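/- **Theorem 1.** Let $N\ge 1$, let $a,b,b'$ be real parameters, let $M\in\frac12\mathbb Z_{\ge 0}$, and let $\mathcal S$ be the space spanned by the kets $|s_1,\dots,s_N\rangle$ with $s_i\in\{-M,-M+1,\dots,M\}$. Let $S_{ij}$ exchange $s_i$ and $s_j$, let $S_i$ replace $s_i$ by $-s_i$, and put $\tilde S_{ij}=S_iS_jS_{ij}$. Likewise let $K_{ij}$ and $K_i$ act on functions of $\mathbf x=(x_1,\dots,x_N)$ by exchanging $x_i$ with $x_j$ and by $x_i\mapsto -x_i$, and put $\tilde K_{ij}=K_iK_jK_{ij}$ and $x_{ij}^\pm=x_i\pm x_j$. Let $\mathfrak D$ be the algebra of linear differential operators with smooth complex coefficients on the set of $\mathbf x\in\mathbb R^N$ with $x_i\ne0$ and $x_i\neq\pm x_j$ for all $i\ne j$; let $\mathfrak D\otimes\mathfrak K$ be the algebra of finite sums of operators $D\,K_{\alpha_1}\cdots K_{\alpha_r}$, where $D\in\mathfrak D$ and each $\alpha_k$ is an index $i$ or a pair $ij$, multiplied by composition, and define $\mathfrak D\otimes\mathfrak S$ in the same way with the operators $S_{ij},S_i$ on $\mathcal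 S$ in place of $K_{ij},K_i$ (they commute with $\mathfrak D$). Let ${}^*:\mathfrak D\otimes\mathfrak K\to\mathfrak D\otimes\mathfrak S$ be the linear map with $(D\,K_{\alpha_1}\cdots K_{\alpha_r})^*=(-1)^r D\,S_{\alpha_r}\cdots S_{\alpha_1}$. Consider the hyperbolic Dunkl operators of type $B_N$ $$J_i=\partial_{x_i}-a\sum_{j\ne i}\Big[(1+\coth x_{ij}^-)K_{ij}+(1+\coth x_{ij}^+)\tilde K_{ij}\Big]-\big[b(1+\coth x_i)+b'(1+\tanh x_i)\big]K_i+2a\sum_{j<i}K_{ij},$$ the power sums $I_p=\sum_{i=1}^N J_i^{2p}$, and the Hamiltonian of the hyperbolic $B_N$ Sutherland spin model $$H^*=-\sum_i\partial_{x_i}^2+2a\sum_{i<j}\Big[\sinh^{-2}x_{ij}^-\,(a+S_{ij})+\sinh^{-2}x_{ij}^+\,(a+\tilde S_{ij})\Big]+b\sum_i\sinh^{-2}x_i\,(b+S_i)-b'\sum_i\cosh^{-2}x_i\,(b'+S_i).$$ Then the Dunkl operators $J_1,\dots,J_N$ commute with each other, $H^*=-I_1^*$, and the operators $I_1^*,\dots,I_N^*$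 form a complete family of commuting integrals of motion of $H^*$: $[H^*,I_p^*]=0$ and $[I_p^*,I_q^*]=0$ for $1\le p,q\le N$, and $I_1^*,\dots,I_N^*$ are algebraically independent, i.e. $Q(I_1^*,\dots,I_N^*)\ne0$ for every nonzero polynomial $Q$ in $N$ variables with complex coefficients. Thus the model is integrable. -/

import Mathlib

open scoped ContDiff TensorProduct

noncomputable section

namespace Sutherland

/-! ### Smooth functions away from the walls, and differential operators -/

/-- The configuration space: `ℝ^N` without the walls `x_i = 0`, `x_i = x_j`, `x_i = -x_j`, that is,
the open set on which all coefficients of the model are smooth. -/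
def regularSet (N : ℕ) : Set (Fin N → ℝ) :=
  {x | (∀ i, x i ≠ 0) ∧ ∀ i j, i ≠ j → x i - x j ≠ 0 ∧ x i + x j ≠ 0}

theorem isOpen_regularSet (N : ℕ) : IsOpen (regularSet N) := by
  simp only [regularSet, Set.ofPred_and, Set.ofPred_forall]
  refine (isOpen_iInter_of_finite fun i => ?_).inter
    (isOpen_iInter_of_finite fun i => isOpen_iInter_of_finite fun j =>
      isOpen_iInter_of_finite fun _ => ?_)
  · exact isOpen_ne_fun (continuous_apply i) continuous_const
  · exact (isOpen_ne_fun ((continuous_apply i).sub (continuous_apply j)) continuous_const).inter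
      (isOpen_ne_fun ((continuous_apply i).add (continuous_apply j)) continuous_const)

/-- Extension by zero of a function on the configuration space to all of `ℝ^N`. -/
def zeroExt {N : ℕ} (f : regularSet N → ℂ) : (Fin N → ℝ) → ℂ :=
  Function.extend Subtype.val f 0

theorem zeroExt_apply {N : ℕ} (f : regularSet N → ℂ) (x : regularSet N) :
    zeroExt f x = f x :=
  Subtype.val_injective.extend_apply _ _ _

/-- The complex valued `C^∞` functions on the configuration space. -/
def smoothFunctions (N : ℕ) : Subalgebra ℂ (regularSet N → ℂ) where
  carrier := {f | ContDiffOn ℝ ∞ (zeroExt f) (regularSet N)}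
  mul_mem' {f g} hf hg := (ContDiffOn.mul hf hg).congr fun x hx => by
    simp [zeroExt_apply _ ⟨x, hx⟩]
  add_mem' {f g} hf hg := (ContDiffOn.add hf hg).congr fun x hx => by
    simp [zeroExt_apply _ ⟨x, hx⟩]
  algebraMap_mem' c := (contDiffOn_const (c := c)).congr fun x hx => by
    simp [zeroExt_apply _ ⟨x, hx⟩]

/-- The algebra of smooth functions on the configuration space, as a type. -/
def Smooth (N : ℕ) : Type := smoothFunctions N

instance (N : ℕ) : CommRing (Smooth N) :=
  inferInstanceAs (CommRing (smoothFunctions N))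

instance (N : ℕ) : Algebra ℂ (Smooth N) :=
  inferInstanceAs (Algebra ℂ (smoothFunctions N))

theorem Smooth.ext {N : ℕ} {f g : Smooth N} (h : ∀ x, f.1 x = g.1 x) : f = g :=
  Subtype.ext (funext h)

/-- The value of `∂f/∂x_i`. -/
def partialFun {N : ℕ} (i : Fin N) (f : regularSet N → ℂ) : regularSet N → ℂ :=
  fun x => fderiv ℝ (zeroExt f) x (Pi.single i 1)

theorem partialFun_mem {N : ℕ} (i : Fin N) {f : regularSet N → ℂ} (hf : f ∈ smoothFunctions N) :
    partialFun i f ∈ smoothFunctions N := by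
  have h : ContDiffOn ℝ ∞ (fun x => fderiv ℝ (zeroExt f) x (Pi.single i 1)) (regularSet N) :=
    (ContDiffOn.fderiv_of_isOpen (m := ∞) hf (isOpen_regularSet N) (by simp)).clm_apply
      contDiffOn_const
  exact h.congr fun x hx => by rw [zeroExt_apply _ ⟨x, hx⟩]; rfl

theorem differentiableAt_zeroExt {N : ℕ} (f : Smooth N) {x : Fin N → ℝ} (hx : x ∈ regularSet N) :
    DifferentiableAt ℝ (zeroExt f.1) x :=
  ((ContDiffOn.contDiffAt f.2 ((isOpen_regularSet N).mem_nhds hx)).differentiableAt (by simp))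

/-- The partial derivative `∂_{x_i}` as an operator on smooth functions. -/
def partialD {N : ℕ} (i : Fin N) : Module.End ℂ (Smooth N) where
  toFun f := ⟨partialFun i f.1, partialFun_mem i f.2⟩
  map_add' f g := by
    refine Smooth.ext fun x => ?_
    have e : zeroExt (f + g).1 =ᶠ[nhds x.1] fun y => zeroExt f.1 y + zeroExt g.1 y := by
      filter_upwards [(isOpen_regularSet N).mem_nhds x.2] with y hy
      simp only [zeroExt_apply _ ⟨y, hy⟩]
      rfl
    simp only [partialFun, e.fderiv_eq]
    rw [fderiv_fun_add (differentiableAt_zeroExt f x.2) (differentiableAt_zeroExt g x.2)]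
    rfl
  map_smul' c f := by
    refine Smooth.ext fun x => ?_
    have e : zeroExt (c • f).1 =ᶠ[nhds x.1] fun y => c • zeroExt f.1 y := by
      filter_upwards [(isOpen_regularSet N).mem_nhds x.2] with y hy
      simp only [zeroExt_apply _ ⟨y, hy⟩]
      rfl
    simp only [partialFun, e.fderiv_eq]
    rw [fderiv_fun_const_smul (differentiableAt_zeroExt f x.2)]
    rfl

/-- The algebra `𝔇` of linear differential operators with smooth coefficients, generated by the
multiplication operators and the partial derivatives. -/
def diffOps (N : ℕ) : Subalgebra ℂ (Module.End ℂ (Smooth N)) :=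
  Algebra.adjoin ℂ (Set.range (fun f : Smooth N => Algebra.lmul ℂ (Smooth N) f) ∪
    Set.range (fun i : Fin N => partialD i))

/-- The algebra `𝔇`, as a type. -/
def DiffOp (N : ℕ) : Type := diffOps N

instance (N : ℕ) : Ring (DiffOp N) := inferInstanceAs (Ring (diffOps N))

instance (N : ℕ) : Algebra ℂ (DiffOp N) := inferInstanceAs (Algebra ℂ (diffOps N))

/-- The operator `∂_{x_i}` in `𝔇`. -/
def dx {N : ℕ} (i : Fin N) : DiffOp N :=
  ⟨partialD i, Algebra.subset_adjoin (Or.inr ⟨i, rfl⟩)⟩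

/-- Multiplication by a smooth function, as an element of `𝔇`. -/
def mulOp {N : ℕ} (f : Smooth N) : DiffOp N :=
  ⟨Algebra.lmul ℂ (Smooth N) f, Algebra.subset_adjoin (Or.inl ⟨f, rfl⟩)⟩

/-! ### The Weyl group of type `B_N` -/

/-- The hyperoctahedral group: pairs (signs, permutation), with the permutations acting on the
signs by permuting them. -/
abbrev WeylGroup (N : ℕ) : Type :=
  SemidirectProduct (Fin N → ℤˣ) (Equiv.Perm (Fin N))
    (mulAutArrow (G := Equiv.Perm (Fin N)) (A := Fin N) (M := ℤˣ))

/-- The transposition of the `i`-th and the `j`-th coordinate. -/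
def wSwap {N : ℕ} (i j : Fin N) : WeylGroup N := SemidirectProduct.inr (Equiv.swap i j)

/-- The change of sign of the `i`-th coordinate. -/
def wFlip {N : ℕ} (i : Fin N) : WeylGroup N := SemidirectProduct.inl (Function.update 1 i (-1))

theorem mul_left_apply {N : ℕ} (v w : WeylGroup N) (i : Fin N) :
    (v * w).left i = v.left i * w.left (v.right⁻¹ i) := rfl

/-- The parity of `w`: the homomorphism that is `-1` at all transpositions and sign changes. -/
def parity {N : ℕ} : WeylGroup N →* ℤˣ where
  toFun w := (∏ i, w.left i) * Equiv.Perm.sign w.right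
  map_one' := by simp
  map_mul' v w := by
    have h : ∏ i, w.left (v.right⁻¹ i) = ∏ i, w.left i := Equiv.prod_comp (v.right⁻¹) w.left
    simp only [mul_left_apply, Finset.prod_mul_distrib, h, SemidirectProduct.mul_right, map_mul]
    exact mul_mul_mul_comm _ _ _ _

/-- The action of the Weyl group on `ℝ^N` by signed permutations of the coordinates. -/
def actPoint {N : ℕ} (w : WeylGroup N) : (Fin N → ℝ) →L[ℝ] (Fin N → ℝ) :=
  ContinuousLinearMap.pi fun i =>
    (((w.left i : ℤ) : ℝ)) • ContinuousLinearMap.proj (w.right⁻¹ i)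

theorem actPoint_apply {N : ℕ} (w : WeylGroup N) (x : Fin N → ℝ) (i : Fin N) :
    actPoint w x i = ((w.left i : ℤ) : ℝ) * x (w.right⁻¹ i) := rfl

theorem actPoint_one {N : ℕ} (x : Fin N → ℝ) : actPoint (1 : WeylGroup N) x = x := by
  ext i; simp [actPoint_apply]

theorem actPoint_mul {N : ℕ} (v w : WeylGroup N) (x : Fin N → ℝ) :
    actPoint (v * w) x = actPoint v (actPoint w x) := by
  ext i
  simp [actPoint_apply, mul_left_apply, mul_assoc]

theorem actPoint_mem {N : ℕ} (w : WeylGroup N) {x : Fin N → ℝ} (hx : x ∈ regularSet N) :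
    actPoint w x ∈ regularSet N := by
  have hs : ∀ i, ((w.left i : ℤ) : ℝ) = 1 ∨ ((w.left i : ℤ) : ℝ) = -1 := fun i => by
    rcases Int.units_eq_one_or (w.left i) with h | h <;> simp [h]
  refine ⟨fun i => ?_, fun i j hij => ?_⟩
  · rw [actPoint_apply]
    rcases hs i with h | h <;> simp [h, hx.1]
  · obtain ⟨h1, h2⟩ := hx.2 (w.right⁻¹ i) (w.right⁻¹ j) (by simpa using hij)
    rw [actPoint_apply, actPoint_apply]
    rcases hs i with h | h <;> rcases hs j with h' | h' <;> rw [h, h'] <;>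
      refine ⟨fun h0 => ?_, fun h0 => ?_⟩ <;>
      first
      | exact h1 (by linarith)
      | exact h2 (by linarith)

/-- The action of the Weyl group on the configuration space. -/
def actReg {N : ℕ} (w : WeylGroup N) (x : regularSet N) : regularSet N :=
  ⟨actPoint w x.1, actPoint_mem w x.2⟩

theorem zeroExt_comp {N : ℕ} (w : WeylGroup N) (f : regularSet N → ℂ) {x : Fin N → ℝ}
    (hx : x ∈ regularSet N) :
    zeroExt (fun y => f (actReg w y)) x = zeroExt f (actPoint w x) := by
  rw [zeroExt_apply _ ⟨x, hx⟩]
  exact (zeroExt_apply f (actReg w ⟨x, hx⟩)).symm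

/-- The action of the Weyl group on functions, `(K_w f)(x) = f (w⁻¹ x)`. -/
def opK {N : ℕ} : WeylGroup N →* Module.End ℂ (Smooth N) where
  toFun w :=
    { toFun := fun f => ⟨fun x => f.1 (actReg w⁻¹ x),
        (ContDiffOn.comp (t := regularSet N) f.2 (actPoint w⁻¹).contDiff.contDiffOn
          fun _ hx => actPoint_mem _ hx).congr fun _ hx => zeroExt_comp _ _ hx⟩
      map_add' := fun _ _ => rfl
      map_smul' := fun _ _ => rfl }
  map_one' := by
    refine LinearMap.ext fun f => Smooth.ext fun x => ?_
    exact congrArg f.1 (Subtype.ext (by simp [actReg, actPoint_one]))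
  map_mul' v w := by
    refine LinearMap.ext fun f => Smooth.ext fun x => ?_
    exact congrArg f.1 (Subtype.ext (by simp [actReg, actPoint_mul]))

theorem opK_apply {N : ℕ} (w : WeylGroup N) (f : Smooth N) (x : regularSet N) :
    (opK w f).1 x = f.1 (actReg w⁻¹ x) := rfl

theorem opK_mul_cancel {N : ℕ} (w : WeylGroup N) : opK w * opK w⁻¹ = 1 := by
  rw [← map_mul, mul_inv_cancel, map_one]

theorem opK_inv_mul_cancel {N : ℕ} (w : WeylGroup N) : opK w⁻¹ * opK w = 1 := by
  rw [← map_mul, inv_mul_cancel, map_one]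

theorem opK_conj_lmul {N : ℕ} (w : WeylGroup N) (f : Smooth N) :
    opK w * Algebra.lmul ℂ (Smooth N) f * opK w⁻¹ = Algebra.lmul ℂ (Smooth N) (opK w f) := by
  refine LinearMap.ext fun g => Smooth.ext fun x => ?_
  have h : actReg w (actReg w⁻¹ x) = x :=
    Subtype.ext (by simp [actReg, ← actPoint_mul, actPoint_one])
  change f.1 (actReg w⁻¹ x) * g.1 (actReg w⁻¹⁻¹ (actReg w⁻¹ x)) = f.1 (actReg w⁻¹ x) * g.1 x
  rw [inv_inv, h]

theorem opK_conj_partialD {N : ℕ} (w : WeylGroup N) (i : Fin N) :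
    opK w * partialD i * opK w⁻¹ =
      (((w.left (w.right i) : ℤ) : ℂ)) • partialD (w.right i) := by
  refine LinearMap.ext fun g => Smooth.ext fun x => ?_
  have h : actPoint w (actPoint w⁻¹ x.1) = x.1 := by
    simp [← actPoint_mul, actPoint_one]
  have hs : actPoint w (Pi.single i 1) =
      ((w.left (w.right i) : ℤ) : ℝ) • (Pi.single (w.right i) 1 : Fin N → ℝ) := by
    ext j
    rw [actPoint_apply]
    rcases eq_or_ne j (w.right i) with rfl | hj
    · simp
    · have : w.right⁻¹ j ≠ i := fun h' => hj (by rw [← h']; simp)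
      rw [Pi.single_eq_of_ne this, Pi.smul_apply, Pi.single_eq_of_ne hj]
      simp
  have e : zeroExt (opK w⁻¹ g).1 =ᶠ[nhds (actPoint w⁻¹ x.1)]
      fun y => zeroExt g.1 (actPoint w y) := by
    filter_upwards [(isOpen_regularSet N).mem_nhds (actPoint_mem w⁻¹ x.2)] with y hy
    rw [← zeroExt_comp w g.1 hy]
    conv_rhs => rw [← inv_inv w]
    rfl
  have hd : HasFDerivAt (fun y => zeroExt g.1 (actPoint w y))
      ((fderiv ℝ (zeroExt g.1) x.1).comp (actPoint w)) (actPoint w⁻¹ x.1) := by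
    refine HasFDerivAt.comp _ ?_ (actPoint w).hasFDerivAt
    rw [h]
    exact (differentiableAt_zeroExt g x.2).hasFDerivAt
  change fderiv ℝ (zeroExt (opK w⁻¹ g).1) (actPoint w⁻¹ x.1) (Pi.single i 1) =
    ((w.left (w.right i) : ℤ) : ℂ) * fderiv ℝ (zeroExt g.1) x.1 (Pi.single (w.right i) 1)
  rw [e.fderiv_eq, hd.fderiv, ContinuousLinearMap.comp_apply, hs, map_smul, Complex.real_smul]
  norm_cast

theorem opK_conj_mem {N : ℕ} (w : WeylGroup N) {D : Module.End ℂ (Smooth N)}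
    (hD : D ∈ diffOps N) : opK w * D * opK w⁻¹ ∈ diffOps N := by
  induction hD using Algebra.adjoin_induction with
  | mem D hD =>
    rcases hD with ⟨f, rfl⟩ | ⟨i, rfl⟩
    · simp only [opK_conj_lmul]
      exact Algebra.subset_adjoin (Or.inl ⟨_, rfl⟩)
    · simp only [opK_conj_partialD]
      exact (diffOps N).smul_mem (Algebra.subset_adjoin (Or.inr ⟨_, rfl⟩)) _
  | algebraMap c =>
    rw [← Algebra.commutes, mul_assoc, opK_mul_cancel, mul_one]
    exact (diffOps N).algebraMap_mem c
  | add D E _ _ hD hE =>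
    rw [mul_add, add_mul]
    exact (diffOps N).add_mem hD hE
  | mul D E _ _ hD hE =>
    have : opK w * (D * E) * opK w⁻¹ = (opK w * D * opK w⁻¹) * (opK w * E * opK w⁻¹) := by
      have h := opK_inv_mul_cancel w
      simp only [mul_assoc]
      rw [← mul_assoc (opK w⁻¹) (opK w), h, one_mul]
    rw [this]
    exact (diffOps N).mul_mem hD hE

/-- The natural action of the Weyl group on differential operators, `w • D = K_w D K_w⁻¹`. -/
instance weylAction (N : ℕ) : MulSemiringAction (WeylGroup N) (DiffOp N) where
  smul w D := ⟨opK w * D.1 * opK w⁻¹, opK_conj_mem w D.2⟩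
  one_smul D := Subtype.ext (by
    change opK 1 * D.1 * opK 1⁻¹ = D.1
    simp)
  mul_smul v w D := Subtype.ext (by
    change opK (v * w) * D.1 * opK (v * w)⁻¹ = opK v * (opK w * D.1 * opK w⁻¹) * opK v⁻¹
    simp only [mul_inv_rev, map_mul, mul_assoc])
  smul_zero w := Subtype.ext (by
    change opK w * 0 * opK w⁻¹ = 0
    simp)
  smul_add w D E := Subtype.ext (by
    change opK w * (D.1 + E.1) * opK w⁻¹ = opK w * D.1 * opK w⁻¹ + opK w * E.1 * opK w⁻¹
    rw [mul_add, add_mul])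
  smul_one w := Subtype.ext (by
    change opK w * 1 * opK w⁻¹ = 1
    rw [mul_one, opK_mul_cancel])
  smul_mul w D E := Subtype.ext (by
    change opK w * (D.1 * E.1) * opK w⁻¹ = (opK w * D.1 * opK w⁻¹) * (opK w * E.1 * opK w⁻¹)
    have h := opK_inv_mul_cancel w
    simp only [mul_assoc]
    rw [← mul_assoc (opK w⁻¹) (opK w), h, one_mul])

theorem smul_val {N : ℕ} (w : WeylGroup N) (D : DiffOp N) :
    (w • D).1 = opK w * D.1 * opK w⁻¹ := rfl

/-! ### The algebra `𝔇 ⊗ 𝔎` -/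

/-- The algebra `𝔇 ⊗ 𝔎` of differential operators with coordinate permutations and sign changes:
finite sums `∑_w D_w K_w`, multiplied by the rule `K_w D = (K_w D K_w⁻¹) K_w` of the composition of
operators. -/
abbrev DK (N : ℕ) : Type := SkewMonoidAlgebra (DiffOp N) (WeylGroup N)

/-- A differential operator, as an element of `𝔇 ⊗ 𝔎`. -/
def ofD {N : ℕ} (D : DiffOp N) : DK N := SkewMonoidAlgebra.single 1 D

/-- The element `K_w` of `𝔇 ⊗ 𝔎`. -/
def elK {N : ℕ} (w : WeylGroup N) : DK N := SkewMonoidAlgebra.single w 1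

/-- The operator on smooth functions that an element `∑_w D_w K_w` of `𝔇 ⊗ 𝔎` stands for; products
in `𝔇 ⊗ 𝔎` are compositions of operators. -/
def toOperator (N : ℕ) : DK N →+* Module.End ℂ (Smooth N) :=
  SkewMonoidAlgebra.liftNCRingHom (diffOps N).val.toRingHom opK (by
    intro D w
    change opK w * D.1 * opK w⁻¹ * opK w = opK w * D.1
    rw [mul_assoc, opK_inv_mul_cancel, mul_one])

/-- The permutation operator `K_{ij}`. -/
def K₂ {N : ℕ} (i j : Fin N) : DK N := elK (wSwap i j)

/-- The sign reversing operator `K_i`. -/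
def K₁ {N : ℕ} (i : Fin N) : DK N := elK (wFlip i)

/-- The operator `K_i K_j K_{ij}`. -/
def Kt {N : ℕ} (i j : Fin N) : DK N := K₁ i * K₁ j * K₂ i j

/-! ### Spin -/

/-- The spin space of `N` particles of spin `M = m / 2`, with basis the kets `|s_1, …, s_N⟩`. The
value `s = -M + k` of a spin is represented by `k ∈ {0, …, m}`, so that `s ↦ -s` is `Fin.rev`. -/
abbrev Spin (N m : ℕ) : Type := (Fin N → Fin (m + 1)) →₀ ℂ

/-- The operator `S_{ij}`, which exchanges the spins `s_i` and `s_j`. -/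
def S₂ {N : ℕ} (m : ℕ) (i j : Fin N) : Module.End ℂ (Spin N m) :=
  Finsupp.lmapDomain ℂ ℂ fun s k => s (Equiv.swap i j k)

/-- The operator `S_i`, which changes the sign of the spin `s_i`. -/
def S₁ {N : ℕ} (m : ℕ) (i : Fin N) : Module.End ℂ (Spin N m) :=
  Finsupp.lmapDomain ℂ ℂ fun s => Function.update s i (s i).rev

/-- The operator `S_i S_j S_{ij}`. -/
def St {N : ℕ} (m : ℕ) (i j : Fin N) : Module.End ℂ (Spin N m) :=
  S₁ m i * S₁ m j * S₂ m i j

/-- The action of a sign on a single spin. -/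
def signSpin {m : ℕ} (e : ℤˣ) (s : Fin (m + 1)) : Fin (m + 1) := if e = 1 then s else s.rev

theorem signSpin_mul {m : ℕ} (e e' : ℤˣ) (s : Fin (m + 1)) :
    signSpin (e * e') s = signSpin e (signSpin e' s) := by
  rcases Int.units_eq_one_or e with rfl | rfl <;> rcases Int.units_eq_one_or e' with rfl | rfl <;>
    simp [signSpin]

/-- The action of the Weyl group on kets. -/
def actSpin {N m : ℕ} (w : WeylGroup N) (s : Fin N → Fin (m + 1)) : Fin N → Fin (m + 1) :=
  fun i => signSpin (w.left i) (s (w.right⁻¹ i))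

/-- The representation of the Weyl group on the spin space, `S_w |s⟩ = |w s⟩`. -/
def opS {N : ℕ} (m : ℕ) : WeylGroup N →* Module.End ℂ (Spin N m) where
  toFun w := Finsupp.lmapDomain ℂ ℂ (actSpin w)
  map_one' := by
    have : actSpin (m := m) (1 : WeylGroup N) = id := by
      ext s i; simp [actSpin, signSpin]
    rw [this, Finsupp.lmapDomain_id]; rfl
  map_mul' v w := by
    have : actSpin (m := m) (v * w) = actSpin v ∘ actSpin w := by
      ext s i; simp [actSpin, mul_left_apply, signSpin_mul]
    rw [this, Finsupp.lmapDomain_comp]; rfl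

/-- `opS` takes the transposition of two coordinates to `S_{ij}`. -/
theorem opS_wSwap {N : ℕ} (m : ℕ) (i j : Fin N) : opS m (wSwap i j) = S₂ m i j := by
  have : actSpin (m := m) (wSwap i j) = fun s k => s (Equiv.swap i j k) := by
    ext s k; simp [actSpin, signSpin, wSwap]
  change Finsupp.lmapDomain ℂ ℂ _ = _
  rw [this]; rfl

/-- `opS` takes the change of sign of a coordinate to `S_i`. -/
theorem opS_wFlip {N : ℕ} (m : ℕ) (i : Fin N) : opS m (wFlip i) = S₁ m i := by
  have : actSpin (m := m) (wFlip i) = fun s => Function.update s i (s i).rev := by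
    ext s k
    rcases eq_or_ne k i with rfl | hk
    · simp [actSpin, signSpin, wFlip]
    · simp [actSpin, signSpin, wFlip, hk]
  change Finsupp.lmapDomain ℂ ℂ _ = _
  rw [this]; rfl

/-- The algebra of differential operators with coefficients acting on the spin space (it contains
`𝔇 ⊗ 𝔖`). Its elements act on the spin wave functions `C^∞ ⊗ Spin`. -/
abbrev DS (N m : ℕ) : Type := DiffOp N ⊗[ℂ] Module.End ℂ (Spin N m)

/-- The star mapping: `(D K_w)^* = (-1)^r D S_{w⁻¹}` if `w` is a product of `r` generators, extended
additively. Since all generators are involutions, `S_{w⁻¹}` is `S_{α_r} ⋯ S_{α_1}` if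
`w` is the product of the generators with indices `α_1, …, α_r`. -/
def starMap {N : ℕ} (m : ℕ) (A : DK N) : DS N m :=
  A.sum fun w D => D ⊗ₜ[ℂ] (((parity w : ℤ) : ℂ) • opS m w⁻¹)

/-- The two kinds of generators `K_{ij}` (with `i ≠ j`) and `K_i` of `𝔎`. -/
inductive Gen (N : ℕ) : Type
  | swap (i j : Fin N) (h : i ≠ j) : Gen N
  | flip (i : Fin N) : Gen N

/-- The generator of `𝔎` with a given index. -/
def Gen.opK {N : ℕ} : Gen N → DK N
  | .swap i j _ => K₂ i j
  | .flip i => K₁ i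

/-- The generator of `𝔖` with a given index. -/
def Gen.opS {N : ℕ} (m : ℕ) : Gen N → Module.End ℂ (Spin N m)
  | .swap i j _ => S₂ m i j
  | .flip i => S₁ m i

/-- The defining formula of the star mapping,
`(D K_{α_1} ⋯ K_{α_r})^* = (-1)^r D S_{α_r} ⋯ S_{α_1}`. -/
theorem starMap_word {N : ℕ} (m : ℕ) (D : DiffOp N) (l : List (Gen N)) :
    starMap m (ofD D * (l.map Gen.opK).prod) =
      D ⊗ₜ[ℂ] ((-1 : ℂ) ^ l.length • (l.reverse.map (Gen.opS m)).prod) := by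
  have key : ∀ l : List (Gen N), ∃ w : WeylGroup N, (l.map Gen.opK).prod = elK w ∧
      ((parity w : ℤ) : ℂ) = (-1) ^ l.length ∧
      Sutherland.opS m w⁻¹ = (l.reverse.map (Gen.opS m)).prod := by
    intro l
    induction l with
    | nil => exact ⟨1, by simp [elK], by simp, by simp⟩
    | cons α l ih =>
      obtain ⟨w, h1, h2, h3⟩ := ih
      obtain ⟨v, k1, k2, k3⟩ : ∃ v : WeylGroup N, α.opK = elK v ∧ parity v = -1 ∧
          Sutherland.opS m v⁻¹ = α.opS m := by
        cases α with
        | swap i j h =>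
          have hinv : (wSwap i j)⁻¹ = wSwap i j := by
            rw [wSwap, ← map_inv, Equiv.swap_inv]
          exact ⟨wSwap i j, rfl, by simp [parity, wSwap, Equiv.Perm.sign_swap h],
            by rw [hinv]; exact opS_wSwap m i j⟩
        | flip i =>
          have hinv : (wFlip i)⁻¹ = wFlip i := by
            rw [wFlip, ← map_inv]
            congr 1
            ext k
            rcases eq_or_ne k i with rfl | hk
            · simp
            · simp [hk]
          exact ⟨wFlip i, rfl,
            by simp [parity, wFlip, Finset.prod_update_of_mem],
            by rw [hinv]; exact opS_wFlip m i⟩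
      refine ⟨v * w, ?_, ?_, ?_⟩
      · rw [List.map_cons, List.prod_cons, h1, k1]
        simp [elK]
      · rw [map_mul, k2, List.length_cons, pow_succ, ← h2]
        simp
      · rw [mul_inv_rev, map_mul, h3, k3]
        simp
  obtain ⟨w, h1, h2, h3⟩ := key l
  rw [h1, ← h2, ← h3]
  have : ofD D * elK w = SkewMonoidAlgebra.single w D := by
    simp [ofD, elK]
  rw [this, starMap, SkewMonoidAlgebra.sum_single_index]
  simp

/-! ### The coefficients -/

/-- A real function on `ℝ^N` that is smooth on the configuration space, as an element of `Smooth`. -/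
def ofRealFun {N : ℕ} (g : (Fin N → ℝ) → ℝ) (hg : ContDiffOn ℝ ∞ g (regularSet N)) : Smooth N :=
  ⟨fun x => (g x.1 : ℂ), (Complex.ofRealCLM.contDiff.comp_contDiffOn hg).congr fun x hx => by
    rw [zeroExt_apply _ ⟨x, hx⟩]; rfl⟩

/-- Smoothness of functions of a linear form that does not vanish on the configuration space (or
that vanishes identically). -/
theorem contDiffOn_of_form {N : ℕ} (u : (Fin N → ℝ) →L[ℝ] ℝ)
    (hu : u = 0 ∨ ∀ x ∈ regularSet N, u x ≠ 0) {g : ℝ → ℝ} (hg : ContDiffOn ℝ ∞ g {0}ᶜ) :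
    ContDiffOn ℝ ∞ (fun x => g (u x)) (regularSet N) := by
  rcases hu with rfl | hu
  · exact contDiffOn_const (c := g 0)
  · exact hg.comp u.contDiff.contDiffOn fun x hx => hu x hx

/-- The linear form `x_i`. -/
def form₁ {N : ℕ} (i : Fin N) : (Fin N → ℝ) →L[ℝ] ℝ := ContinuousLinearMap.proj i

theorem form₁_ne {N : ℕ} (i : Fin N) : ∀ x ∈ regularSet N, form₁ i x ≠ 0 := fun _ hx => hx.1 i

theorem minus_ne {N : ℕ} (i j : Fin N) :
    form₁ i - form₁ j = 0 ∨ ∀ x ∈ regularSet N, (form₁ i - form₁ j) x ≠ 0 := by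
  rcases eq_or_ne i j with rfl | h
  · exact Or.inl (sub_self _)
  · exact Or.inr fun x hx => (hx.2 i j h).1

theorem plus_ne {N : ℕ} (i j : Fin N) :
    form₁ i + form₁ j = 0 ∨ ∀ x ∈ regularSet N, (form₁ i + form₁ j) x ≠ 0 := by
  refine Or.inr fun x hx => ?_
  rcases eq_or_ne i j with rfl | h
  · change x i + x i ≠ 0
    have := hx.1 i
    intro h0
    exact this (by linarith)
  · exact (hx.2 i j h).2

theorem contDiffOn_coth : ContDiffOn ℝ ∞ (fun t : ℝ => 1 + Real.cosh t / Real.sinh t) {0}ᶜ :=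
  contDiffOn_const.add (Real.contDiff_cosh.contDiffOn.div Real.contDiff_sinh.contDiffOn
    fun t ht => by simpa [Real.sinh_eq_zero] using ht)

theorem contDiffOn_invSinhSq : ContDiffOn ℝ ∞ (fun t : ℝ => (Real.sinh t ^ 2)⁻¹) {0}ᶜ :=
  (Real.contDiff_sinh.contDiffOn.pow 2).inv fun t ht => by simpa [Real.sinh_eq_zero] using ht

/-- `1 + coth (x_i - x_j)`. -/
def cothMinus {N : ℕ} (i j : Fin N) : Smooth N :=
  ofRealFun (fun x => 1 + Real.cosh (x i - x j) / Real.sinh (x i - x j))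
    (contDiffOn_of_form _ (minus_ne i j) contDiffOn_coth)

/-- `1 + coth (x_i + x_j)`. -/
def cothPlus {N : ℕ} (i j : Fin N) : Smooth N :=
  ofRealFun (fun x => 1 + Real.cosh (x i + x j) / Real.sinh (x i + x j))
    (contDiffOn_of_form _ (plus_ne i j) contDiffOn_coth)

/-- `1 + coth x_i`. -/
def cothOne {N : ℕ} (i : Fin N) : Smooth N :=
  ofRealFun (fun x => 1 + Real.cosh (x i) / Real.sinh (x i))
    (contDiffOn_of_form _ (Or.inr (form₁_ne i)) contDiffOn_coth)

/-- `1 + tanh x_i`. -/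
def tanhOne {N : ℕ} (i : Fin N) : Smooth N :=
  ofRealFun (fun x => 1 + Real.sinh (x i) / Real.cosh (x i))
    (contDiffOn_of_form (g := fun t => 1 + Real.sinh t / Real.cosh t) _ (Or.inr (form₁_ne i))
      (contDiffOn_const.add (Real.contDiff_sinh.contDiffOn.div Real.contDiff_cosh.contDiffOn
        fun t _ => (Real.cosh_pos t).ne')))

/-- `sinh⁻² (x_i - x_j)`. -/
def invSinhSqMinus {N : ℕ} (i j : Fin N) : Smooth N :=
  ofRealFun (fun x => (Real.sinh (x i - x j) ^ 2)⁻¹)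
    (contDiffOn_of_form _ (minus_ne i j) contDiffOn_invSinhSq)

/-- `sinh⁻² (x_i + x_j)`. -/
def invSinhSqPlus {N : ℕ} (i j : Fin N) : Smooth N :=
  ofRealFun (fun x => (Real.sinh (x i + x j) ^ 2)⁻¹)
    (contDiffOn_of_form _ (plus_ne i j) contDiffOn_invSinhSq)

/-- `sinh⁻² x_i`. -/
def invSinhSqOne {N : ℕ} (i : Fin N) : Smooth N :=
  ofRealFun (fun x => (Real.sinh (x i) ^ 2)⁻¹)
    (contDiffOn_of_form _ (Or.inr (form₁_ne i)) contDiffOn_invSinhSq)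

/-- `cosh⁻² x_i`. -/
def invCoshSqOne {N : ℕ} (i : Fin N) : Smooth N :=
  ofRealFun (fun x => (Real.cosh (x i) ^ 2)⁻¹)
    (contDiffOn_of_form (g := fun t => (Real.cosh t ^ 2)⁻¹) _ (Or.inr (form₁_ne i))
      ((Real.contDiff_cosh.contDiffOn.pow 2).inv fun t _ => pow_ne_zero 2 (Real.cosh_pos t).ne'))

/-! ### The Dunkl operators, the integrals of motion and the Hamiltonian -/

/-- The hyperbolic Dunkl operator `J_i` of type `B_N` with parameters `a, b, b'`. -/
def dunklJ {N : ℕ} (a b b' : ℝ) (i : Fin N) : DK N :=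
  ofD (dx i)
    - (a : ℂ) • (∑ j ∈ Finset.univ.erase i,
        (ofD (mulOp (cothMinus i j)) * K₂ i j + ofD (mulOp (cothPlus i j)) * Kt i j))
    - ofD (mulOp ((b : ℂ) • cothOne i + (b' : ℂ) • tanhOne i)) * K₁ i
    + (2 * a : ℂ) • ∑ j ∈ Finset.Iio i, K₂ i j

/-- The power sum `I_p = ∑_i J_i^{2p}`. -/
def powerSum (N : ℕ) (a b b' : ℝ) (p : ℕ) : DK N := ∑ i, dunklJ a b b' i ^ (2 * p)

/-- The image `I_p^*` of the power sum `I_p` under the star mapping. -/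
def starIntegral (N m : ℕ) (a b b' : ℝ) (p : ℕ) : DS N m := starMap m (powerSum N a b b' p)

/-- The Hamiltonian `H^*` of the hyperbolic `B_N` Sutherland spin model of spin `m / 2`. -/
def hamiltonian (N m : ℕ) (a b b' : ℝ) : DS N m :=
  -(∑ i, (dx i ^ 2) ⊗ₜ[ℂ] 1)
    + (2 * a : ℂ) • (∑ i, ∑ j ∈ Finset.Ioi i,
        (mulOp (invSinhSqMinus i j) ⊗ₜ[ℂ] ((a : ℂ) • 1 + S₂ m i j)
          + mulOp (invSinhSqPlus i j) ⊗ₜ[ℂ] ((a : ℂ) • 1 + St m i j)))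
    + (b : ℂ) • (∑ i, mulOp (invSinhSqOne i) ⊗ₜ[ℂ] ((b : ℂ) • 1 + S₁ m i))
    - (b' : ℂ) • (∑ i, mulOp (invCoshSqOne i) ⊗ₜ[ℂ] ((b' : ℂ) • 1 + S₁ m i))

/-! ### Algebraic independence of commuting elements -/

/-- The value of a polynomial at a tuple of elements of an algebra (the factors of each monomial
are multiplied in increasing order; for commuting elements the order does not matter). -/
def polyValue {A : Type*} [Ring A] [Algebra ℂ A] {n : ℕ} (T : Fin n → A)
    (Q : MvPolynomial (Fin n) ℂ) : A :=
  ∑ d ∈ Q.support, Q.coeff d • (List.ofFn fun k => T k ^ d k).prod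

/-- The elements `T_1, …, T_n` satisfy no nontrivial polynomial relation. -/
def AlgIndependent {A : Type*} [Ring A] [Algebra ℂ A] {n : ℕ} (T : Fin n → A) : Prop :=
  ∀ Q : MvPolynomial (Fin n) ℂ, polyValue T Q = 0 → Q = 0

end Sutherland

end

open scoped ContDiff TensorProduct

noncomputable section

namespace Sutherland

/-! ### Values of smooth functions -/

section Values

variable {N : ℕ}

/-! Write J_i = ∂_i − ∑_{j≠i} R_ij − P_i, where R_ij is `exch` and P_i is `pot` (`dunklJ_eq`). The
sum 2a ∑_{j<i} K_ij is absorbed by replacing the constant 1 beside coth(x_i − e x_j), e = ±1, with a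
sign, called `shift`. This sign is the limit of coth(x_i − e x_j) as x_1 ≫ x_2 ≫ … ≫ x_N ≫ 0, so it
obeys the same symmetry and addition law as coth. Every relation below then reduces to the addition
law of coth, its analogue for signs, or an elementary identity between coth and tanh.

Commutativity. [J_i, J_j] splits into a two-body part and one contribution for each third index k.
The latter vanishes by a Yang–Baxter relation (`exch_yang_baxter`, `lie_exch_triple`), the former by
relations of type B_2 (`lie_dx_exch`, `lie_exch_exch`, `lie_exch_pot`). The result is
`dunklJ_commute`.

Descent to spin. The star mapping reverses products of reflections and is not multiplicative, but
(AB)* = A*B* when B commutes with all K_w (`starMap_mul`). The power sums have this property because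
the J_i and K_w satisfy relations of a degenerate affine Hecke algebra: K_{i,i+1} J_i = J_{i+1}
K_{i,i+1} − 2a and K_N J_N = −J_N K_N − 2(b+b'), while K_{i,i+1} commutes with the J_k of other
indices and K_N with J_k for k < N. Symmetric functions of the J_i² therefore commute with the whole
Weyl group (`elK_commute_powerSum`), and the I_p* inherit commutativity.

Hamiltonian. In ∑ J_i² the products R_ij R_ik with i, j, k distinct cancel in cyclic triples
(`exch_cyclic`), the mixed terms R P cancel in pairs, and the squares and derivatives give the
potentials of −H* (`powerSum_one`).

Independence. J_i differs from ∂_i by an operator of order 0, so I_p* has leading part ∑ ∂_i^{2p}.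
The top weighted part of a polynomial relation between the I_p* would be a relation between power
sums in the squares of N variables. No such relation exists, by Newton's identities and the fact
that a surjective endomorphism of a Noetherian ring is injective (`aeval_evenPsum_injective`). -/

@[simp] theorem Smooth.add_val (f g : Smooth N) (x : regularSet N) :
    (f + g).1 x = f.1 x + g.1 x := rfl

@[simp] theorem Smooth.sub_val (f g : Smooth N) (x : regularSet N) :
    (f - g).1 x = f.1 x - g.1 x := rfl

@[simp] theorem Smooth.mul_val (f g : Smooth N) (x : regularSet N) :
    (f * g).1 x = f.1 x * g.1 x := rfl

@[simp] theorem Smooth.neg_val (f : Smooth N) (x : regularSet N) :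
    (-f).1 x = -f.1 x := rfl

@[simp] theorem Smooth.smul_val (c : ℂ) (f : Smooth N) (x : regularSet N) :
    (c • f).1 x = c * f.1 x := rfl

@[simp] theorem Smooth.one_val (x : regularSet N) : (1 : Smooth N).1 x = 1 := rfl

@[simp] theorem Smooth.zero_val (x : regularSet N) : (0 : Smooth N).1 x = 0 := rfl

theorem DiffOp.ext {D E : DiffOp N} (h : ∀ f, D.1 f = E.1 f) : D = E :=
  Subtype.ext (LinearMap.ext h)

theorem mulOp_apply (f g : Smooth N) : (mulOp f).1 g = f * g := rfl

end Values

/-! ### Multiplication operators and derivatives -/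

section Operators

variable {N : ℕ}

/-- Multiplication by functions, as a homomorphism of algebras. -/
def mulHom (N : ℕ) : Smooth N →ₐ[ℂ] DiffOp N :=
  (Algebra.lmul ℂ (Smooth N)).codRestrict (diffOps N)
    fun f => Algebra.subset_adjoin (Or.inl ⟨f, rfl⟩)

theorem mulOp_mul (f g : Smooth N) : mulOp (f * g) = mulOp f * mulOp g := map_mul (mulHom N) f g

theorem mulOp_add (f g : Smooth N) : mulOp (f + g) = mulOp f + mulOp g := map_add (mulHom N) f g

theorem mulOp_neg (f : Smooth N) : mulOp (-f) = -mulOp f := map_neg (mulHom N) f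

theorem mulOp_smul (c : ℂ) (f : Smooth N) : mulOp (c • f) = c • mulOp f := map_smul (mulHom N) c f

theorem mulOp_zero : mulOp (0 : Smooth N) = 0 := map_zero (mulHom N)

theorem mulOp_one : mulOp (1 : Smooth N) = 1 := map_one (mulHom N)

theorem mulOp_comm (f g : Smooth N) : mulOp f * mulOp g = mulOp g * mulOp f := by
  rw [← mulOp_mul, mul_comm, mulOp_mul]

theorem mulOp_injective : Function.Injective (mulOp (N := N)) := fun f g h => by
  have := congrArg (fun D : DiffOp N => D.1 1) h
  simpa [mulOp_apply] using this

theorem zeroExt_mul (f g : Smooth N) :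
    zeroExt (f * g).1 = fun y => zeroExt f.1 y * zeroExt g.1 y := by
  funext y
  by_cases hy : y ∈ regularSet N
  · simp only [zeroExt_apply _ ⟨y, hy⟩]; rfl
  · have : ∀ h : regularSet N → ℂ, zeroExt h y = 0 := fun h =>
      Function.extend_apply' _ _ _ fun ⟨z, hz⟩ => hy (hz ▸ z.2)
    simp [this]

theorem partialD_val (i : Fin N) (f : Smooth N) (x : regularSet N) :
    (partialD i f).1 x = fderiv ℝ (zeroExt f.1) x.1 (Pi.single i 1) := rfl

theorem partialD_mul (i : Fin N) (f g : Smooth N) :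
    partialD i (f * g) = partialD i f * g + f * partialD i g := by
  refine Smooth.ext fun x => ?_
  rw [Smooth.add_val, Smooth.mul_val, Smooth.mul_val, partialD_val, partialD_val, partialD_val,
    zeroExt_mul, fderiv_fun_mul (differentiableAt_zeroExt f x.2) (differentiableAt_zeroExt g x.2)]
  simp only [_root_.add_apply, _root_.smul_apply, zeroExt_apply,
    smul_eq_mul]
  ring

theorem partialD_comm (i j : Fin N) (f : Smooth N) :
    partialD i (partialD j f) = partialD j (partialD i f) := by
  refine Smooth.ext fun x => ?_
  have key : ∀ i j : Fin N, (partialD i (partialD j f)).1 x =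
      fderiv ℝ (fderiv ℝ (zeroExt f.1)) x.1 (Pi.single i 1) (Pi.single j 1) := by
    intro i j
    have e : zeroExt (partialD j f).1 =ᶠ[nhds x.1]
        fun y => fderiv ℝ (zeroExt f.1) y (Pi.single j 1) := by
      filter_upwards [(isOpen_regularSet N).mem_nhds x.2] with y hy
      rw [zeroExt_apply _ ⟨y, hy⟩]; rfl
    have hd : DifferentiableAt ℝ (fderiv ℝ (zeroExt f.1)) x.1 :=
      ((ContDiffOn.fderiv_of_isOpen (m := ∞) f.2 (isOpen_regularSet N) (by simp)).contDiffAt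
        ((isOpen_regularSet N).mem_nhds x.2)).differentiableAt (by simp)
    rw [partialD_val, e.fderiv_eq, fderiv_clm_apply hd (differentiableAt_const _)]
    simp
  rw [key, key]
  have hc : ContDiffAt ℝ ∞ (zeroExt f.1) x.1 :=
    ContDiffOn.contDiffAt f.2 ((isOpen_regularSet N).mem_nhds x.2)
  exact (hc.isSymmSndFDerivAt (by
    simpa using WithTop.coe_le_coe.2 (le_top (a := (2 : ℕ∞))))).eq _ _

theorem dx_comm (i j : Fin N) : (dx i : DiffOp N) * dx j = dx j * dx i :=
  DiffOp.ext fun f => partialD_comm i j f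

theorem dx_mul_mulOp (i : Fin N) (f : Smooth N) :
    dx i * mulOp f = mulOp (partialD i f) + mulOp f * dx i :=
  DiffOp.ext fun g => partialD_mul i f g

theorem smul_mulOp (w : WeylGroup N) (f : Smooth N) : w • mulOp f = mulOp (opK w f) :=
  Subtype.ext (opK_conj_lmul w f)

theorem smul_dx (w : WeylGroup N) (i : Fin N) :
    w • (dx i : DiffOp N) = ((w.left (w.right i) : ℤ) : ℂ) • dx (w.right i) :=
  Subtype.ext (opK_conj_partialD w i)

/-- The derivative of a real function along a coordinate. -/
theorem partialD_eq_of_hasDerivAt (i : Fin N) {f g : Smooth N} (u v : (Fin N → ℝ) → ℝ)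
    (hf : ∀ x, f.1 x = u x.1) (hg : ∀ x, g.1 x = v x.1)
    (h : ∀ x ∈ regularSet N, HasDerivAt (fun t : ℝ => u (x + t • Pi.single i 1)) (v x) 0) :
    partialD i f = g := by
  refine Smooth.ext fun x => ?_
  have hl : HasDerivAt (fun t : ℝ => x.1 + t • (Pi.single i 1 : Fin N → ℝ)) (Pi.single i 1) 0 := by
    simpa using ((hasDerivAt_id (0 : ℝ)).smul_const (Pi.single i (1 : ℝ))).const_add x.1
  have h1 : HasDerivAt (fun t : ℝ => zeroExt f.1 (x.1 + t • Pi.single i 1))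
      ((partialD i f).1 x) 0 := by
    have := HasFDerivAt.comp_hasDerivAt (f := fun t : ℝ => x.1 + t • (Pi.single i 1 : Fin N → ℝ))
      (x := (0 : ℝ)) (l := zeroExt f.1) (l' := fderiv ℝ (zeroExt f.1) x.1)
      (by simpa using (differentiableAt_zeroExt f x.2).hasFDerivAt) hl
    exact this
  have h2 : HasDerivAt (fun t : ℝ => zeroExt f.1 (x.1 + t • Pi.single i 1)) (v x.1 : ℂ) 0 := by
    refine (h x.1 x.2).ofReal_comp.congr_of_eventuallyEq ?_
    have : ∀ᶠ t : ℝ in nhds 0, x.1 + t • (Pi.single i 1 : Fin N → ℝ) ∈ regularSet N :=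
      hl.continuousAt.eventually_mem ((isOpen_regularSet N).mem_nhds (by simp))
    filter_upwards [this] with t ht
    rw [zeroExt_apply _ ⟨_, ht⟩, hf]
  rw [hg]
  exact h1.unique h2

end Operators

/-! ### Multiplication in `𝔇 ⊗ 𝔎` -/

section Terms

variable {N : ℕ}

/-- The operator `f K_w`. -/
def tm (f : Smooth N) (w : WeylGroup N) : DK N := SkewMonoidAlgebra.single w (mulOp f)

theorem tm_add (f g : Smooth N) (w : WeylGroup N) : tm (f + g) w = tm f w + tm g w := by
  rw [tm, mulOp_add, SkewMonoidAlgebra.single_add]; rfl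

theorem tm_neg (f : Smooth N) (w : WeylGroup N) : tm (-f) w = -tm f w := by
  rw [tm, mulOp_neg, SkewMonoidAlgebra.single_neg]; rfl

theorem tm_sub (f g : Smooth N) (w : WeylGroup N) : tm (f - g) w = tm f w - tm g w := by
  rw [sub_eq_add_neg, tm_add, tm_neg, sub_eq_add_neg]

theorem tm_zero (w : WeylGroup N) : tm (0 : Smooth N) w = 0 := by
  rw [tm, mulOp_zero, SkewMonoidAlgebra.single_zero]

theorem tm_one_one : tm (1 : Smooth N) 1 = 1 := by rw [tm, mulOp_one]; rfl

theorem tm_smul (c : ℂ) (f : Smooth N) (w : WeylGroup N) : tm (c • f) w = c • tm f w := by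
  rw [tm, mulOp_smul, ← SkewMonoidAlgebra.smul_single]; rfl

theorem tm_one (w : WeylGroup N) : tm (1 : Smooth N) w = elK w := by rw [tm, mulOp_one]; rfl

theorem tm_mul (f g : Smooth N) (v w : WeylGroup N) :
    tm f v * tm g w = tm (f * opK v g) (v * w) := by
  simp only [tm, SkewMonoidAlgebra.single_mul_single, smul_mulOp, mulOp_mul]

theorem ofD_mulOp_mul_elK (f : Smooth N) (w : WeylGroup N) : ofD (mulOp f) * elK w = tm f w := by
  simp [ofD, elK, tm]

theorem elK_mul (v w : WeylGroup N) : elK v * elK w = elK (v * w) := by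
  simp [elK]

theorem elK_mul_tm (v w : WeylGroup N) (f : Smooth N) :
    elK v * tm f w = tm (opK v f) (v * w) := by
  rw [← tm_one, tm_mul, one_mul]

theorem tm_mul_elK (v w : WeylGroup N) (f : Smooth N) :
    tm f v * elK w = tm f (v * w) := by
  rw [← tm_one, tm_mul]
  congr 1
  exact Smooth.ext fun x => by simp [opK_apply]

theorem ofD_mul (D E : DiffOp N) : ofD (D * E) = ofD D * ofD E := by
  simp [ofD]

theorem ofD_mul_single (D E : DiffOp N) (w : WeylGroup N) :
    ofD D * SkewMonoidAlgebra.single w E = SkewMonoidAlgebra.single w (D * E) := by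
  simp [ofD]

theorem single_mul_ofD (D E : DiffOp N) (w : WeylGroup N) :
    SkewMonoidAlgebra.single w E * ofD D = SkewMonoidAlgebra.single w (E * w • D) := by
  simp [ofD]

theorem elK_mul_ofD (w : WeylGroup N) (D : DiffOp N) :
    elK w * ofD D = ofD (w • D) * elK w := by
  simp [ofD, elK]

/-- `∂_i f K_w = (∂_i f) K_w + f ∂_i K_w`. -/
theorem ofD_dx_mul_tm (i : Fin N) (f : Smooth N) (w : WeylGroup N) :
    ofD (dx i) * tm f w = tm (partialD i f) w + SkewMonoidAlgebra.single w (mulOp f * dx i) := by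
  rw [tm, ofD_mul_single, dx_mul_mulOp, SkewMonoidAlgebra.single_add]; rfl

theorem tm_mul_ofD_dx (i : Fin N) (f : Smooth N) (w : WeylGroup N) :
    tm f w * ofD (dx i) = ((w.left (w.right i) : ℤ) : ℂ) •
      SkewMonoidAlgebra.single w (mulOp f * dx (w.right i)) := by
  rw [tm, single_mul_ofD, smul_dx, mul_smul_comm, ← SkewMonoidAlgebra.smul_single]

end Terms

/-! ### The hyperbolic cotangent -/

section Coth

/-- The hyperbolic cotangent. -/
def coth (t : ℝ) : ℝ := Real.cosh t / Real.sinh t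

theorem coth_neg (t : ℝ) : coth (-t) = -coth t := by
  simp [coth, div_neg]

theorem coth_unit_mul (e : ℤˣ) (t : ℝ) : coth (((e : ℤ) : ℝ) * t) = ((e : ℤ) : ℝ) * coth t := by
  rcases Int.units_eq_one_or e with rfl | rfl <;> simp [coth_neg]

theorem sinh_ne_zero {t : ℝ} (h : t ≠ 0) : Real.sinh t ≠ 0 := by
  simpa [Real.sinh_eq_zero] using h

theorem coth_add_mul {p q : ℝ} (hp : p ≠ 0) (hq : q ≠ 0) (hpq : p + q ≠ 0) :
    coth (p + q) * (coth p + coth q) = 1 + coth p * coth q := by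
  have h1 := sinh_ne_zero hp
  have h2 := sinh_ne_zero hq
  have h3 := sinh_ne_zero hpq
  simp only [coth]
  field_simp
  rw [Real.sinh_add, Real.cosh_add]
  ring

theorem one_sub_coth_sq {t : ℝ} (ht : t ≠ 0) : 1 - coth t ^ 2 = -(Real.sinh t ^ 2)⁻¹ := by
  have h1 := sinh_ne_zero ht
  simp only [coth]
  field_simp
  have := Real.cosh_sq t
  linarith

theorem hasDerivAt_coth {t : ℝ} (ht : t ≠ 0) : HasDerivAt coth (-(Real.sinh t ^ 2)⁻¹) t := by
  have h1 := sinh_ne_zero ht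
  refine ((Real.hasDerivAt_cosh t).div (Real.hasDerivAt_sinh t) h1).congr_deriv ?_
  rw [inv_eq_one_div, ← neg_div]
  congr 1
  have := Real.cosh_sq t
  linarith

theorem units_mul_self_cast (e : ℤˣ) : ((e : ℤ) : ℝ) * ((e : ℤ) : ℝ) = 1 := by
  rcases Int.units_eq_one_or e with rfl | rfl <;> simp

theorem regularSet_sub_ne {N : ℕ} (x : regularSet N) {i j : Fin N} (h : i ≠ j) (e : ℤˣ) :
    x.1 i - ((e : ℤ) : ℝ) * x.1 j ≠ 0 := by
  rcases Int.units_eq_one_or e with rfl | rfl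
  · simpa using (x.2.2 i j h).1
  · simpa using (x.2.2 i j h).2

end Coth

/-! ### Reflections -/

section Reflections

variable {N : ℕ}

/-- The reflection that exchanges `x_i` with `e x_j`. -/
def tau (e : ℤˣ) (i j : Fin N) : WeylGroup N :=
  ⟨fun k => if k = i ∨ k = j then e else 1, Equiv.swap i j⟩

theorem tau_one (i j : Fin N) : tau 1 i j = wSwap i j := by
  refine SemidirectProduct.ext ?_ rfl
  funext k
  simp [tau, wSwap]

theorem tau_neg_one {i j : Fin N} (h : i ≠ j) : tau (-1) i j = wFlip i * wFlip j * wSwap i j := by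
  refine SemidirectProduct.ext ?_ ?_
  · funext k
    simp only [tau, wFlip, wSwap, mul_left_apply]
    by_cases h1 : k = i
    · subst h1; simp [h]
    · by_cases h2 : k = j
      · subst h2; simp [h1]
      · simp [h1, h2]
  · simp [tau, wFlip, wSwap]

theorem tau_comm (e : ℤˣ) (i j : Fin N) : tau e i j = tau e j i := by
  refine SemidirectProduct.ext ?_ (Equiv.swap_comm i j)
  funext k
  simp [tau, or_comm]

theorem tau_mul_self (e : ℤˣ) (i j : Fin N) : tau e i j * tau e i j = 1 := by
  refine SemidirectProduct.ext ?_ (Equiv.swap_mul_self i j)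
  funext k
  simp only [tau, mul_left_apply, Equiv.swap_inv, SemidirectProduct.one_left, Pi.one_apply]
  by_cases h1 : k = i
  · subst h1; simp
  · by_cases h2 : k = j
    · subst h2; simp
    · simp [Equiv.swap_apply_of_ne_of_ne h1 h2, h1, h2]

theorem tau_inv (e : ℤˣ) (i j : Fin N) : (tau e i j)⁻¹ = tau e i j :=
  inv_eq_of_mul_eq_one_left (tau_mul_self e i j)

theorem wFlip_mul_self (i : Fin N) : wFlip i * wFlip i = 1 := by
  rw [wFlip, ← map_mul, ← map_one SemidirectProduct.inl]
  congr 1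
  funext k
  by_cases h : k = i
  · subst h; simp
  · simp [h]

theorem wFlip_inv (i : Fin N) : (wFlip i)⁻¹ = wFlip i :=
  inv_eq_of_mul_eq_one_left (wFlip_mul_self i)

/-- The roots x_i − e x_j, x_j − d x_k and x_i − ed x_k form a system of type A_2, where each
rotation of order 3 is a product of two reflections in three ways. With `tau_mul_tau'` this lists
the three ways for one rotation, which allows products of exchange terms to be collected by group
element. -/
theorem tau_mul_tau (e d : ℤˣ) {i j k : Fin N} (hij : i ≠ j) (hik : i ≠ k) (hjk : j ≠ k) :
    tau d j k * tau (e * d) i k = tau e i j * tau d j k := by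
  refine SemidirectProduct.ext ?_ ?_
  · funext l
    simp only [tau, mul_left_apply, Equiv.swap_inv]
    by_cases h1 : l = i
    · subst h1; simp [hij, hik, hjk, Equiv.swap_apply_of_ne_of_ne]
    · by_cases h2 : l = j
      · subst h2
        simp [hij, hij.symm, hik, hjk, mul_comm e d, ← mul_assoc]
      · by_cases h3 : l = k
        · subst h3
          simp [hij.symm, hik.symm, hjk.symm, hjk, Equiv.swap_apply_of_ne_of_ne]
        · simp [h1, h2, h3, Equiv.swap_apply_of_ne_of_ne]
  · change Equiv.swap j k * Equiv.swap i k = Equiv.swap i j * Equiv.swap j k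
    rw [Equiv.mul_swap_eq_swap_mul, Equiv.swap_apply_of_ne_of_ne hij hik, Equiv.swap_apply_right]

theorem tau_mul_tau' (e d : ℤˣ) {i j k : Fin N} (hij : i ≠ j) (hik : i ≠ k) (hjk : j ≠ k) :
    tau (e * d) i k * tau e i j = tau e i j * tau d j k := by
  have h := tau_mul_tau d (e * d) hjk hij.symm hik.symm
  rw [mul_left_comm, Int.units_mul_self, mul_one, tau_comm (e * d) k i, tau_comm e j i] at h
  rw [h, tau_mul_tau e d hij hik hjk]

theorem tau_commute (e d : ℤˣ) {i j k l : Fin N} (hik : i ≠ k) (hil : i ≠ l) (hjk : j ≠ k)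
    (hjl : j ≠ l) : tau e i j * tau d k l = tau d k l * tau e i j := by
  refine SemidirectProduct.ext ?_ ?_
  · funext n
    simp only [tau, mul_left_apply, Equiv.swap_inv]
    by_cases h1 : n = i
    · subst h1; simp [hik, hil, hjk, hjl, Equiv.swap_apply_of_ne_of_ne]
    · by_cases h2 : n = j
      · subst h2; simp [hik, hil, hjk, hjl, Equiv.swap_apply_of_ne_of_ne]
      · by_cases h3 : n = k
        · subst h3; simp [hik.symm, hil.symm, hjk.symm, hjl.symm, Equiv.swap_apply_of_ne_of_ne]
        · by_cases h4 : n = l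
          · subst h4; simp [hik.symm, hil.symm, hjk.symm, hjl.symm, Equiv.swap_apply_of_ne_of_ne]
          · simp [h1, h2, h3, h4, Equiv.swap_apply_of_ne_of_ne]
  · change Equiv.swap i j * Equiv.swap k l = Equiv.swap k l * Equiv.swap i j
    rw [Equiv.mul_swap_eq_swap_mul, Equiv.swap_apply_of_ne_of_ne hik.symm hjk.symm,
      Equiv.swap_apply_of_ne_of_ne hil.symm hjl.symm]

theorem wFlip_mul_tau (e : ℤˣ) {i j : Fin N} (h : i ≠ j) :
    wFlip i * tau e i j = tau e i j * wFlip j := by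
  refine SemidirectProduct.ext ?_ ?_
  · funext l
    simp only [tau, wFlip, mul_left_apply, Equiv.swap_inv, SemidirectProduct.left_inl,
      SemidirectProduct.right_inl]
    by_cases h1 : l = i
    · subst h1; simp [mul_comm]
    · by_cases h2 : l = j
      · subst h2; simp [h1, h]
      · simp [h1, h2, Equiv.swap_apply_of_ne_of_ne]
  · simp [tau, wFlip]

theorem wFlip_mul_tau_neg (e : ℤˣ) {i j : Fin N} (h : i ≠ j) :
    wFlip i * tau (-e) i j = tau e i j * wFlip i := by
  refine SemidirectProduct.ext ?_ ?_
  · funext l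
    simp only [tau, wFlip, mul_left_apply, Equiv.swap_inv, SemidirectProduct.left_inl,
      SemidirectProduct.right_inl]
    by_cases h1 : l = i
    · subst h1; simp [h.symm]
    · by_cases h2 : l = j
      · subst h2; simp [h1]
      · simp [h1, h2, Equiv.swap_apply_of_ne_of_ne]
  · simp [tau, wFlip]

theorem wFlip_mul_tau_of_ne (e : ℤˣ) {i j k : Fin N} (hj : i ≠ j) (hk : i ≠ k) :
    wFlip i * tau e j k = tau e j k * wFlip i := by
  refine SemidirectProduct.ext ?_ ?_
  · funext l
    simp only [tau, wFlip, mul_left_apply, Equiv.swap_inv, SemidirectProduct.left_inl,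
      SemidirectProduct.right_inl]
    by_cases h1 : l = i
    · subst h1; simp [hj, hk, Equiv.swap_apply_of_ne_of_ne]
    · by_cases h2 : l = j
      · subst h2; simp [h1, hk.symm]
      · by_cases h3 : l = k
        · subst h3; simp [h1, hj.symm]
        · simp [h1, h2, h3, Equiv.swap_apply_of_ne_of_ne]
  · simp [tau, wFlip]

theorem wFlip_comm (i j : Fin N) : wFlip i * wFlip j = wFlip j * wFlip i := by
  rw [wFlip, wFlip, ← map_mul, ← map_mul, mul_comm]

/-- The reflected point. -/
theorem actReg_tau_apply (e : ℤˣ) (i j k : Fin N) (x : regularSet N) :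
    (actReg (tau e i j) x).1 k =
      if k = i then ((e : ℤ) : ℝ) * x.1 j else if k = j then ((e : ℤ) : ℝ) * x.1 i else x.1 k := by
  change actPoint (tau e i j) x.1 k = _
  rw [actPoint_apply]
  simp only [tau, Equiv.swap_inv]
  by_cases h1 : k = i
  · subst h1; simp
  · by_cases h2 : k = j
    · subst h2; simp [h1]
    · simp [h1, h2, Equiv.swap_apply_of_ne_of_ne]

theorem opK_tau_val (e : ℤˣ) (i j : Fin N) (f : Smooth N) (x : regularSet N) :
    (opK (tau e i j) f).1 x = f.1 (actReg (tau e i j) x) := by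
  rw [opK_apply, tau_inv]

theorem actReg_wFlip_apply (i k : Fin N) (x : regularSet N) :
    (actReg (wFlip i) x).1 k = if k = i then -x.1 i else x.1 k := by
  change actPoint (wFlip i) x.1 k = _
  rw [actPoint_apply]
  by_cases h1 : k = i
  · subst h1; simp [wFlip]
  · simp [h1, wFlip]

theorem opK_wFlip_val (i : Fin N) (f : Smooth N) (x : regularSet N) :
    (opK (wFlip i) f).1 x = f.1 (actReg (wFlip i) x) := by
  rw [opK_apply, wFlip_inv]

end Reflections

/-! ### The exchange terms of the Dunkl operators -/

section Exchange

variable {N : ℕ}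

/-- The constant that is added to `coth (x_i - e x_j)` in the Dunkl operators. -/
def shift (e : ℤˣ) (i j : Fin N) : ℝ := if e = 1 then (if i < j then 1 else -1) else 1

/-- The limit, for x_1 ≫ … ≫ x_N ≫ 0, of coth(x_j − e x_i) = −e coth(x_i − e x_j). -/
theorem shift_swap (e : ℤˣ) {i j : Fin N} (h : i ≠ j) :
    shift e j i = -(((e : ℤ) : ℝ) * shift e i j) := by
  rcases Int.units_eq_one_or e with rfl | rfl
  · rcases lt_or_gt_of_ne h with h | h <;> simp [shift, h, not_lt.2 h.le]
  · simp [shift]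

/-- The same limit of e times the addition law of coth for p = x_i − e x_j and e q, with q = x_j − d
x_k, for which p + e q = x_i − ed x_k. -/
theorem shift_cycle (e d : ℤˣ) {i j k : Fin N} (_ : i ≠ j) (_ : i ≠ k) (_ : j ≠ k) :
    ((e : ℤ) : ℝ) + shift e i j * shift d j k - ((e : ℤ) : ℝ) * shift (e * d) i k * shift e i j
      - shift d j k * shift (e * d) i k = 0 := by
  rcases Int.units_eq_one_or e with rfl | rfl <;> rcases Int.units_eq_one_or d with rfl | rfl
  · simp only [shift, mul_one, if_true]
    split_ifs <;> first | (exfalso; omega) | norm_num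
  · simp [shift]
  · simp [shift]
  · simp only [shift]
    split_ifs <;> simp_all

/-- The coefficient `coth (x_i - e x_j) ± 1`. -/
def phi (e : ℤˣ) (i j : Fin N) : Smooth N :=
  if e = 1 then (if i < j then cothMinus i j else cothMinus i j - (2 : ℂ) • 1) else cothPlus i j

theorem phi_val (e : ℤˣ) (i j : Fin N) (x : regularSet N) :
    (phi e i j).1 x = ((coth (x.1 i - ((e : ℤ) : ℝ) * x.1 j) + shift e i j : ℝ) : ℂ) := by
  have hm : (cothMinus i j).1 x = ((1 + coth (x.1 i - x.1 j) : ℝ) : ℂ) := rfl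
  have hp : (cothPlus i j).1 x = ((1 + coth (x.1 i + x.1 j) : ℝ) : ℂ) := rfl
  rcases Int.units_eq_one_or e with rfl | rfl
  · by_cases h : i < j
    · simp [phi, shift, h, hm, add_comm]
    · simp only [phi, shift, h, if_true, if_false, Smooth.sub_val, Smooth.smul_val, hm,
        Smooth.one_val]
      push_cast
      simp only [one_mul]
      ring
  · simp [phi, shift, hp, add_comm]

/-- The exchange term of the Dunkl operator `J_i` with the coordinate `x_j`. -/
def exch (a : ℝ) (i j : Fin N) : DK N := ∑ e : ℤˣ, tm ((a : ℂ) • phi e i j) (tau e i j)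

/-- This is the coefficient of the rotation τ_e(ij) τ_d(jk) in the Yang–Baxter relation for the
exchange terms. -/
theorem phi_yang_baxter (a : ℂ) (e d : ℤˣ) {i j k : Fin N}
    (hij : i ≠ j) (hik : i ≠ k) (hjk : j ≠ k) :
    (a • phi e i j) * opK (tau e i j) (a • phi d j k) +
      (a • phi (e * d) i k) * opK (tau (e * d) i k) (a • phi e j i) -
      (a • phi d j k) * opK (tau d j k) (a • phi (e * d) i k) = 0 := by
  refine Smooth.ext fun x => ?_
  have hee := units_mul_self_cast e
  have hdd := units_mul_self_cast d
  have hc := shift_cycle e d hij hik hjk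
  have hs := shift_swap e hij
  have n1 := regularSet_sub_ne x hij e
  have n2 := regularSet_sub_ne x hjk d
  have n3 := regularSet_sub_ne x hik (e * d)
  simp only [Smooth.add_val, Smooth.sub_val, Smooth.mul_val, Smooth.zero_val, Smooth.smul_val,
    opK_tau_val, phi_val, actReg_tau_apply, if_pos, if_neg hij.symm, if_neg hik.symm,
    if_neg hjk.symm, if_neg hij, if_neg hjk, if_neg hik]
  set E : ℝ := ((e : ℤ) : ℝ) with hE
  set D : ℝ := ((d : ℤ) : ℝ) with hD
  have hED : (((e * d : ℤˣ) : ℤ) : ℝ) = E * D := by simp [hE, hD]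
  rw [hED] at n3 ⊢
  set p := x.1 i - E * x.1 j with hp
  set q := x.1 j - D * x.1 k with hq
  have r1 : E * x.1 i - D * x.1 k = E * (x.1 i - E * D * x.1 k) := by
    linear_combination (D * x.1 k) * hee
  have r2 : x.1 j - E * (E * D * x.1 k) = q := by linear_combination (-D * x.1 k) * hee
  have r3 : x.1 i - E * D * (D * x.1 j) = p := by linear_combination (-E * x.1 j) * hdd
  have r4 : x.1 i - E * D * x.1 k = p + E * q := by rw [hp, hq]; ring
  have hq0 : E * q ≠ 0 := mul_ne_zero (left_ne_zero_of_mul_eq_one hee) n2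
  rw [r1, r2, r3, coth_unit_mul, r4]
  have key := coth_add_mul n1 hq0 (r4 ▸ n3)
  rw [coth_unit_mul] at key
  rw [← hE] at key ⊢
  -- Terms of degree one in coth cancel by the symmetry of the signs. The quadratic terms are the
  -- addition law, whose constant E is cancelled by `shift_cycle`.
  have goal : (coth p + shift e i j) * (E * coth (p + E * q) + shift d j k) +
      (coth (p + E * q) + shift (e * d) i k) * (coth q + shift e j i) -
      (coth q + shift d j k) * (coth p + shift (e * d) i k) = 0 := by
    rw [hs]
    linear_combination hc + E * key + (coth p * coth q - coth (p + E * q) * coth q) * hee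
  have := congrArg (fun t : ℝ => a * a * (t : ℂ)) goal
  push_cast at this ⊢
  linear_combination this

end Exchange

/-! ### Three-body relations between exchange terms -/

section ThreeBody

variable {N : ℕ}

/-- The coefficient of τ_e(ij) τ_d(ik) in the cyclic relation. The mechanism is that of
`phi_yang_baxter`, with the signs taken in the order j, i, k. -/
theorem phi_cyclic (a : ℂ) (e d : ℤˣ) {i j k : Fin N}
    (hij : i ≠ j) (hik : i ≠ k) (hjk : j ≠ k) :
    (a • phi e i j) * opK (tau e i j) (a • phi d i k) +
      (a • phi (e * d) j k) * opK (tau (e * d) j k) (a • phi e j i) +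
      (a • phi d k i) * opK (tau d k i) (a • phi (e * d) k j) = 0 := by
  refine Smooth.ext fun x => ?_
  have hee := units_mul_self_cast e
  have hdd := units_mul_self_cast d
  have hc := shift_cycle e d hij.symm hjk hik
  have hs1 := shift_swap e hij
  have hs2 := shift_swap d hik
  have hs3 := shift_swap (e * d) hjk
  have n1 := regularSet_sub_ne x hij e
  have n2 := regularSet_sub_ne x hjk (e * d)
  have n3 := regularSet_sub_ne x hik d
  simp only [Smooth.add_val, Smooth.mul_val, Smooth.zero_val, Smooth.smul_val,
    opK_tau_val, phi_val, actReg_tau_apply, if_pos, if_neg hij.symm, if_neg hik.symm,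
    if_neg hjk.symm, if_neg hij, if_neg hjk, if_neg hik]
  have hED : (((e * d : ℤˣ) : ℤ) : ℝ) = ((e : ℤ) : ℝ) * ((d : ℤ) : ℝ) := by simp
  have c1 := coth_unit_mul e
  have c2 := coth_unit_mul d
  rw [hED] at n2 hs3 ⊢
  generalize ((e : ℤ) : ℝ) = E at *
  generalize ((d : ℤ) : ℝ) = D at *
  set p := x.1 i - E * x.1 j with hp
  set q := x.1 j - E * D * x.1 k with hq
  have r1 : E * x.1 j - D * x.1 k = E * q := by
    linear_combination (D * x.1 k) * hee
  have r2 : E * D * x.1 k - E * x.1 i = -(E * (p + E * q)) := by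
    linear_combination (-E * D * x.1 k) * hee
  have r3 : D * x.1 i - E * D * x.1 j = D * p := by rw [hp]; ring
  have r4 : x.1 i - D * x.1 k = p + E * q := by linear_combination (D * x.1 k) * hee
  have r5 : x.1 k - D * x.1 i = -(D * (p + E * q)) := by
    linear_combination (-x.1 k) * hdd - D * D * x.1 k * hee
  have hq0 : E * q ≠ 0 := mul_ne_zero (left_ne_zero_of_mul_eq_one hee) n2
  rw [r4] at n3
  have key := coth_add_mul n1 hq0 n3
  rw [r1, r2, r3, r5, coth_neg, coth_neg, c1, c1, c2, c2]
  rw [c1] at key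
  have goal : (coth p + shift e i j) * (E * coth q + shift d i k) +
      (coth q + shift (e * d) j k) * (-(E * coth (p + E * q)) + shift e j i) +
      (-(D * coth (p + E * q)) + shift d k i) * (D * coth p + shift (e * d) k j) = 0 := by
    rw [hs1] at hc ⊢
    rw [hs2, hs3]
    generalize coth (p + E * q) = cs at *
    generalize coth p = cp at *
    generalize coth q = cq at *
    generalize shift e i j = s1 at *
    generalize shift d i k = s2 at *
    generalize shift (e * d) j k = s3 at *
    linear_combination -E * hc - key + (1 - s1 * s2 + E * s1 * s3) * hee +
      (-(cs * cp) + E * cs * s3 - s2 * cp + E * s2 * s3) * hdd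
  have := congrArg (fun t : ℝ => a * a * (t : ℂ)) goal
  push_cast at this ⊢
  linear_combination this

theorem exch_mul_exch (a : ℝ) (i j k l : Fin N) :
    exch a i j * exch a k l = ∑ e : ℤˣ, ∑ d : ℤˣ,
      tm (((a : ℂ) • phi e i j) * opK (tau e i j) ((a : ℂ) • phi d k l))
        (tau e i j * tau d k l) := by
  simp only [exch, Finset.sum_mul_sum, tm_mul]

theorem exch_yang_baxter (a : ℝ) {i j k : Fin N} (hij : i ≠ j) (hik : i ≠ k) (hjk : j ≠ k) :
    exch a i j * exch a j k + exch a i k * exch a j i - exch a j k * exch a i k = 0 := by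
  have h2 : exch a i k * exch a j i = ∑ e : ℤˣ, ∑ d : ℤˣ,
      tm (((a : ℂ) • phi (e * d) i k) * opK (tau (e * d) i k) ((a : ℂ) • phi e j i))
        (tau e i j * tau d j k) := by
    rw [exch_mul_exch, Finset.sum_comm]
    refine Finset.sum_congr rfl fun e _ => ?_
    -- Relabelling one sign as e·d makes the group element of each summand equal to τ_e(ij) τ_d(jk),
    -- so that the three double sums can be compared term by term.
    rw [← Equiv.sum_comp (Equiv.mulLeft e)]
    refine Finset.sum_congr rfl fun d _ => ?_
    rw [Equiv.coe_mulLeft, tau_comm e j i, tau_mul_tau' e d hij hik hjk]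
  have h3 : exch a j k * exch a i k = ∑ e : ℤˣ, ∑ d : ℤˣ,
      tm (((a : ℂ) • phi d j k) * opK (tau d j k) ((a : ℂ) • phi (e * d) i k))
        (tau e i j * tau d j k) := by
    rw [exch_mul_exch, Finset.sum_comm (s := (Finset.univ : Finset ℤˣ)) (t := Finset.univ)
      (f := fun e d => tm (((a : ℂ) • phi d j k) * opK (tau d j k) ((a : ℂ) • phi (e * d) i k))
        (tau e i j * tau d j k))]
    refine Finset.sum_congr rfl fun d _ => ?_
    rw [← Equiv.sum_comp (Equiv.mulRight d)]
    refine Finset.sum_congr rfl fun e _ => ?_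
    rw [Equiv.coe_mulRight, tau_mul_tau e d hij hik hjk]
  rw [h2, h3, exch_mul_exch]
  simp only [← Finset.sum_add_distrib, ← Finset.sum_sub_distrib, ← tm_add, ← tm_sub,
    phi_yang_baxter _ _ _ hij hik hjk, tm_zero, Finset.sum_const_zero]

theorem exch_cyclic (a : ℝ) {i j k : Fin N} (hij : i ≠ j) (hik : i ≠ k) (hjk : j ≠ k) :
    exch a i j * exch a i k + exch a j k * exch a j i + exch a k i * exch a k j = 0 := by
  have h2 : exch a j k * exch a j i = ∑ e : ℤˣ, ∑ d : ℤˣ,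
      tm (((a : ℂ) • phi (e * d) j k) * opK (tau (e * d) j k) ((a : ℂ) • phi e j i))
        (tau e i j * tau d i k) := by
    rw [exch_mul_exch, Finset.sum_comm]
    refine Finset.sum_congr rfl fun e _ => ?_
    rw [← Equiv.sum_comp (Equiv.mulLeft e)]
    refine Finset.sum_congr rfl fun d _ => ?_
    rw [Equiv.coe_mulLeft, tau_mul_tau' e d hij.symm hjk hik, tau_comm e j i]
  have h3 : exch a k i * exch a k j = ∑ e : ℤˣ, ∑ d : ℤˣ,
      tm (((a : ℂ) • phi d k i) * opK (tau d k i) ((a : ℂ) • phi (e * d) k j))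
        (tau e i j * tau d i k) := by
    rw [exch_mul_exch, Finset.sum_comm (s := (Finset.univ : Finset ℤˣ)) (t := Finset.univ)
      (f := fun e d => tm (((a : ℂ) • phi d k i) * opK (tau d k i) ((a : ℂ) • phi (e * d) k j))
        (tau e i j * tau d i k))]
    refine Finset.sum_congr rfl fun d _ => ?_
    rw [← Equiv.sum_comp (Equiv.mulRight d)]
    refine Finset.sum_congr rfl fun e _ => ?_
    rw [Equiv.coe_mulRight, tau_comm d k i, tau_comm (e * d) k j,
      tau_mul_tau e d hij.symm hjk hik, tau_comm e j i]
  rw [h2, h3, exch_mul_exch]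
  simp only [← Finset.sum_add_distrib, ← tm_add,
    phi_cyclic _ _ _ hij hik hjk, tm_zero, Finset.sum_const_zero]

theorem opK_phi_of_ne (e d : ℤˣ) {i j k l : Fin N} (hik : i ≠ k) (hil : i ≠ l) (hjk : j ≠ k)
    (hjl : j ≠ l) : opK (tau e i j) (phi d k l) = phi d k l := by
  refine Smooth.ext fun x => ?_
  simp only [opK_tau_val, phi_val, actReg_tau_apply, if_neg hik.symm, if_neg hil.symm,
    if_neg hjk.symm, if_neg hjl.symm]

theorem exch_commute (a : ℝ) {i j k l : Fin N} (hik : i ≠ k) (hil : i ≠ l) (hjk : j ≠ k)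
    (hjl : j ≠ l) : Commute (exch a i j) (exch a k l) := by
  rw [Commute, SemiconjBy, exch_mul_exch, exch_mul_exch, Finset.sum_comm]
  refine Finset.sum_congr rfl fun d _ => Finset.sum_congr rfl fun e _ => ?_
  rw [map_smul, map_smul, opK_phi_of_ne e d hik hil hjk hjl,
    opK_phi_of_ne d e hik.symm hjk.symm hil.symm hjl.symm, mul_comm,
    tau_commute e d hik hil hjk hjl]

end ThreeBody

/-! ### Two-body terms -/

section TwoBody

variable {N : ℕ}

/-- `± sinh⁻² (x_i - e x_j)`, the derivative of the coefficient `phi`. -/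
def invSq (e : ℤˣ) (i j : Fin N) : Smooth N :=
  if e = 1 then invSinhSqMinus i j else invSinhSqPlus i j

theorem invSq_val (e : ℤˣ) (i j : Fin N) (x : regularSet N) :
    (invSq e i j).1 x = (((Real.sinh (x.1 i - ((e : ℤ) : ℝ) * x.1 j) ^ 2)⁻¹ : ℝ) : ℂ) := by
  have hm : (invSinhSqMinus i j).1 x = (((Real.sinh (x.1 i - x.1 j) ^ 2)⁻¹ : ℝ) : ℂ) := rfl
  have hp : (invSinhSqPlus i j).1 x = (((Real.sinh (x.1 i + x.1 j) ^ 2)⁻¹ : ℝ) : ℂ) := rfl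
  rcases Int.units_eq_one_or e with rfl | rfl
  · simp [invSq, hm]
  · simp [invSq, hp]

theorem partialD_phi_left (e : ℤˣ) {i j : Fin N} (h : i ≠ j) :
    partialD i (phi e i j) = -invSq e i j := by
  refine partialD_eq_of_hasDerivAt i
    (fun y => coth (y i - ((e : ℤ) : ℝ) * y j) + shift e i j)
    (fun y => -(Real.sinh (y i - ((e : ℤ) : ℝ) * y j) ^ 2)⁻¹) (phi_val e i j)
    (fun x => by rw [Smooth.neg_val, invSq_val]; push_cast; rfl) fun x hx => ?_
  have h0 := regularSet_sub_ne ⟨x, hx⟩ h e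
  have h1 : HasDerivAt (fun t : ℝ => (x + t • (Pi.single i 1 : Fin N → ℝ)) i -
      ((e : ℤ) : ℝ) * (x + t • (Pi.single i 1 : Fin N → ℝ)) j) 1 0 := by
    simpa [h.symm] using (((hasDerivAt_id (0 : ℝ)).const_add (x i)).sub_const
      (((e : ℤ) : ℝ) * x j))
  have h2 := (HasDerivAt.comp (0 : ℝ) (h₂ := coth) (h := fun t : ℝ =>
    (x + t • (Pi.single i 1 : Fin N → ℝ)) i -
      ((e : ℤ) : ℝ) * (x + t • (Pi.single i 1 : Fin N → ℝ)) j)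
      (by simpa using hasDerivAt_coth h0) h1).add_const (shift e i j)
  simpa using h2

theorem phi_swap (e : ℤˣ) {i j : Fin N} (h : i ≠ j) :
    phi e j i = -((((e : ℤ) : ℂ)) • phi e i j) := by
  refine Smooth.ext fun x => ?_
  rw [Smooth.neg_val, Smooth.smul_val, phi_val, phi_val, shift_swap e h,
    show x.1 j - ((e : ℤ) : ℝ) * x.1 i = -(((e : ℤ) : ℝ) * (x.1 i - ((e : ℤ) : ℝ) * x.1 j)) by
      linear_combination (-x.1 j) * units_mul_self_cast e, coth_neg, coth_unit_mul]
  push_cast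
  ring

theorem invSq_swap (e : ℤˣ) (i j : Fin N) : invSq e j i = invSq e i j := by
  refine Smooth.ext fun x => ?_
  rw [invSq_val, invSq_val]
  rcases Int.units_eq_one_or e with rfl | rfl
  · rw [← neg_sq, ← Real.sinh_neg]; simp
  · simp [add_comm]

theorem partialD_phi_right (e : ℤˣ) {i j : Fin N} (h : i ≠ j) :
    partialD j (phi e i j) = (((e : ℤ) : ℂ)) • invSq e i j := by
  rw [phi_swap e h.symm, map_neg, map_smul, partialD_phi_left e h.symm, invSq_swap, smul_neg,
    neg_neg]

/-- A single reflection term of the Dunkl operator `J_i`. -/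
def refl (a : ℝ) (e : ℤˣ) (i j : Fin N) : DK N := tm ((a : ℂ) • phi e i j) (tau e i j)

theorem exch_eq_refl (a : ℝ) (i j : Fin N) : exch a i j = refl a 1 i j + refl a (-1) i j := by
  rw [exch, UnitsInt.univ, Finset.sum_pair (by decide)]; rfl

theorem refl_swap (a : ℝ) (e : ℤˣ) {i j : Fin N} (h : i ≠ j) :
    refl a e j i = -(((e : ℤ) : ℂ) • refl a e i j) := by
  rw [refl, phi_swap e h, smul_neg, tm_neg, smul_comm, tm_smul, tau_comm]; rfl

theorem dx_mul_refl_left (a : ℝ) (e : ℤˣ) {i j : Fin N} (h : i ≠ j) :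
    ofD (dx i) * refl a e i j = -tm ((a : ℂ) • invSq e i j) (tau e i j) +
      SkewMonoidAlgebra.single (tau e i j) (mulOp ((a : ℂ) • phi e i j) * dx i) := by
  rw [refl, ofD_dx_mul_tm, map_smul, partialD_phi_left e h, smul_neg, tm_neg]

theorem dx_mul_refl_right (a : ℝ) (e : ℤˣ) {i j : Fin N} (h : i ≠ j) :
    ofD (dx j) * refl a e i j = ((e : ℤ) : ℂ) • tm ((a : ℂ) • invSq e i j) (tau e i j) +
      SkewMonoidAlgebra.single (tau e i j) (mulOp ((a : ℂ) • phi e i j) * dx j) := by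
  rw [refl, ofD_dx_mul_tm, map_smul, partialD_phi_right e h, smul_comm, tm_smul]

theorem refl_mul_dx_left (a : ℝ) (e : ℤˣ) (i j : Fin N) :
    refl a e i j * ofD (dx i) = ((e : ℤ) : ℂ) •
      SkewMonoidAlgebra.single (tau e i j) (mulOp ((a : ℂ) • phi e i j) * dx j) := by
  rw [refl, tm_mul_ofD_dx]
  simp [tau]

theorem refl_mul_dx_right (a : ℝ) (e : ℤˣ) (i j : Fin N) :
    refl a e i j * ofD (dx j) = ((e : ℤ) : ℂ) •
      SkewMonoidAlgebra.single (tau e i j) (mulOp ((a : ℂ) • phi e i j) * dx i) := by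
  rw [refl, tm_mul_ofD_dx]
  simp [tau]

end TwoBody

/-! ### Relations of type B_2 between exchange and potential terms -/

section Potential

variable {N : ℕ}

/-- The coefficient of `K_i` in the Dunkl operator `J_i`. -/
def potCoeff (b b' : ℝ) (i : Fin N) : Smooth N := (b : ℂ) • cothOne i + (b' : ℂ) • tanhOne i

theorem potCoeff_val (b b' : ℝ) (i : Fin N) (x : regularSet N) :
    (potCoeff b b' i).1 x =
      ((b * (1 + coth (x.1 i)) + b' * (1 + Real.tanh (x.1 i)) : ℝ) : ℂ) := by
  have h1 : (cothOne i).1 x = ((1 + coth (x.1 i) : ℝ) : ℂ) := rfl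
  have h2 : (tanhOne i).1 x = ((1 + Real.tanh (x.1 i) : ℝ) : ℂ) := by
    rw [Real.tanh_eq_sinh_div_cosh]; rfl
  rw [potCoeff, Smooth.add_val, Smooth.smul_val, Smooth.smul_val, h1, h2]
  push_cast
  rfl

/-- The reflection term `u(x_i) K_i` of the Dunkl operator `J_i`. -/
def pot (b b' : ℝ) (i : Fin N) : DK N := tm (potCoeff b b' i) (wFlip i)

/-- The identity is linear in (b, b'), so coth and tanh are treated separately. Sums and differences
of coth s and coth t carry a factor sinh(s ± t) that cancels the denominator of coth(s ± t). What
remains is cosh(s+t) − cosh(s−t) = 2 sinh s sinh t for coth, and cosh(s+t) + cosh(s−t) = 2 cosh s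
cosh t for tanh. -/
theorem coth_tanh_identity (b b' : ℝ) {s t : ℝ} (hs : s ≠ 0) (ht : t ≠ 0) (h1 : s - t ≠ 0)
    (h2 : s + t ≠ 0) :
    coth (s - t) * (b * coth s + b' * Real.tanh s - (b * coth t + b' * Real.tanh t)) +
      coth (s + t) * (b * coth s + b' * Real.tanh s + (b * coth t + b' * Real.tanh t)) =
      2 * (b + b') := by
  have e1 := sinh_ne_zero hs
  have e2 := sinh_ne_zero ht
  have e3 := sinh_ne_zero h1
  have e4 := sinh_ne_zero h2
  have c1 := (Real.cosh_pos s).ne'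
  have c2 := (Real.cosh_pos t).ne'
  have k1 : coth (s - t) * (coth s - coth t) + coth (s + t) * (coth s + coth t) = 2 := by
    have a1 : coth s - coth t = -(Real.sinh (s - t) / (Real.sinh s * Real.sinh t)) := by
      simp only [coth]; field_simp; rw [Real.sinh_sub]; ring
    have a2 : coth s + coth t = Real.sinh (s + t) / (Real.sinh s * Real.sinh t) := by
      simp only [coth]; field_simp; rw [Real.sinh_add]; ring
    rw [a1, a2]
    simp only [coth]
    field_simp
    rw [Real.cosh_sub, Real.cosh_add]
    ring
  have k2 : coth (s - t) * (Real.tanh s - Real.tanh t) +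
      coth (s + t) * (Real.tanh s + Real.tanh t) = 2 := by
    have a1 : Real.tanh s - Real.tanh t = Real.sinh (s - t) / (Real.cosh s * Real.cosh t) := by
      simp only [Real.tanh_eq_sinh_div_cosh]; field_simp; rw [Real.sinh_sub]
    have a2 : Real.tanh s + Real.tanh t = Real.sinh (s + t) / (Real.cosh s * Real.cosh t) := by
      simp only [Real.tanh_eq_sinh_div_cosh]; field_simp; rw [Real.sinh_add]
    rw [a1, a2]
    simp only [coth]
    field_simp
    rw [Real.cosh_sub, Real.cosh_add]
    ring
  linear_combination b * k1 + b' * k2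

theorem neg_one_cast : (((-1 : ℤˣ) : ℤ) : ℝ) = -1 := by simp

theorem one_cast : (((1 : ℤˣ) : ℤ) : ℝ) = 1 := by simp

/-- All four products have the group element K_ij K_j, so this is an identity of coefficients. The
sign `shift 1 i j` drops out, and the constant 2(b+b') of `coth_tanh_identity` is matched by the
constants in P and in the term with e = −1. `pot_refl_swap` is the companion for K_ij K_i. Together
they give both the commutator needed for [J_i, J_j] and the anticommutator needed for ∑ J_i². -/
theorem refl_pot_swap (a b b' : ℝ) {i j : Fin N} (h : i ≠ j) :
    refl a 1 i j * pot b b' j = pot b b' j * refl a (-1) i j + pot b b' i * refl a 1 i j +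
      refl a (-1) i j * pot b b' i := by
  have g1 : wFlip j * tau (-1) i j = tau 1 i j * wFlip j := by
    rw [tau_comm, wFlip_mul_tau_neg 1 h.symm, tau_comm]
  have g3 : tau (-1) i j * wFlip i = tau 1 i j * wFlip j := by
    rw [← g1, tau_comm, ← wFlip_mul_tau _ h.symm]
  simp only [refl, pot, tm_mul]
  rw [g1, wFlip_mul_tau 1 h, g3, ← tm_add, ← tm_add]
  congr 1
  refine Smooth.ext fun x => ?_
  simp only [Smooth.add_val, Smooth.mul_val, Smooth.smul_val, opK_tau_val, opK_wFlip_val,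
    potCoeff_val, phi_val, actReg_tau_apply, actReg_wFlip_apply, if_pos, if_neg h, if_neg h.symm,
    map_smul, neg_one_cast, one_cast, one_mul]
  have key := coth_tanh_identity b b' (x.2.1 i) (x.2.1 j) (x.2.2 i j h).1 (x.2.2 i j h).2
  have hs : shift (-1) i j = 1 := by simp [shift]
  rw [hs, show x.1 i - -1 * -x.1 j = x.1 i - x.1 j by ring,
    show -x.1 i - x.1 j = -(x.1 i + x.1 j) by ring,
    show x.1 i - -1 * x.1 j = x.1 i + x.1 j by ring, show -1 * x.1 j = -x.1 j by ring,
    coth_neg, coth_neg, Real.tanh_neg]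
  have := congrArg (fun t : ℝ => (a : ℂ) * (t : ℂ)) key
  push_cast at this ⊢
  linear_combination this

theorem pot_refl_swap (a b b' : ℝ) {i j : Fin N} (h : i ≠ j) :
    pot b b' j * refl a 1 i j = refl a (-1) i j * pot b b' j + pot b b' i * refl a (-1) i j +
      refl a 1 i j * pot b b' i := by
  have g1 : wFlip j * tau 1 i j = tau 1 i j * wFlip i := by
    rw [tau_comm, wFlip_mul_tau 1 h.symm, tau_comm]
  have g2 : wFlip i * tau (-1) i j = tau 1 i j * wFlip i := wFlip_mul_tau_neg 1 h
  have g3 : tau (-1) i j * wFlip j = tau 1 i j * wFlip i := by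
    rw [← g2, ← wFlip_mul_tau _ h]
  simp only [refl, pot, tm_mul]
  rw [g1, g2, g3, ← tm_add, ← tm_add]
  congr 1
  refine Smooth.ext fun x => ?_
  simp only [Smooth.add_val, Smooth.mul_val, Smooth.smul_val, opK_tau_val, opK_wFlip_val,
    potCoeff_val, phi_val, actReg_tau_apply, actReg_wFlip_apply, if_pos, if_neg h, if_neg h.symm,
    map_smul, neg_one_cast, one_cast, one_mul]
  have key := coth_tanh_identity b b' (x.2.1 i) (x.2.1 j) (x.2.2 i j h).1 (x.2.2 i j h).2
  have hs : shift (-1) i j = 1 := by simp [shift]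
  rw [hs, show x.1 i - -x.1 j = x.1 i + x.1 j by ring,
    show -x.1 i - -1 * x.1 j = -(x.1 i - x.1 j) by ring,
    show x.1 i - -1 * x.1 j = x.1 i + x.1 j by ring, show -1 * x.1 i = -x.1 i by ring,
    coth_neg, coth_neg, Real.tanh_neg]
  have := congrArg (fun t : ℝ => (a : ℂ) * (t : ℂ)) key
  push_cast at this ⊢
  linear_combination this

/-- The roots x_i − x_j and x_i + x_j are orthogonal, so the reflections commute and each fixes the
coefficient of the other. -/
theorem refl_commute_refl (a : ℝ) {i j : Fin N} (h : i ≠ j) :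
    Commute (refl a 1 i j) (refl a (-1) i j) := by
  have g : tau (-1) i j * tau 1 i j = tau 1 i j * tau (-1) i j := by
    rw [tau_neg_one h, ← tau_one]
    have := wFlip_mul_tau 1 h
    have h2 : wFlip j * tau 1 i j = tau 1 i j * wFlip i := by
      rw [tau_comm, wFlip_mul_tau 1 h.symm, tau_comm]
    calc wFlip i * wFlip j * tau 1 i j * tau 1 i j
        = wFlip i * (wFlip j * tau 1 i j) * tau 1 i j := by simp only [mul_assoc]
      _ = wFlip i * tau 1 i j * (wFlip i * tau 1 i j) := by rw [h2]; simp only [mul_assoc]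
      _ = tau 1 i j * (wFlip j * wFlip i) * tau 1 i j := by
        rw [this]; simp only [mul_assoc]; rw [this]
      _ = tau 1 i j * (wFlip i * wFlip j * tau 1 i j) := by
        rw [wFlip_comm j i]; simp only [mul_assoc]
  rw [Commute, SemiconjBy, refl, refl, tm_mul, tm_mul, g]
  congr 1
  refine Smooth.ext fun x => ?_
  simp only [Smooth.mul_val, Smooth.smul_val, opK_tau_val,
    phi_val, actReg_tau_apply, if_pos, if_neg h.symm, map_smul, neg_one_cast, one_cast, one_mul]
  rw [show x.1 j - -1 * x.1 i = x.1 i - -1 * x.1 j by ring,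
    show -1 * x.1 j - -1 * x.1 i = x.1 i - x.1 j by ring]
  ring

theorem pot_commute_pot (b b' : ℝ) {i j : Fin N} (h : i ≠ j) :
    Commute (pot b b' i) (pot b b' j) := by
  rw [Commute, SemiconjBy, pot, pot, tm_mul, tm_mul, wFlip_comm]
  congr 1
  refine Smooth.ext fun x => ?_
  simp only [Smooth.mul_val, opK_wFlip_val, potCoeff_val, actReg_wFlip_apply, if_neg h,
    if_neg h.symm]
  ring

theorem pot_commute_exch (a b b' : ℝ) {i j k : Fin N} (hj : i ≠ j) (hk : i ≠ k) :
    Commute (pot b b' i) (exch a j k) := by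
  refine Commute.sum_right _ _ _ fun e _ => ?_
  rw [Commute, SemiconjBy, pot, tm_mul, tm_mul, wFlip_mul_tau_of_ne e hj hk]
  congr 1
  refine Smooth.ext fun x => ?_
  simp only [Smooth.mul_val, map_smul, Smooth.smul_val, opK_wFlip_val, opK_tau_val, phi_val,
    potCoeff_val, actReg_wFlip_apply, actReg_tau_apply, if_neg hj, if_neg hj.symm, if_neg hk,
    if_neg hk.symm]
  ring

theorem partialD_eq_zero {i : Fin N} {f : Smooth N} (u : (Fin N → ℝ) → ℝ)
    (hf : ∀ x, f.1 x = u x.1) (h : ∀ x (t : ℝ), u (x + t • Pi.single i 1) = u x) :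
    partialD i f = 0 :=
  partialD_eq_of_hasDerivAt i u 0 hf (fun _ => by simp) fun x _ => by
    simp only [h]
    exact hasDerivAt_const (0 : ℝ) (u x)

theorem dx_commute_pot (b b' : ℝ) {i j : Fin N} (h : i ≠ j) :
    Commute (ofD (dx i)) (pot b b' j) := by
  have h0 : partialD i (potCoeff b b' j) = 0 :=
    partialD_eq_zero (fun y => b * (1 + coth (y j)) + b' * (1 + Real.tanh (y j)))
      (potCoeff_val b b' j) fun x t => by simp [h.symm]
  rw [Commute, SemiconjBy, pot, ofD_dx_mul_tm, tm_mul_ofD_dx, h0, tm_zero, zero_add]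
  simp [wFlip, h]

theorem dx_commute_exch (a : ℝ) {i j k : Fin N} (hj : i ≠ j) (hk : i ≠ k) :
    Commute (ofD (dx i)) (exch a j k) := by
  refine Commute.sum_right _ _ _ fun e _ => ?_
  have h0 : partialD i (phi e j k) = 0 :=
    partialD_eq_zero (fun y => coth (y j - ((e : ℤ) : ℝ) * y k) + shift e j k)
      (phi_val e j k) fun x t => by simp [hj.symm, hk.symm]
  rw [Commute, SemiconjBy, ofD_dx_mul_tm, tm_mul_ofD_dx, map_smul, h0, smul_zero, tm_zero, zero_add]
  simp [tau, Equiv.swap_apply_of_ne_of_ne hj hk, hj, hk]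

theorem exch_swap_eq (a : ℝ) {i j : Fin N} (h : i ≠ j) :
    exch a j i = -refl a 1 i j + refl a (-1) i j := by
  rw [exch_eq_refl, refl_swap a _ h, refl_swap a _ h]
  simp

end Potential

/-! ### Commutation of the Dunkl operators -/

section Brackets

attribute [local instance] LieRing.ofAssociativeRing

variable {R : Type*} [Ring R]

theorem sub_sub_lie (x y z w : R) : ⁅x - y - z, w⁆ = ⁅x, w⁆ - ⁅y, w⁆ - ⁅z, w⁆ := by
  simp only [sub_lie]

theorem lie_sub_sub (x y z w : R) : ⁅w, x - y - z⁆ = ⁅w, x⁆ - ⁅w, y⁆ - ⁅w, z⁆ := by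
  simp only [lie_sub]

theorem lie_sub_sub_sub_sub (x y z x' y' z' : R) :
    ⁅x - y - z, x' - y' - z'⁆ = ⁅x, x'⁆ - (⁅x, y'⁆ + ⁅y, x'⁆) - ⁅x, z'⁆ - ⁅z, x'⁆ + ⁅y, y'⁆ +
      (⁅y, z'⁆ + ⁅z, y'⁆) + ⁅z, z'⁆ := by
  simp only [lie_sub, sub_lie]
  abel

/-- Bookkeeping for [J_i, J_j]: A and B are the two-body parts, F k and G k the couplings of i and j
to a third index k. Only the part −x of A fails to commute with G k, only the part −y of B with F k,
and distinct third indices do not interact, so the bracket splits over k. -/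
theorem lie_sub_sum_eq_zero {ι : Type*} (S : Finset ι) {A B : R} {F G : ι → R} (x y : R)
    (hAB : ⁅A, B⁆ = 0) (hA : ∀ k ∈ S, ⁅A, G k⁆ = -⁅x, G k⁆) (hB : ∀ k ∈ S, ⁅F k, B⁆ = -⁅F k, y⁆)
    (hFG : ∀ k ∈ S, ∀ l ∈ S, k ≠ l → ⁅F k, G l⁆ = 0)
    (h : ∀ k ∈ S, ⁅x, G k⁆ + ⁅F k, y⁆ + ⁅F k, G k⁆ = 0) :
    ⁅A - ∑ k ∈ S, F k, B - ∑ k ∈ S, G k⁆ = 0 := by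
  have hSS : ⁅∑ k ∈ S, F k, ∑ k ∈ S, G k⁆ = ∑ k ∈ S, ⁅F k, G k⁆ := by
    rw [sum_lie]
    refine Finset.sum_congr rfl fun k hk => ?_
    rw [lie_sum]
    exact Finset.sum_eq_single_of_mem k hk fun l hl hlk => hFG k hk l hl hlk.symm
  rw [sub_lie, lie_sub, lie_sub, hAB, hSS, lie_sum, sum_lie, Finset.sum_congr rfl hA,
    Finset.sum_congr rfl hB]
  have h' := Finset.sum_eq_zero h
  simp only [Finset.sum_neg_distrib, Finset.sum_add_distrib] at h' ⊢
  exact Eq.trans (by abel) h'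

end Brackets

section Commutation

variable {N : ℕ}

/-- For j < i the extra 2a K_ij turns 1 + coth into coth − 1 inside the subtracted exchange term;
this is where the signs in `phi` come from. -/
theorem dunklJ_eq (a b b' : ℝ) (i : Fin N) :
    dunklJ a b b' i =
      ofD (dx i) - (∑ j ∈ Finset.univ.erase i, exch a i j) - pot b b' i := by
  have h1 : ∀ j ∈ Finset.univ.erase i, exch a i j =
      (a : ℂ) • (ofD (mulOp (cothMinus i j)) * K₂ i j + ofD (mulOp (cothPlus i j)) * Kt i j) -
        (if j < i then (2 * a : ℂ) • K₂ i j else 0) := by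
    intro j hj
    have hij : i ≠ j := (Finset.ne_of_mem_erase hj).symm
    have hk : (Kt i j : DK N) = elK (tau (-1) i j) := by
      rw [tau_neg_one hij, ← elK_mul, ← elK_mul]; rfl
    rw [hk, K₂, ofD_mulOp_mul_elK, ofD_mulOp_mul_elK, exch_eq_refl, refl, refl, tau_one, ← tm_one]
    have hm : phi (-1) i j = cothPlus i j := by simp [phi]
    rw [hm]
    rcases lt_or_gt_of_ne hij with h | h
    · have : phi 1 i j = cothMinus i j := by simp [phi, h]
      rw [this, if_neg (not_lt.2 h.le), sub_zero, tm_smul, tm_smul, smul_add]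
    · have : phi 1 i j = cothMinus i j - (2 : ℂ) • 1 := by simp [phi, not_lt.2 h.le]
      rw [this, if_pos h]
      simp only [tm_smul, tm_sub, smul_add, smul_sub, smul_smul, mul_comm (2 : ℂ)]
      abel
  have h2 : (∑ j ∈ Finset.univ.erase i, if j < i then (2 * a : ℂ) • (K₂ i j : DK N) else 0) =
      (2 * a : ℂ) • ∑ j ∈ Finset.Iio i, K₂ i j := by
    rw [← Finset.sum_filter, Finset.smul_sum]
    refine Finset.sum_congr ?_ fun _ _ => rfl
    ext j
    simp only [Finset.mem_filter, Finset.mem_erase, Finset.mem_univ, and_true, Finset.mem_Iio]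
    exact ⟨fun h => h.2, fun h => ⟨h.ne, h⟩⟩
  rw [Finset.sum_congr rfl h1, Finset.sum_sub_distrib, h2, ← Finset.smul_sum, dunklJ, pot,
    ← ofD_mulOp_mul_elK]
  simp only [potCoeff, K₁]
  abel

/-- ∂_i + ∂_j commutes with the term in x_i − x_j, and ∂_i − ∂_j with the term in x_i + x_j. The
left side is a combination of these two brackets. -/
theorem lie_dx_exch (a : ℝ) {i j : Fin N} (h : i ≠ j) :
    ⁅(ofD (dx i) : DK N), exch a j i⁆ + ⁅exch a i j, ofD (dx j)⁆ = 0 := by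
  rw [exch_swap_eq a h, exch_eq_refl]
  simp only [Ring.lie_def, mul_add, add_mul, mul_neg, neg_mul, dx_mul_refl_left a _ h,
    dx_mul_refl_right a _ h, refl_mul_dx_left, refl_mul_dx_right]
  simp
  abel

theorem lie_exch_exch (a : ℝ) {i j : Fin N} (h : i ≠ j) : ⁅exch a i j, exch a j i⁆ = 0 := by
  have := (refl_commute_refl a h).eq
  rw [exch_swap_eq a h, exch_eq_refl, Ring.lie_def]
  simp only [mul_add, add_mul, mul_neg, neg_mul, this]
  abel

theorem lie_exch_pot (a b b' : ℝ) {i j : Fin N} (h : i ≠ j) :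
    ⁅exch a i j, pot b b' j⁆ + ⁅pot b b' i, exch a j i⁆ = 0 := by
  rw [exch_swap_eq a h, exch_eq_refl]
  simp only [Ring.lie_def, mul_add, add_mul, mul_neg, neg_mul, refl_pot_swap a b b' h,
    pot_refl_swap a b b' h]
  abel

theorem exch_pot_anticomm (a b b' : ℝ) {i j : Fin N} (h : i ≠ j) :
    exch a i j * pot b b' i + pot b b' i * exch a i j +
      (exch a j i * pot b b' j + pot b b' j * exch a j i) = 0 := by
  rw [exch_swap_eq a h, exch_eq_refl]
  simp only [mul_add, add_mul, mul_neg, neg_mul, refl_pot_swap a b b' h,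
    pot_refl_swap a b b' h]
  abel

theorem lie_exch_triple (a : ℝ) {i j k : Fin N} (hij : i ≠ j) (hik : i ≠ k) (hjk : j ≠ k) :
    ⁅exch a i j, exch a j k⁆ + ⁅exch a i k, exch a j i⁆ + ⁅exch a i k, exch a j k⁆ = 0 := by
  have h1 := exch_yang_baxter a hij hik hjk
  have h2 := exch_yang_baxter a hij.symm hjk hik
  -- The claim is the Yang–Baxter relation for (i, j, k) minus the one for (j, i, k). The zero on
  -- the right is rewritten as that difference.
  rw [← sub_self (0 : DK N), ← h1]
  nth_rw 2 [h1]
  rw [← h2]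
  simp only [Ring.lie_def]
  abel

theorem dunklJ_commute (a b b' : ℝ) (i j : Fin N) :
    Commute (dunklJ a b b' i) (dunklJ a b b' j) := by
  rcases eq_or_ne i j with rfl | h
  · exact Commute.refl _
  rw [commute_iff_lie_eq]
  set S : Finset (Fin N) := (Finset.univ.erase i).erase j with hS
  have hS' : S = (Finset.univ.erase j).erase i := Finset.erase_right_comm
  have e1 : dunklJ a b b' i = ofD (dx i) - exch a i j - pot b b' i - ∑ k ∈ S, exch a i k := by
    rw [dunklJ_eq, ← Finset.add_sum_erase (Finset.univ.erase i) _
      (Finset.mem_erase.2 ⟨h.symm, Finset.mem_univ j⟩)]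
    abel
  have e2 : dunklJ a b b' j = ofD (dx j) - exch a j i - pot b b' j - ∑ k ∈ S, exch a j k := by
    rw [dunklJ_eq, ← Finset.add_sum_erase (Finset.univ.erase j) _
      (Finset.mem_erase.2 ⟨h, Finset.mem_univ i⟩), hS']
    abel
  have hmem : ∀ k ∈ S, i ≠ k ∧ j ≠ k := fun k hk => by
    simp only [hS, Finset.mem_erase] at hk
    exact ⟨hk.2.1.symm, hk.1.symm⟩
  rw [e1, e2]
  refine lie_sub_sum_eq_zero S (exch a i j) (exch a j i) ?_ (fun k hk => ?_) (fun k hk => ?_)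
    (fun k hk l hl hkl => ?_) fun k hk => lie_exch_triple a h (hmem k hk).1 (hmem k hk).2
  · have z1 : ⁅(ofD (dx i) : DK N), ofD (dx j)⁆ = 0 := by
      rw [← commute_iff_lie_eq, Commute, SemiconjBy, ← ofD_mul, ← ofD_mul, dx_comm]
    rw [lie_sub_sub_sub_sub, z1, commute_iff_lie_eq.1 (dx_commute_pot b b' h),
      commute_iff_lie_eq.1 (dx_commute_pot b b' h.symm).symm,
      commute_iff_lie_eq.1 (pot_commute_pot b b' h), lie_exch_exch a h, lie_dx_exch a h,
      lie_exch_pot a b b' h]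
    simp
  · rw [sub_sub_lie, commute_iff_lie_eq.1 (dx_commute_exch a h (hmem k hk).1),
      commute_iff_lie_eq.1 (pot_commute_exch a b b' h (hmem k hk).1)]
    simp
  · rw [lie_sub_sub, commute_iff_lie_eq.1 (dx_commute_exch a h.symm (hmem k hk).2).symm,
      commute_iff_lie_eq.1 (pot_commute_exch a b b' h.symm (hmem k hk).2).symm]
    simp
  · exact commute_iff_lie_eq.1 (exch_commute a h (hmem l hl).1 (hmem k hk).2.symm hkl)

end Commutation

/-! ### The relations between the Dunkl operators and the Weyl group -/

section Hecke

variable {N : ℕ}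

/-- The coordinate permutation operator `σ`. -/
abbrev wPerm (σ : Equiv.Perm (Fin N)) : WeylGroup N := SemidirectProduct.inr σ

theorem wPerm_mul_tau (σ : Equiv.Perm (Fin N)) (e : ℤˣ) (k l : Fin N) :
    wPerm σ * tau e k l = tau e (σ k) (σ l) * wPerm σ := by
  refine SemidirectProduct.ext ?_ ?_
  · funext n
    simp [tau, mul_left_apply, Equiv.symm_apply_eq]
  · change σ * Equiv.swap k l = Equiv.swap (σ k) (σ l) * σ
    rw [Equiv.mul_swap_eq_swap_mul]

theorem wPerm_mul_wFlip (σ : Equiv.Perm (Fin N)) (k : Fin N) :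
    wPerm σ * wFlip k = wFlip (σ k) * wPerm σ := by
  refine SemidirectProduct.ext ?_ ?_
  · funext n
    simp [wFlip, mul_left_apply, Function.update_apply, Equiv.symm_apply_eq]
  · simp [wFlip]

theorem opK_wPerm_val (σ : Equiv.Perm (Fin N)) (f : Smooth N) (x : regularSet N) :
    (opK (wPerm σ) f).1 x = f.1 (actReg (wPerm σ)⁻¹ x) := rfl

theorem actReg_wPerm_apply (σ : Equiv.Perm (Fin N)) (x : regularSet N) (k : Fin N) :
    (actReg (wPerm σ)⁻¹ x).1 k = x.1 (σ k) := by
  change actPoint (wPerm σ)⁻¹ x.1 k = _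
  rw [actPoint_apply, wPerm, ← map_inv]
  simp

theorem opK_wPerm_phi (σ : Equiv.Perm (Fin N)) (e : ℤˣ) (k l : Fin N) :
    opK (wPerm σ) (phi e k l) =
      phi e (σ k) (σ l) + ((shift e k l - shift e (σ k) (σ l) : ℝ) : ℂ) • 1 := by
  refine Smooth.ext fun x => ?_
  simp only [opK_wPerm_val, phi_val, actReg_wPerm_apply, Smooth.add_val, Smooth.smul_val,
    Smooth.one_val]
  push_cast
  ring

theorem elK_wPerm_mul_pot (b b' : ℝ) (σ : Equiv.Perm (Fin N)) (k : Fin N) :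
    elK (wPerm σ) * pot b b' k = pot b b' (σ k) * elK (wPerm σ) := by
  rw [pot, pot, elK_mul_tm, tm_mul_elK, wPerm_mul_wFlip]
  congr 1
  refine Smooth.ext fun x => ?_
  simp only [opK_wPerm_val, potCoeff_val, actReg_wPerm_apply]

theorem elK_wPerm_mul_dx (σ : Equiv.Perm (Fin N)) (k : Fin N) :
    elK (wPerm σ) * ofD (dx k) = ofD (dx (σ k)) * elK (wPerm σ) := by
  rw [elK_mul_ofD, smul_dx]
  simp

/-- The coth part is equivariant, so only the change of the sign `shift` remains. For e = −1 that
sign is always 1, hence the correction has only a term with e = 1. -/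
theorem elK_wPerm_mul_exch (a : ℝ) (σ : Equiv.Perm (Fin N)) (k l : Fin N) :
    elK (wPerm σ) * exch a k l = exch a (σ k) (σ l) * elK (wPerm σ) +
      (a * (shift 1 k l - shift 1 (σ k) (σ l)) : ℂ) •
        elK (tau 1 (σ k) (σ l) * wPerm σ) := by
  have h : ∀ e : ℤˣ, elK (wPerm σ) * tm ((a : ℂ) • phi e k l) (tau e k l) =
      tm ((a : ℂ) • phi e (σ k) (σ l)) (tau e (σ k) (σ l)) * elK (wPerm σ) +
      (a * (shift e k l - shift e (σ k) (σ l)) : ℂ) •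
        elK (tau e (σ k) (σ l) * wPerm σ) := by
    intro e
    rw [elK_mul_tm, tm_mul_elK, map_smul, opK_wPerm_phi, wPerm_mul_tau, smul_add, tm_add,
      smul_smul, tm_smul (_ * _) 1, tm_one]
    push_cast
    rfl
  have h' : ∀ m n : Fin N, shift (-1) m n = 1 := fun m n => by simp [shift]
  rw [exch, exch, Finset.mul_sum, Finset.sum_mul, Finset.sum_congr rfl fun e _ => h e,
    Finset.sum_add_distrib, UnitsInt.univ, Finset.sum_pair (by decide),
    Finset.sum_pair (by decide), h', h']
  simp

/-- An adjacent transposition preserves the order of every pair of indices except the pair it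
exchanges. This is why the Hecke relations are simple for adjacent transpositions only. -/
theorem shift_adjacent {i j : Fin N} (hij : (j : ℕ) = i + 1) {k l : Fin N}
    (h : ¬(k = i ∧ l = j)) (h' : ¬(k = j ∧ l = i)) :
    shift 1 (Equiv.swap i j k) (Equiv.swap i j l) = shift 1 k l := by
  have : Equiv.swap i j k < Equiv.swap i j l ↔ k < l := by
    simp only [Equiv.swap_apply_def, Fin.lt_def]
    simp only [Fin.ext_iff] at h h' ⊢
    split_ifs <;> omega
  simp [shift, this]

theorem elK_swap_mul_exch {a : ℝ} {i j : Fin N} (hij : (j : ℕ) = i + 1) {k l : Fin N}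
    (h : ¬(k = i ∧ l = j)) (h' : ¬(k = j ∧ l = i)) :
    elK (wSwap i j) * exch a k l =
      exch a (Equiv.swap i j k) (Equiv.swap i j l) * elK (wSwap i j) := by
  have := elK_wPerm_mul_exch a (Equiv.swap i j) k l
  rw [shift_adjacent hij h h', sub_self, mul_zero, zero_smul, add_zero] at this
  exact this

theorem elK_swap_mul_exch_self {a : ℝ} {i j : Fin N} (hij : i < j) :
    elK (wSwap i j) * exch a i j = exch a j i * elK (wSwap i j) + (2 * a : ℂ) • 1 := by
  have := elK_wPerm_mul_exch a (Equiv.swap i j) i j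
  have h1 : shift 1 i j = 1 := by simp [shift, hij]
  have h2 : shift 1 j i = -1 := by simp [shift, not_lt.2 hij.le]
  have h3 : tau 1 j i * wPerm (Equiv.swap i j) = 1 := by
    rw [tau_comm, ← tau_mul_self 1 i j]
    nth_rw 3 [tau_one]
    rfl
  rw [Equiv.swap_apply_left, Equiv.swap_apply_right, h1, h2, h3] at this
  rw [show (2 * a : ℂ) = a * ((1 : ℝ) - (-1 : ℝ)) by push_cast; ring]
  exact this

theorem elK_mul_self {w : WeylGroup N} (h : w * w = 1) : (elK w : DK N) * elK w = 1 := by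
  rw [elK_mul, h]; rfl

theorem wSwap_mul_self (i j : Fin N) : wSwap i j * wSwap i j = 1 := by
  rw [← tau_one, tau_mul_self]

/-- Scalars are central in `𝔇 ⊗ 𝔎`. -/
theorem smul_one_commute (z : ℂ) (A : DK N) : Commute (z • (1 : DK N)) A := by
  induction A using SkewMonoidAlgebra.induction_on with
  | zero => exact Commute.zero_right _
  | add f g hf hg => exact hf.add_right hg
  | single w D =>
    -- K_w is ℂ-linear, so the twist in the product does not affect scalars.
    have h : w • (z • (1 : DiffOp N)) = z • 1 := Subtype.ext (by
      rw [smul_val]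
      change opK w * (z • 1) * opK w⁻¹ = z • 1
      rw [mul_smul_comm, mul_one, smul_mul_assoc, opK_mul_cancel])
    have h1 : z • (1 : DK N) = ofD (z • 1) := by
      rw [ofD, ← SkewMonoidAlgebra.smul_single]; rfl
    rw [h1, Commute, SemiconjBy, ofD_mul_single, single_mul_ofD, h]
    simp

theorem sum_erase_swap {M : Type*} [AddCommMonoid M] (σ : Equiv.Perm (Fin N)) (k : Fin N)
    (F : Fin N → M) :
    ∑ l ∈ Finset.univ.erase k, F (σ l) = ∑ l ∈ Finset.univ.erase (σ k), F l :=
  Finset.sum_bij (fun l _ => σ l) (by simp) (by simp) (fun l hl => ⟨σ.symm l, by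
    simp only [Finset.mem_erase, Finset.mem_univ, and_true] at hl ⊢
    exact fun h => hl (by rw [← h]; simp), by simp⟩) (by simp)

theorem elK_swap_mul_dunklJ_of_ne (a b b' : ℝ) {i j : Fin N} (hij : (j : ℕ) = i + 1) {k : Fin N}
    (hi : k ≠ i) (hj : k ≠ j) :
    Commute (elK (wSwap i j)) (dunklJ a b b' k) := by
  have hk : Equiv.swap i j k = k := Equiv.swap_apply_of_ne_of_ne hi hj
  have h1 : ∑ l ∈ Finset.univ.erase k, elK (wSwap i j) * exch a k l =
      (∑ l ∈ Finset.univ.erase k, exch a k l) * elK (wSwap i j) := by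
    have := sum_erase_swap (Equiv.swap i j) k (fun l => exch a k l)
    rw [hk] at this
    rw [← this, Finset.sum_mul]
    refine Finset.sum_congr rfl fun l hl => ?_
    rw [elK_swap_mul_exch hij (fun h => hi h.1) (fun h => hj h.1),
      hk]
  have h2 := elK_wPerm_mul_pot b b' (Equiv.swap i j) k
  have h3 := elK_wPerm_mul_dx (Equiv.swap i j) k
  rw [hk] at h2 h3
  change elK (wSwap i j) * _ = _ * elK (wSwap i j) at h2
  change elK (wSwap i j) * _ = _ * elK (wSwap i j) at h3
  rw [Commute, SemiconjBy, dunklJ_eq, mul_sub, mul_sub, h2, h3, Finset.mul_sum, h1, sub_mul,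
    sub_mul]

theorem elK_swap_mul_dunklJ (a b b' : ℝ) {i j : Fin N} (hij : (j : ℕ) = i + 1) :
    elK (wSwap i j) * dunklJ a b b' i =
      dunklJ a b b' j * elK (wSwap i j) - (2 * a : ℂ) • 1 := by
  have hlt : i < j := by rw [Fin.lt_def]; omega
  have hk : Equiv.swap i j i = j := Equiv.swap_apply_left i j
  have hji : j ∈ Finset.univ.erase i := by simp [hlt.ne']
  have h1 : ∑ l ∈ Finset.univ.erase i, elK (wSwap i j) * exch a i l =
      (∑ l ∈ Finset.univ.erase j, exch a j l) * elK (wSwap i j) + (2 * a : ℂ) • 1 := by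
    have := sum_erase_swap (Equiv.swap i j) i (fun l => exch a j l)
    rw [hk] at this
    rw [← this, Finset.sum_mul, ← Finset.add_sum_erase _ _ hji, elK_swap_mul_exch_self hlt,
      ← Finset.add_sum_erase _ (fun l => exch a j (Equiv.swap i j l) * elK (wSwap i j)) hji,
      Equiv.swap_apply_right, add_right_comm]
    congr 2
    refine Finset.sum_congr rfl fun l hl => ?_
    have hl' := Finset.ne_of_mem_erase (Finset.mem_of_mem_erase hl)
    rw [elK_swap_mul_exch hij (fun h => Finset.ne_of_mem_erase hl h.2)
      (fun h => hl' h.2), hk]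
  have h2 := elK_wPerm_mul_pot b b' (Equiv.swap i j) i
  have h3 := elK_wPerm_mul_dx (Equiv.swap i j) i
  rw [hk] at h2 h3
  change elK (wSwap i j) * _ = _ * elK (wSwap i j) at h2
  change elK (wSwap i j) * _ = _ * elK (wSwap i j) at h3
  rw [dunklJ_eq, dunklJ_eq, mul_sub, mul_sub, h2, h3, Finset.mul_sum, h1, sub_mul, sub_mul]
  abel

theorem elK_swap_mul_dunklJ' (a b b' : ℝ) {i j : Fin N} (hij : (j : ℕ) = i + 1) :
    elK (wSwap i j) * dunklJ a b b' j =
      dunklJ a b b' i * elK (wSwap i j) + (2 * a : ℂ) • 1 := by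
  have h := elK_swap_mul_dunklJ a b b' hij
  have hs := elK_mul_self (wSwap_mul_self i j)
  -- The second relation is the first one multiplied on both sides by the involution K_ij.
  have h' := congrArg (fun A => elK (wSwap i j) * A * elK (wSwap i j)) h
  simp only [mul_sub, sub_mul, ← mul_assoc, hs, one_mul] at h'
  rw [mul_assoc _ (elK (wSwap i j)) (elK (wSwap i j)), hs, mul_one,
    ((smul_one_commute (2 * a : ℂ) (elK (wSwap i j))).eq).symm, mul_assoc, hs, mul_one] at h'
  rw [h']
  abel

/-- The Hecke relations make s commute with x + y and with xy, hence with x^n + y^n by the recursion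
p_{n+2} = (x+y) p_{n+1} − xy p_n. -/
theorem commute_pow_add_pow {R : Type*} [Ring R] {s x y c : R} (hxy : Commute x y)
    (h1 : s * x = y * s - c) (h2 : s * y = x * s + c) (hc : ∀ z, Commute c z) (n : ℕ) :
    Commute s (x ^ n + y ^ n) := by
  have hs : Commute s (x + y) := by
    rw [Commute, SemiconjBy, mul_add, h1, h2]; noncomm_ring
  have hp : Commute s (x * y) := by
    rw [Commute, SemiconjBy, ← mul_assoc, h1, sub_mul, mul_assoc, h2, mul_add, ← mul_assoc,
      (hc y).eq, hxy.eq]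
    abel
  induction n using Nat.twoStepInduction with
  | zero => simp
  | one => simpa using hs
  | more n ih1 ih2 =>
    have : x ^ (n + 2) + y ^ (n + 2) =
        (x + y) * (x ^ (n + 1) + y ^ (n + 1)) - x * y * (x ^ n + y ^ n) := by
      have e1 : x * y * x ^ n = y * x ^ (n + 1) := by rw [hxy.eq, mul_assoc, pow_succ']
      have e2 : x * y * y ^ n = x * y ^ (n + 1) := by rw [mul_assoc, pow_succ']
      rw [mul_add (x * y), e1, e2, add_mul, mul_add, mul_add, ← pow_succ', ← pow_succ']
      abel
    rw [this]
    exact (hs.mul_right ih2).sub_right (hp.mul_right ih1)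

theorem elK_swap_commute_powerSum (a b b' : ℝ) (p : ℕ) {i j : Fin N} (hij : (j : ℕ) = i + 1) :
    Commute (elK (wSwap i j)) (powerSum N a b b' p) := by
  have hlt : i < j := by rw [Fin.lt_def]; omega
  have hji : j ∈ Finset.univ.erase i := by simp [hlt.ne']
  rw [powerSum, ← Finset.add_sum_erase _ _ (Finset.mem_univ i), ← Finset.add_sum_erase _ _ hji,
    ← add_assoc]
  refine Commute.add_right ?_ (Commute.sum_right _ _ _ fun k hk => ?_)
  · exact commute_pow_add_pow (dunklJ_commute a b b' i j) (elK_swap_mul_dunklJ a b b' hij)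
      (elK_swap_mul_dunklJ' a b b' hij) (smul_one_commute _) _
  · simp only [Finset.mem_erase] at hk
    exact (elK_swap_mul_dunklJ_of_ne a b b' hij hk.2.1 hk.1).pow_right _

/-- Changing the sign of x_i exchanges x_k − e x_i with x_k + e x_i. For k < i both constants equal
1, so no correction arises. -/
theorem elK_wFlip_mul_refl (a : ℝ) (e : ℤˣ) {i k : Fin N} (h : k < i) :
    elK (wFlip i) * refl a e k i = refl a (-e) k i * elK (wFlip i) := by
  have g := wFlip_mul_tau_neg (-e) h.ne'
  rw [neg_neg, tau_comm, tau_comm (-e)] at g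
  rw [refl, refl, elK_mul_tm, tm_mul_elK, g]
  congr 1
  have hs : ∀ e, shift e k i = 1 := fun e => by simp [shift, h]
  refine Smooth.ext fun x => ?_
  simp only [map_smul, Smooth.smul_val, opK_wFlip_val, phi_val, actReg_wFlip_apply, if_pos,
    if_neg h.ne, hs]
  simp

theorem elK_wFlip_commute_exch (a : ℝ) {i k l : Fin N} (hk : i ≠ k) (hl : i ≠ l) :
    Commute (elK (wFlip i)) (exch a k l) := by
  refine Commute.sum_right _ _ _ fun e _ => ?_
  rw [Commute, SemiconjBy, elK_mul_tm, tm_mul_elK, wFlip_mul_tau_of_ne e hk hl]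
  congr 1
  refine Smooth.ext fun x => ?_
  simp only [map_smul, Smooth.smul_val, opK_wFlip_val, phi_val, actReg_wFlip_apply,
    if_neg hk.symm, if_neg hl.symm]

theorem elK_wFlip_commute_dunklJ (a b b' : ℝ) {i k : Fin N} (h : k < i) :
    Commute (elK (wFlip i)) (dunklJ a b b' k) := by
  rw [dunklJ_eq]
  refine ((?_ : Commute _ _).sub_right (Commute.sum_right _ _ _ fun l _ => ?_)).sub_right ?_
  · rw [Commute, SemiconjBy, elK_mul_ofD, smul_dx]
    simp [wFlip, h.ne]
  · by_cases hl : l = i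
    · subst hl
      rw [exch_eq_refl, Commute, SemiconjBy, mul_add, add_mul, elK_wFlip_mul_refl a _ h,
        elK_wFlip_mul_refl a _ h, neg_neg, add_comm]
    · exact elK_wFlip_commute_exch a h.ne' (Ne.symm hl)
  · rw [pot, Commute, SemiconjBy, elK_mul_tm, tm_mul_elK, wFlip_comm]
    congr 1
    refine Smooth.ext fun x => ?_
    simp only [opK_wFlip_val, potCoeff_val, actReg_wFlip_apply, if_neg h.ne]

/-- Here i is the last index. Every R_il is then a difference of two reflection terms that K_i
exchanges, so it anticommutes with K_i, as does ∂_i. The constant is the sum of the coefficient of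
P_i at x_i and at −x_i, where coth and tanh cancel. -/
theorem elK_wFlip_mul_dunklJ (a b b' : ℝ) {i : Fin N} (h : ∀ k, k ≠ i → k < i) :
    elK (wFlip i) * dunklJ a b b' i =
      -(dunklJ a b b' i * elK (wFlip i)) - (2 * (b + b') : ℂ) • 1 := by
  have h1 : elK (wFlip i) * ofD (dx i) = -(ofD (dx i) * elK (wFlip i)) := by
    rw [elK_mul_ofD, smul_dx]
    have : ofD (-dx i : DiffOp N) = -ofD (dx i) := SkewMonoidAlgebra.single_neg _ _
    simp [wFlip, this]
  have h2 : ∀ l ∈ Finset.univ.erase i, elK (wFlip i) * exch a i l =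
      -(exch a i l * elK (wFlip i)) := fun l hl => by
    have hl' := h l (Finset.ne_of_mem_erase hl)
    rw [exch_swap_eq a hl'.ne, mul_add, add_mul, mul_neg, elK_wFlip_mul_refl a _ hl',
      elK_wFlip_mul_refl a _ hl', neg_neg, neg_mul]
    abel
  have h3 : elK (wFlip i) * pot b b' i = -(pot b b' i * elK (wFlip i)) +
      (2 * (b + b') : ℂ) • 1 := by
    rw [pot, elK_mul_tm, tm_mul_elK, wFlip_mul_self, ← tm_neg, ← tm_one_one, ← tm_smul, ← tm_add]
    congr 1
    refine Smooth.ext fun x => ?_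
    simp only [opK_wFlip_val, potCoeff_val, actReg_wFlip_apply, if_pos, Smooth.add_val,
      Smooth.neg_val, Smooth.smul_val, Smooth.one_val, coth_neg, Real.tanh_neg]
    push_cast
    ring
  rw [dunklJ_eq, mul_sub, mul_sub, h1, h3, Finset.mul_sum, Finset.sum_congr rfl h2, sub_mul,
    sub_mul, Finset.sum_mul, Finset.sum_neg_distrib]
  abel

theorem elK_wFlip_commute_powerSum (a b b' : ℝ) (p : ℕ) {i : Fin N} (h : ∀ k, k ≠ i → k < i) :
    Commute (elK (wFlip i)) (powerSum N a b b' p) := by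
  refine Commute.sum_right _ _ _ fun k _ => ?_
  by_cases hk : k = i
  · subst hk
    -- Only even powers of J_i occur: from K J = −J K − c with c central follows K J² = J² K.
    rw [pow_mul]
    refine Commute.pow_right ?_ p
    have := elK_wFlip_mul_dunklJ a b b' h
    have hc := (smul_one_commute (2 * (b + b') : ℂ) (dunklJ a b b' k)).eq
    rw [Commute, SemiconjBy, sq, ← mul_assoc, this, sub_mul, neg_mul, mul_assoc, this, hc]
    noncomm_ring
  · exact (elK_wFlip_commute_dunklJ a b b' (h k hk)).pow_right _

theorem elK_commute_powerSum (a b b' : ℝ) (p : ℕ) (w : WeylGroup N) :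
    Commute (elK w) (powerSum N a b b' p) := by
  let H : Submonoid (WeylGroup N) :=
    { carrier := {w | Commute (elK w) (powerSum N a b b' p)}
      one_mem' := Commute.one_left _
      mul_mem' := fun {v w} hv hw => by
        change Commute _ _
        rw [← elK_mul]
        exact Commute.mul_left hv hw }
  have hperm : ∀ σ, wPerm σ ∈ H := by
    intro σ
    cases N with
    | zero => rw [Subsingleton.elim σ 1, wPerm, map_one]; exact H.one_mem
    | succ n =>
      have : σ ∈ H.comap (SemidirectProduct.inr : _ →* WeylGroup (n + 1)) := by
        -- Adjacent transpositions generate all permutations. The sign change at the last index and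
        -- its conjugates by permutations then supply all sign changes.
        have htop := Equiv.Perm.mclosure_swap_castSucc_succ n
        have hle : (⊤ : Submonoid (Equiv.Perm (Fin (n + 1)))) ≤
            H.comap (SemidirectProduct.inr : _ →* WeylGroup (n + 1)) := by
          rw [← htop, Submonoid.closure_le]
          rintro _ ⟨i, rfl⟩
          exact elK_swap_commute_powerSum a b b' p (by simp)
        exact hle trivial
      exact this
  have hflip : ∀ i, wFlip i ∈ H := by
    intro i
    cases N with
    | zero => exact i.elim0
    | succ n =>
      have h0 : wFlip (Fin.last n) ∈ H :=
        elK_wFlip_commute_powerSum a b b' p fun k hk => Fin.lt_last_iff_ne_last.2 hk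
      have := wPerm_mul_wFlip (Equiv.swap i (Fin.last n)) (Fin.last n)
      rw [Equiv.swap_apply_right] at this
      have h1 : wFlip i = wPerm (Equiv.swap i (Fin.last n)) * wFlip (Fin.last n) *
          wPerm (Equiv.swap i (Fin.last n))⁻¹ := by
        rw [this, mul_assoc, ← map_mul, mul_inv_cancel, map_one, mul_one]
      rw [h1]
      exact H.mul_mem (H.mul_mem (hperm _) h0) (hperm _)
  have hsign : ∀ ε : Fin N → ℤˣ, (SemidirectProduct.inl ε : WeylGroup N) ∈ H := by
    intro ε
    have h1 : ε = ∏ i, Pi.mulSingle i (ε i) := (Finset.univ_prod_mulSingle ε).symm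
    rw [h1]
    refine Submonoid.prod_mem (H.comap (SemidirectProduct.inl : _ →* WeylGroup N)) fun i _ => ?_
    rw [Submonoid.mem_comap]
    rcases Int.units_eq_one_or (ε i) with h | h
    · rw [h, Pi.mulSingle_one, map_one]; exact H.one_mem
    · rw [h]; exact hflip i
  have := H.mul_mem (hsign w.left) (hperm w.right)
  rwa [SemidirectProduct.inl_left_mul_inr_right] at this

end Hecke

/-! ### The star mapping on invariant elements -/

section Star

variable {N : ℕ} (m : ℕ)

theorem starMap_single (w : WeylGroup N) (D : DiffOp N) :
    starMap m (SkewMonoidAlgebra.single w D) =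
      D ⊗ₜ[ℂ] (((parity w : ℤ) : ℂ) • opS m w⁻¹) :=
  SkewMonoidAlgebra.sum_single_index (by simp)

theorem starMap_zero : starMap m (0 : DK N) = 0 := SkewMonoidAlgebra.sum_zero_index

theorem starMap_add (A B : DK N) : starMap m (A + B) = starMap m A + starMap m B :=
  SkewMonoidAlgebra.sum_add_index' (by simp) (by simp [TensorProduct.add_tmul])

/-- The star mapping as an additive homomorphism. -/
def starHom (N m : ℕ) : DK N →+ DS N m where
  toFun := starMap m
  map_zero' := starMap_zero m
  map_add' := starMap_add m

theorem starHom_apply (A : DK N) : starHom N m A = starMap m A := rfl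

theorem starHom_smul (z : ℂ) (A : DK N) : starHom N m (z • A) = z • starHom N m A := by
  induction A using SkewMonoidAlgebra.induction_on with
  | zero => simp
  | add f g hf hg => rw [smul_add, map_add, map_add, hf, hg, smul_add]
  | single w D =>
    rw [SkewMonoidAlgebra.smul_single, starHom_apply, starHom_apply, starMap_single,
      starMap_single, TensorProduct.smul_tmul']

/-- For A = E K_v, invariance gives AB = E B K_v. A factor K_v appended on the right becomes ±
S_{v⁻¹} on the left, the place it occupies in A*B*. -/
theorem starMap_mul (A B : DK N) (hB : ∀ w, Commute (elK w) B) :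
    starMap m (A * B) = starMap m A * starMap m B := by
  have key : ∀ (v : WeylGroup N) (E : DiffOp N) (C : DK N),
      starHom N m (ofD E * C * elK v) =
        starHom N m (SkewMonoidAlgebra.single v E) * starHom N m C := by
    intro v E C
    induction C using SkewMonoidAlgebra.induction_on with
    | zero => simp
    | add f g hf hg => rw [mul_add, add_mul, map_add, map_add, hf, hg, mul_add]
    | single w D =>
      have : ofD E * SkewMonoidAlgebra.single w D * elK v =
          SkewMonoidAlgebra.single (w * v) (E * D) := by
        rw [ofD_mul_single, elK, SkewMonoidAlgebra.single_mul_single, smul_one, mul_one]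
      rw [this, starHom_apply, starHom_apply, starHom_apply, starMap_single, starMap_single,
        starMap_single, Algebra.TensorProduct.tmul_mul_tmul, mul_inv_rev, map_mul, map_mul,
        smul_mul_smul_comm, mul_comm (parity w)]
      push_cast
      rfl
  rw [← starHom_apply, ← starHom_apply, ← starHom_apply]
  induction A using SkewMonoidAlgebra.induction_on with
  | zero => simp
  | add f g hf hg => rw [add_mul, map_add, map_add, hf, hg, add_mul]
  | single v E =>
    have : (SkewMonoidAlgebra.single v E : DK N) = ofD E * elK v := by simp [ofD, elK]
    rw [← key, mul_assoc, ← (hB v).eq, ← mul_assoc, ← this]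

theorem powerSum_commute (a b b' : ℝ) (p q : ℕ) :
    Commute (powerSum N a b b' p) (powerSum N a b b' q) :=
  Commute.sum_left _ _ _ fun i _ => Commute.sum_right _ _ _ fun j _ =>
    (dunklJ_commute a b b' i j).pow_pow _ _

theorem starIntegral_commute (a b b' : ℝ) (p q : ℕ) :
    Commute (starIntegral N m a b b' p) (starIntegral N m a b b' q) := by
  rw [Commute, SemiconjBy, starIntegral, starIntegral,
    ← starMap_mul _ _ _ (elK_commute_powerSum a b b' q),
    ← starMap_mul _ _ _ (elK_commute_powerSum a b b' p), (powerSum_commute a b b' p q).eq]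

end Star

/-! ### The Hamiltonian -/

section Sums

variable {ι M : Type*} [Fintype ι] [AddCommMonoid M]

theorem sum_sum_erase_eq_sum_Ioi {N : ℕ} (F : Fin N → Fin N → M) :
    ∑ i, ∑ k ∈ Finset.univ.erase i, F i k = ∑ i, ∑ k ∈ Finset.Ioi i, (F i k + F k i) := by
  have h : ∀ i : Fin N, ∑ k ∈ Finset.univ.erase i, F i k =
      ∑ k ∈ Finset.Ioi i, F i k + ∑ k ∈ Finset.Iio i, F i k := fun i => by
    rw [← Finset.sum_union]
    · refine Finset.sum_congr ?_ fun _ _ => rfl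
      ext k
      simp only [Finset.mem_erase, Finset.mem_univ, and_true, Finset.mem_union, Finset.mem_Ioi,
        Finset.mem_Iio]
      rw [ne_iff_lt_or_gt, or_comm]
    · rw [Finset.disjoint_left]
      intro k h1 h2
      exact lt_asymm (Finset.mem_Ioi.1 h1) (Finset.mem_Iio.1 h2)
  simp only [h, Finset.sum_add_distrib]
  congr 1
  exact Finset.sum_comm' (by simp)

theorem sum_cyclic (G : ι → ι → ι → M) :
    ∑ i, ∑ j, ∑ k, (G i j k + G j k i + G k i j) = 3 • ∑ i, ∑ j, ∑ k, G i j k := by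
  have h1 : ∑ i, ∑ j, ∑ k, G j k i = ∑ i, ∑ j, ∑ k, G i j k := by
    rw [Finset.sum_comm]
    refine Finset.sum_congr rfl fun j _ => ?_
    rw [Finset.sum_comm]
  have h2 : ∑ i, ∑ j, ∑ k, G k i j = ∑ i, ∑ j, ∑ k, G i j k := by
    calc ∑ i, ∑ j, ∑ k, G k i j = ∑ i, ∑ k, ∑ j, G k i j :=
          Finset.sum_congr rfl fun i _ => Finset.sum_comm
      _ = ∑ k, ∑ i, ∑ j, G k i j := Finset.sum_comm
  simp only [Finset.sum_add_distrib, h1, h2]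
  abel

end Sums

/-! ### The sum of the squares of the Dunkl operators -/

section Squares

variable {N : ℕ}

theorem dx_exch_anticomm (a : ℝ) {i j : Fin N} (h : i ≠ j) :
    ofD (dx i) * exch a i j + exch a i j * ofD (dx i) +
      (ofD (dx j) * exch a j i + exch a j i * ofD (dx j)) =
      (-2 * a : ℂ) • (tm (invSq 1 i j) (tau 1 i j) + tm (invSq (-1) i j) (tau (-1) i j)) := by
  rw [exch_swap_eq a h, exch_eq_refl]
  simp only [mul_add, add_mul, mul_neg, neg_mul, dx_mul_refl_left a _ h,
    dx_mul_refl_right a _ h, refl_mul_dx_left, refl_mul_dx_right, tm_smul]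
  simp only [Units.val_one, Int.cast_one, one_smul, Units.val_neg, Int.cast_neg, neg_smul,
    mul_smul, two_smul, smul_add]
  abel

/-- The reflection negates the argument of coth, so the product is a²(s² − coth²) with s = ±1, and 1
− coth² = −sinh⁻². -/
theorem phi_mul_opK_phi (a : ℂ) (e : ℤˣ) {i j : Fin N} (h : i ≠ j) :
    (a • phi e i j) * opK (tau e i j) (a • phi e i j) = -(a ^ 2 • invSq e i j) := by
  refine Smooth.ext fun x => ?_
  have hs : shift e i j ^ 2 = 1 := by
    rw [shift]; split_ifs <;> norm_num
  have key := one_sub_coth_sq (regularSet_sub_ne x h e)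
  have hee := units_mul_self_cast e
  simp only [Smooth.mul_val, map_smul, Smooth.smul_val, Smooth.neg_val, opK_tau_val, phi_val,
    invSq_val, actReg_tau_apply, if_pos, if_neg h.symm]
  rw [show ((e : ℤ) : ℝ) * x.1 j - ((e : ℤ) : ℝ) * (((e : ℤ) : ℝ) * x.1 i) =
    -(x.1 i - ((e : ℤ) : ℝ) * x.1 j) by linear_combination (-x.1 i) * hee, coth_neg]
  rw [← hs] at key
  have := congrArg (fun t : ℝ => a ^ 2 * (t : ℂ)) key
  push_cast at this ⊢
  linear_combination this

theorem exch_sq_add (a : ℝ) {i j : Fin N} (h : i ≠ j) :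
    exch a i j * exch a i j + exch a j i * exch a j i =
      (-2 * a ^ 2 : ℂ) • (tm (invSq 1 i j) 1 + tm (invSq (-1) i j) 1) := by
  have hr : ∀ e, refl a e i j * refl a e i j = -((a : ℂ) ^ 2 • tm (invSq e i j) 1) := fun e => by
    rw [refl, tm_mul, phi_mul_opK_phi _ _ h, tau_mul_self, tm_neg, tm_smul]
  rw [exch_swap_eq a h, exch_eq_refl, show (-2 * a ^ 2 : ℂ) = -(a ^ 2) + -(a ^ 2) by ring]
  simp only [mul_add, add_mul, mul_neg, neg_mul, neg_neg, hr, (refl_commute_refl a h).eq]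
  simp only [add_smul, neg_smul, smul_add]
  abel

/-- Summing over cyclic relabellings triples the sum, while `exch_cyclic` makes each cyclic group of
three terms vanish. -/
theorem sum_exch_mul_exch (a : ℝ) :
    ∑ i : Fin N, ∑ k ∈ Finset.univ.erase i, ∑ l ∈ (Finset.univ.erase i).erase k,
      exch a i k * exch a i l = 0 := by
  classical
  -- Extension by zero to all triples frees the relabelling from the condition that the indices be
  -- distinct.
  set G : Fin N → Fin N → Fin N → DK N := fun i k l =>
    if i ≠ k ∧ i ≠ l ∧ k ≠ l then exch a i k * exch a i l else 0 with hG
  have h1 : ∑ i : Fin N, ∑ k ∈ Finset.univ.erase i, ∑ l ∈ (Finset.univ.erase i).erase k,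
      exch a i k * exch a i l = ∑ i, ∑ k, ∑ l, G i k l := by
    refine Finset.sum_congr rfl fun i _ => ?_
    refine Finset.sum_subset_zero_on_sdiff (Finset.subset_univ _) (fun k hk => ?_)
      fun k hk => ?_
    · have : k = i := by simpa using hk
      subst this
      exact Finset.sum_eq_zero fun l _ => by simp [hG]
    · have hk' : i ≠ k := (Finset.ne_of_mem_erase hk).symm
      refine Finset.sum_subset_zero_on_sdiff (Finset.subset_univ _) (fun l hl => ?_)
        fun l hl => ?_
      · rw [hG]
        refine if_neg fun h => ?_
        simp [h.2.1.symm, h.2.2.symm] at hl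
      · simp only [Finset.mem_erase] at hl
        rw [hG]
        exact (if_pos ⟨hk', hl.2.1.symm, hl.1.symm⟩).symm
  have h2 := sum_cyclic G
  have h3 : ∀ i j k, G i j k + G j k i + G k i j = 0 := by
    intro i j k
    by_cases h : i ≠ j ∧ i ≠ k ∧ j ≠ k
    · obtain ⟨hij, hik, hjk⟩ := h
      simp only [hG]
      rw [if_pos ⟨hij, hik, hjk⟩, if_pos ⟨hjk, hij.symm, hik.symm⟩,
        if_pos ⟨hik.symm, hjk.symm, hij⟩]
      exact exch_cyclic a hij hik hjk
    · simp only [hG]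
      rw [if_neg h, if_neg fun h' => h ⟨h'.2.1.symm, h'.2.2.symm, h'.1⟩,
        if_neg fun h' => h ⟨h'.2.2, h'.1.symm, h'.2.1.symm⟩]
      simp
  simp only [h3, Finset.sum_const_zero] at h2
  rw [h1]
  have h4 : (3 : ℂ) • ∑ i, ∑ k, ∑ l, G i k l = 0 := by
    rw [h2, ← Nat.cast_smul_eq_nsmul ℂ]; norm_num
  exact (smul_eq_zero.1 h4).resolve_left (by norm_num)

theorem sum_exch_sq (a : ℝ) :
    ∑ i : Fin N, (∑ k ∈ Finset.univ.erase i, exch a i k) *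
        (∑ k ∈ Finset.univ.erase i, exch a i k) =
      ∑ i : Fin N, ∑ j ∈ Finset.Ioi i,
        (-2 * a ^ 2 : ℂ) • (tm (invSq 1 i j) 1 + tm (invSq (-1) i j) 1) := by
  have h : ∀ i : Fin N, (∑ k ∈ Finset.univ.erase i, exch a i k) *
        (∑ k ∈ Finset.univ.erase i, exch a i k) =
      ∑ k ∈ Finset.univ.erase i, exch a i k * exch a i k +
        ∑ k ∈ Finset.univ.erase i, ∑ l ∈ (Finset.univ.erase i).erase k,
          exch a i k * exch a i l := fun i => by
    rw [Finset.sum_mul_sum, ← Finset.sum_add_distrib]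
    refine Finset.sum_congr rfl fun k hk => ?_
    rw [Finset.add_sum_erase _ (fun l => exch a i k * exch a i l) hk]
  simp only [h]
  rw [Finset.sum_add_distrib, sum_exch_mul_exch, add_zero, sum_sum_erase_eq_sum_Ioi]
  exact Finset.sum_congr rfl fun i _ => Finset.sum_congr rfl fun j hj =>
    exch_sq_add a (Finset.mem_Ioi.1 hj).ne

theorem sum_dx_exch (a : ℝ) :
    ∑ i : Fin N, (ofD (dx i) * (∑ k ∈ Finset.univ.erase i, exch a i k) +
        (∑ k ∈ Finset.univ.erase i, exch a i k) * ofD (dx i)) =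
      ∑ i : Fin N, ∑ j ∈ Finset.Ioi i,
        (-2 * a : ℂ) • (tm (invSq 1 i j) (tau 1 i j) + tm (invSq (-1) i j) (tau (-1) i j)) := by
  simp only [Finset.mul_sum, Finset.sum_mul, ← Finset.sum_add_distrib]
  rw [sum_sum_erase_eq_sum_Ioi]
  exact Finset.sum_congr rfl fun i _ => Finset.sum_congr rfl fun j hj =>
    dx_exch_anticomm a (Finset.mem_Ioi.1 hj).ne

theorem sum_exch_pot (a b b' : ℝ) :
    ∑ i : Fin N, ((∑ k ∈ Finset.univ.erase i, exch a i k) * pot b b' i +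
        pot b b' i * (∑ k ∈ Finset.univ.erase i, exch a i k)) = 0 := by
  simp only [Finset.mul_sum, Finset.sum_mul, ← Finset.sum_add_distrib]
  rw [sum_sum_erase_eq_sum_Ioi]
  exact Finset.sum_eq_zero fun i _ => Finset.sum_eq_zero fun j hj =>
    exch_pot_anticomm a b b' (Finset.mem_Ioi.1 hj).ne

theorem invSinhSqOne_val (i : Fin N) (x : regularSet N) :
    (invSinhSqOne i).1 x = (((Real.sinh (x.1 i) ^ 2)⁻¹ : ℝ) : ℂ) := rfl

theorem invCoshSqOne_val (i : Fin N) (x : regularSet N) :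
    (invCoshSqOne i).1 x = (((Real.cosh (x.1 i) ^ 2)⁻¹ : ℝ) : ℂ) := rfl

theorem one_sub_tanh_sq (t : ℝ) : 1 - Real.tanh t ^ 2 = (Real.cosh t ^ 2)⁻¹ := by
  have := (Real.cosh_pos t).ne'
  rw [Real.tanh_eq_sinh_div_cosh]
  field_simp
  have := Real.cosh_sq t
  linarith

theorem hasDerivAt_tanh' (t : ℝ) : HasDerivAt Real.tanh (Real.cosh t ^ 2)⁻¹ t := by
  have h := (Real.hasDerivAt_sinh t).div (Real.hasDerivAt_cosh t) (Real.cosh_pos t).ne'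
  have e : Real.tanh = fun t => Real.sinh t / Real.cosh t :=
    funext Real.tanh_eq_sinh_div_cosh
  rw [e]
  refine h.congr_deriv ?_
  rw [inv_eq_one_div]
  congr 1
  have := Real.cosh_sq t
  linarith

theorem partialD_potCoeff (b b' : ℝ) (i : Fin N) :
    partialD i (potCoeff b b' i) = -((b : ℂ) • invSinhSqOne i) + (b' : ℂ) • invCoshSqOne i := by
  refine partialD_eq_of_hasDerivAt i
    (fun y => b * (1 + coth (y i)) + b' * (1 + Real.tanh (y i)))
    (fun y => b * (-(Real.sinh (y i) ^ 2)⁻¹) + b' * (Real.cosh (y i) ^ 2)⁻¹)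
    (potCoeff_val b b' i) (fun x => ?_) fun x hx => ?_
  · simp only [Smooth.add_val, Smooth.neg_val, Smooth.smul_val, invSinhSqOne_val,
      invCoshSqOne_val]
    push_cast
    ring
  · have h1 : HasDerivAt (fun t : ℝ => (x + t • (Pi.single i 1 : Fin N → ℝ)) i) 1 0 := by
      simpa using (hasDerivAt_id (0 : ℝ)).const_add (x i)
    have e : (x + (0 : ℝ) • (Pi.single i 1 : Fin N → ℝ)) i = x i := by simp
    have h2 := HasDerivAt.comp (0 : ℝ) (h₂ := coth)
      (h := fun t : ℝ => (x + t • (Pi.single i 1 : Fin N → ℝ)) i)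
      (by rw [e]; exact hasDerivAt_coth (hx.1 i)) h1
    have h3 := HasDerivAt.comp (0 : ℝ) (h₂ := Real.tanh)
      (h := fun t : ℝ => (x + t • (Pi.single i 1 : Fin N → ℝ)) i)
      (by rw [e]; exact hasDerivAt_tanh' (x i)) h1
    have h4 := ((h2.const_add 1).const_mul b).add ((h3.const_add 1).const_mul b')
    rw [mul_one, mul_one] at h4
    exact h4

theorem dx_pot_anticomm (b b' : ℝ) (i : Fin N) :
    ofD (dx i) * pot b b' i + pot b b' i * ofD (dx i) =
      -((b : ℂ) • tm (invSinhSqOne i) (wFlip i)) + (b' : ℂ) • tm (invCoshSqOne i) (wFlip i) := by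
  rw [pot, ofD_dx_mul_tm, tm_mul_ofD_dx, partialD_potCoeff, tm_add, tm_neg, tm_smul, tm_smul]
  simp [wFlip]

theorem pot_sq (b b' : ℝ) (i : Fin N) :
    pot b b' i * pot b b' i =
      -((b ^ 2 : ℂ) • tm (invSinhSqOne i) 1) + (b' ^ 2 : ℂ) • tm (invCoshSqOne i) 1 := by
  rw [pot, tm_mul, wFlip_mul_self, ← tm_smul, ← tm_smul, ← tm_neg, ← tm_add]
  congr 1
  refine Smooth.ext fun x => ?_
  simp only [Smooth.mul_val, Smooth.add_val, Smooth.neg_val, Smooth.smul_val, opK_wFlip_val,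
    potCoeff_val, actReg_wFlip_apply, if_pos, coth_neg, Real.tanh_neg, invSinhSqOne_val,
    invCoshSqOne_val]
  rw [← one_sub_tanh_sq, ← neg_neg (Real.sinh (x.1 i) ^ 2)⁻¹, ← one_sub_coth_sq (x.2.1 i)]
  -- The cross term of the product is 2bb'(1 − coth tanh), so no term mixing b and b' survives.
  have h1 : coth (x.1 i) * Real.tanh (x.1 i) = 1 := by
    have := sinh_ne_zero (x.2.1 i)
    have := (Real.cosh_pos (x.1 i)).ne'
    rw [Real.tanh_eq_sinh_div_cosh, coth]
    field_simp
  have := congrArg (fun t : ℝ => (t : ℂ)) h1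
  push_cast at this ⊢
  linear_combination (-2 * b * b' : ℂ) * this

theorem powerSum_one (a b b' : ℝ) :
    powerSum N a b b' 1 =
      ∑ i, ofD (dx i ^ 2) -
      (∑ i : Fin N, ∑ j ∈ Finset.Ioi i,
        (-2 * a : ℂ) • (tm (invSq 1 i j) (tau 1 i j) + tm (invSq (-1) i j) (tau (-1) i j))) -
      (∑ i, (-((b : ℂ) • tm (invSinhSqOne i) (wFlip i)) +
        (b' : ℂ) • tm (invCoshSqOne i) (wFlip i))) +
      (∑ i : Fin N, ∑ j ∈ Finset.Ioi i,
        (-2 * a ^ 2 : ℂ) • (tm (invSq 1 i j) 1 + tm (invSq (-1) i j) 1)) +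
      ∑ i, (-((b ^ 2 : ℂ) • tm (invSinhSqOne i) 1) + (b' ^ 2 : ℂ) • tm (invCoshSqOne i) 1) := by
  -- The vanishing sum of the anticommutators of R and P is inserted, so that both sides agree for
  -- each i as the expansion of (∂_i − ∑ R_ik − P_i)².
  rw [← sum_exch_sq, ← sum_dx_exch, ← add_zero (∑ i : Fin N, (∑ k ∈ _, _) * _),
    ← sum_exch_pot a b b']
  simp only [← dx_pot_anticomm, ← pot_sq]
  simp only [powerSum, ← Finset.sum_add_distrib, ← Finset.sum_sub_distrib]
  refine Finset.sum_congr rfl fun i _ => ?_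
  rw [mul_one, dunklJ_eq, sq, sq, ofD_mul]
  noncomm_ring

end Squares

/-! ### The image of the quadratic power sum under the star mapping -/

section Hamiltonian

variable {N : ℕ} (m : ℕ)

theorem DS.neg_smul (z : ℂ) (A : DS N m) : (-z) • A = -(z • A) := _root_.neg_smul z A

theorem DS.smul_neg (z : ℂ) (A : DS N m) : z • (-A) = -(z • A) := _root_.smul_neg z A

/-- K_ij is one generator and K_i K_j K_ij is three, so the star mapping attaches the same minus
sign to both. -/
theorem parity_tau (e : ℤˣ) {i j : Fin N} (h : i ≠ j) : parity (tau e i j) = -1 := by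
  have h1 : parity (wSwap i j) = -1 := by simp [parity, wSwap, Equiv.Perm.sign_swap h]
  have h2 : ∀ k : Fin N, parity (wFlip k) = -1 := fun k => by
    simp [parity, wFlip, Finset.prod_update_of_mem]
  rcases Int.units_eq_one_or e with rfl | rfl
  · rw [tau_one, h1]
  · rw [tau_neg_one h, map_mul, map_mul, h1, h2, h2]
    rfl

theorem starHom_tm_one (f : Smooth N) : starHom N m (tm f 1) = mulOp f ⊗ₜ[ℂ] 1 := by
  rw [starHom_apply, tm, starMap_single]
  simp

theorem starHom_ofD (D : DiffOp N) : starHom N m (ofD D) = D ⊗ₜ[ℂ] 1 := by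
  rw [starHom_apply, ofD, starMap_single]
  simp

theorem starHom_tm_wFlip (f : Smooth N) (i : Fin N) :
    starHom N m (tm f (wFlip i)) = -(mulOp f ⊗ₜ[ℂ] S₁ m i) := by
  have h2 : parity (wFlip i) = -1 := by
    simp [parity, wFlip, Finset.prod_update_of_mem]
  rw [starHom_apply, tm, starMap_single, wFlip_inv, opS_wFlip, h2]
  simp [DS.neg_smul]

theorem starHom_tm_tau_one (f : Smooth N) {i j : Fin N} (h : i ≠ j) :
    starHom N m (tm f (tau 1 i j)) = -(mulOp f ⊗ₜ[ℂ] S₂ m i j) := by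
  rw [starHom_apply, tm, starMap_single, tau_inv, parity_tau 1 h, tau_one, opS_wSwap]
  simp [DS.neg_smul]

theorem starHom_tm_tau_neg_one (f : Smooth N) {i j : Fin N} (h : i ≠ j) :
    starHom N m (tm f (tau (-1) i j)) = -(mulOp f ⊗ₜ[ℂ] St m i j) := by
  rw [starHom_apply, tm, starMap_single, tau_inv, parity_tau _ h, tau_neg_one h, map_mul, map_mul,
    opS_wSwap, opS_wFlip, opS_wFlip]
  simp [DS.neg_smul, St]

theorem hamiltonian_eq_neg_starIntegral (a b b' : ℝ) :
    hamiltonian N m a b b' = -starIntegral N m a b b' 1 := by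
  have e2 : ∑ i : Fin N, ∑ j ∈ Finset.Ioi i, starHom N m
      ((-2 * a : ℂ) • (tm (invSq 1 i j) (tau 1 i j) + tm (invSq (-1) i j) (tau (-1) i j))) =
      (2 * a : ℂ) • ∑ i : Fin N, ∑ j ∈ Finset.Ioi i, (mulOp (invSinhSqMinus i j) ⊗ₜ[ℂ] S₂ m i j +
        mulOp (invSinhSqPlus i j) ⊗ₜ[ℂ] St m i j) := by
    simp only [Finset.smul_sum]
    refine Finset.sum_congr rfl fun i _ => Finset.sum_congr rfl fun j hj => ?_
    have h := (Finset.mem_Ioi.1 hj).ne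
    rw [starHom_smul, map_add, starHom_tm_tau_one _ _ h, starHom_tm_tau_neg_one _ _ h,
      show invSq 1 i j = invSinhSqMinus i j from rfl,
      show invSq (-1) i j = invSinhSqPlus i j from if_neg (by decide), neg_mul, DS.neg_smul,
      ← DS.smul_neg,      neg_add, neg_neg, neg_neg]
  have e3 : ∑ i : Fin N, ∑ j ∈ Finset.Ioi i, starHom N m
      ((-2 * a ^ 2 : ℂ) • (tm (invSq 1 i j) 1 + tm (invSq (-1) i j) 1)) =
      (-(2 * a) : ℂ) • ∑ i : Fin N, ∑ j ∈ Finset.Ioi i, (a : ℂ) •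
        (mulOp (invSinhSqMinus i j) ⊗ₜ[ℂ] (1 : Module.End ℂ (Spin N m)) +
        mulOp (invSinhSqPlus i j) ⊗ₜ[ℂ] 1) := by
    simp only [Finset.smul_sum]
    refine Finset.sum_congr rfl fun i _ => Finset.sum_congr rfl fun j hj => ?_
    rw [starHom_smul, map_add, starHom_tm_one, starHom_tm_one,
      show invSq 1 i j = invSinhSqMinus i j from rfl,
      show invSq (-1) i j = invSinhSqPlus i j from if_neg (by decide), smul_smul]
    congr 1
    ring
  rw [starIntegral, ← starHom_apply, powerSum_one]
  simp only [map_add, map_sub, map_sum] at e2 e3 ⊢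
  rw [e2, e3]
  simp only [map_neg, starHom_smul, starHom_ofD, starHom_tm_one, starHom_tm_wFlip, hamiltonian,
    TensorProduct.tmul_add, TensorProduct.tmul_smul, Finset.sum_add_distrib, smul_add,
    Finset.sum_neg_distrib, Finset.smul_sum, DS.smul_neg, DS.neg_smul, sq, mul_smul]
  abel

end Hamiltonian

/-! ### Algebraic independence of power sums -/

section PowerSums

open MvPolynomial

/-- The kernels of the powers of f stabilize at some n. An element x = fⁿ(y) of ker f has y in ker
fⁿ⁺¹ = ker fⁿ, so x = 0. -/
theorem ringHom_injective_of_surjective {R : Type*} [CommRing R] [IsNoetherianRing R]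
    (f : R →+* R) (hf : Function.Surjective f) : Function.Injective f := by
  let c : ℕ →o Ideal R := ⟨fun n => RingHom.ker (f ^ n), monotone_nat_of_le_succ fun n x hx => by
    rw [RingHom.mem_ker] at hx ⊢
    rw [pow_succ', RingHom.mul_def, RingHom.comp_apply, hx, map_zero]⟩
  obtain ⟨n, hn⟩ := monotone_stabilizes_iff_noetherian.2 ‹_› c
  rw [injective_iff_map_eq_zero]
  intro x hx
  have hs : Function.Surjective (f ^ n) := by
    rw [RingHom.coe_pow]; exact hf.iterate n
  obtain ⟨y, rfl⟩ := hs x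
  have h1 : y ∈ c (n + 1) := by
    change y ∈ RingHom.ker (f ^ (n + 1))
    rwa [RingHom.mem_ker, pow_succ', RingHom.mul_def, RingHom.comp_apply]
  rw [← hn (n + 1) n.le_succ] at h1
  exact h1

/-- The evaluation of polynomials at the power sums. -/
def psumHom (n : ℕ) : MvPolynomial (Fin n) ℂ →ₐ[ℂ] symmetricSubalgebra (Fin n) ℂ :=
  aeval fun i => ⟨psum (Fin n) ℂ (i + 1), psum_isSymmetric _ _ _⟩

/-- Newton's identity expresses k e_k through e_l with l < k and the power sums of degree at most k.
In characteristic zero it can be divided by k. -/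
theorem esymm_mem_range_psumHom (n k : ℕ) (hk : k ≤ n) :
    (⟨esymm (Fin n) ℂ k, esymm_isSymmetric _ _ _⟩ : symmetricSubalgebra (Fin n) ℂ) ∈
      (psumHom n).range := by
  induction k using Nat.strong_induction_on with
  | _ k ih =>
    rcases Nat.eq_zero_or_pos k with rfl | hpos
    · have h0 : (⟨esymm (Fin n) ℂ 0, esymm_isSymmetric _ _ _⟩ :
          symmetricSubalgebra (Fin n) ℂ) = 1 := Subtype.ext (esymm_zero (Fin n) ℂ)
      rw [h0]
      exact (psumHom n).range.one_mem
    · have hp : ∀ l, 0 < l → l ≤ n →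
          (⟨psum (Fin n) ℂ l, psum_isSymmetric _ _ _⟩ : symmetricSubalgebra (Fin n) ℂ) ∈
            (psumHom n).range := by
        intro l hl hln
        -- Variables are numbered from 0, so the variable of index l − 1 is sent to the power sum of
        -- degree l.
        refine ⟨X ⟨l - 1, by omega⟩, ?_⟩
        change psumHom n (X _) = _
        rw [psumHom, aeval_X]
        refine Subtype.ext ?_
        change psum (Fin n) ℂ (l - 1 + 1) = _
        rw [Nat.sub_add_cancel hl]
      have hsum : ((k : ℂ) • (⟨esymm (Fin n) ℂ k, esymm_isSymmetric _ _ _⟩ :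
          symmetricSubalgebra (Fin n) ℂ)) = (-1) ^ (k + 1) *
          ∑ a ∈ Finset.HasAntidiagonal.antidiagonal k with a.1 < k, (-1) ^ a.1 *
            (⟨esymm (Fin n) ℂ a.1, esymm_isSymmetric _ _ _⟩ : symmetricSubalgebra (Fin n) ℂ) *
            ⟨psum (Fin n) ℂ a.2, psum_isSymmetric _ _ _⟩ := by
        refine Subtype.ext ?_
        have := mul_esymm_eq_sum (Fin n) ℂ k
        simp only [Subalgebra.coe_smul, Subalgebra.coe_mul, Subalgebra.coe_pow, Subalgebra.coe_neg,
          Subalgebra.coe_one, AddSubmonoidClass.coe_finsetSum]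
        rw [← this, Algebra.smul_def]
        simp
      have hmem : ((k : ℂ) • (⟨esymm (Fin n) ℂ k, esymm_isSymmetric _ _ _⟩ :
          symmetricSubalgebra (Fin n) ℂ)) ∈ (psumHom n).range := by
        rw [hsum]
        have hneg : (-1 : symmetricSubalgebra (Fin n) ℂ) ∈ (psumHom n).range :=
          (psumHom n).range.neg_mem (psumHom n).range.one_mem
        refine (psumHom n).range.mul_mem (pow_mem hneg _) (sum_mem fun a ha => ?_)
        rw [Finset.mem_filter, Finset.HasAntidiagonal.mem_antidiagonal] at ha
        exact mul_mem (mul_mem (pow_mem hneg _) (ih a.1 ha.2 (by omega)))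
          (hp a.2 (by omega) (by omega))
      have hk0 : (k : ℂ) ≠ 0 := by exact_mod_cast hpos.ne'
      have := (psumHom n).range.smul_mem hmem (k : ℂ)⁻¹
      rwa [smul_smul, inv_mul_cancel₀ hk0, one_smul] at this

theorem psumHom_surjective (n : ℕ) : Function.Surjective (psumHom n) := by
  rw [← AlgHom.range_eq_top, eq_top_iff]
  rintro p -
  obtain ⟨q, rfl⟩ := (esymmAlgHom_fin_bijective ℂ n).2 p
  induction q using MvPolynomial.induction_on with
  | C c => rw [esymmAlgHom, aeval_C]; exact (psumHom n).range.algebraMap_mem c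
  | add p q hp hq => rw [map_add]; exact add_mem hp hq
  | mul_X p i hp =>
    rw [map_mul]
    refine mul_mem hp ?_
    rw [esymmAlgHom, aeval_X]
    exact esymm_mem_range_psumHom n (i + 1) i.2

/-- The symmetric polynomials are again a polynomial ring in n variables, on the elementary ones.
The surjection `psumHom` thus becomes a surjective endomorphism of a Noetherian ring. -/
theorem psumHom_injective (n : ℕ) : Function.Injective (psumHom n) := by
  let e := esymmAlgEquiv (Fin n) ℂ (Fintype.card_fin n)
  have h := ringHom_injective_of_surjective
    ((e.symm : symmetricSubalgebra (Fin n) ℂ →ₐ[ℂ] MvPolynomial (Fin n) ℂ).comp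
      (psumHom n)).toRingHom (e.symm.surjective.comp (psumHom_surjective n))
  exact Function.Injective.of_comp (f := e.symm) h

/-- The symbol of the `k`-th integral of motion: the power sum of degree `2 (k + 1)`. -/
def evenPsum (n : ℕ) (k : Fin n) : MvPolynomial (Fin n) ℂ := ∑ i, X i ^ (2 * (k.val + 1))

theorem evenPsum_isHomogeneous (n : ℕ) (k : Fin n) :
    (evenPsum n k).IsHomogeneous (2 * (k.val + 1)) :=
  IsHomogeneous.sum _ _ _ fun i _ => by
    simpa using (isHomogeneous_X ℂ i).pow (2 * (k.val + 1))

/-- Even power sums are ordinary power sums in the squares of the variables, and the substitution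
X_i ↦ X_i² is injective. -/
theorem aeval_evenPsum_injective (n : ℕ) :
    Function.Injective (aeval (evenPsum n) : MvPolynomial (Fin n) ℂ →ₐ[ℂ] _) := by
  have h : (aeval (evenPsum n) : MvPolynomial (Fin n) ℂ →ₐ[ℂ] MvPolynomial (Fin n) ℂ) =
      ((expand 2).comp (symmetricSubalgebra (Fin n) ℂ).val).comp (psumHom n) := by
    refine algHom_ext fun k => ?_
    simp [psumHom, psum, evenPsum, pow_mul]
  rw [h]
  intro p q hpq
  exact psumHom_injective n (Subtype.val_injective (expand_injective two_pos hpq))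

end PowerSums

/-! ### The order filtration -/

section Filtration

variable {R ι : Type*} [Ring R] (X : ι → R)

/-- The elements of order less than `n` in the sense of Grothendieck: all `n`-fold commutators with
the elements `X i` vanish. -/
def ordLT : ℕ → AddSubgroup R
  | 0 => ⊥
  | n + 1 =>
    { carrier := {D | ∀ i, D * X i - X i * D ∈ ordLT n}
      zero_mem' := fun i => by simp [(ordLT n).zero_mem]
      add_mem' := fun {D E} hD hE i => by
        have := (ordLT n).add_mem (hD i) (hE i)
        rwa [show D * X i - X i * D + (E * X i - X i * E) =
          (D + E) * X i - X i * (D + E) by noncomm_ring] at this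
      neg_mem' := fun {D} hD i => by
        have := (ordLT n).neg_mem (hD i)
        rwa [show -(D * X i - X i * D) = -D * X i - X i * -D by noncomm_ring] at this }

variable {X}

theorem mem_ordLT_zero {D : R} : D ∈ ordLT X 0 ↔ D = 0 := by
  rw [ordLT, AddSubgroup.mem_bot]

theorem mem_ordLT_succ {n : ℕ} {D : R} :
    D ∈ ordLT X (n + 1) ↔ ∀ i, D * X i - X i * D ∈ ordLT X n := by
  rw [ordLT]; rfl

theorem ordLT_le_succ (n : ℕ) : ordLT X n ≤ ordLT X (n + 1) := by
  induction n with
  | zero => rw [ordLT]; exact bot_le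
  | succ n ih => exact fun D hD => mem_ordLT_succ.2 fun i => ih (mem_ordLT_succ.1 hD i)

theorem ordLT_mono : Monotone (ordLT X) := monotone_nat_of_le_succ ordLT_le_succ

/-- Membership at index n + 1 means order at most n, so this is additivity of orders. It follows by
induction from the Leibniz rule for the commutator with X i. -/
theorem mul_mem_ordLT_succ (n m : ℕ) {D E : R} (hD : D ∈ ordLT X (n + 1))
    (hE : E ∈ ordLT X (m + 1)) : D * E ∈ ordLT X (n + m + 1) := by
  induction h : n + m generalizing n m D E with
  | zero =>
    obtain ⟨rfl, rfl⟩ : n = 0 ∧ m = 0 := by omega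
    refine mem_ordLT_succ.2 fun i => mem_ordLT_zero.2 ?_
    have h1 := mem_ordLT_zero.1 (mem_ordLT_succ.1 hD i)
    have h2 := mem_ordLT_zero.1 (mem_ordLT_succ.1 hE i)
    rw [sub_eq_zero] at h1 h2 ⊢
    rw [mul_assoc, h2, ← mul_assoc, h1, mul_assoc]
  | succ k ih =>
    refine mem_ordLT_succ.2 fun i => ?_
    have h1 := mem_ordLT_succ.1 hD i
    have h2 := mem_ordLT_succ.1 hE i
    rw [show D * E * X i - X i * (D * E) =
      D * (E * X i - X i * E) + (D * X i - X i * D) * E by noncomm_ring]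
    refine add_mem ?_ ?_
    · cases m with
      | zero => rw [mem_ordLT_zero.1 h2, mul_zero]; exact zero_mem _
      | succ m => exact ih n m hD h2 (by omega)
    · cases n with
      | zero => rw [mem_ordLT_zero.1 h1, zero_mul]; exact zero_mem _
      | succ n => exact ih n m h1 hE (by omega)

theorem mul_mem_ordLT_left {n m : ℕ} {D E : R} (hD : D ∈ ordLT X n)
    (hE : E ∈ ordLT X (m + 1)) : D * E ∈ ordLT X (n + m) := by
  cases n with
  | zero => rw [mem_ordLT_zero.1 hD, zero_mul]; exact zero_mem _
  | succ n =>
    have := mul_mem_ordLT_succ n m hD hE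
    rwa [add_right_comm] at this

theorem mul_mem_ordLT_right {n m : ℕ} {D E : R} (hD : D ∈ ordLT X (n + 1))
    (hE : E ∈ ordLT X m) : D * E ∈ ordLT X (n + m) := by
  cases m with
  | zero => rw [mem_ordLT_zero.1 hE, mul_zero]; exact zero_mem _
  | succ m => exact mul_mem_ordLT_succ n m hD hE

theorem mem_ordLT_one_of_commute {D : R} (h : ∀ i, Commute D (X i)) : D ∈ ordLT X 1 :=
  mem_ordLT_succ.2 fun i => mem_ordLT_zero.2 (by rw [(h i).eq, sub_self])

end Filtration

/-! ### Orders and leading parts of the Dunkl operators and the integrals -/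

section DifferentialOperators

variable {N : ℕ}

theorem mulOp_mem_ordLT (f : Smooth N) : mulOp f ∈ ordLT (mulOp (N := N)) 1 :=
  mem_ordLT_one_of_commute fun g => mulOp_comm f g

theorem dx_mem_ordLT (i : Fin N) : (dx i : DiffOp N) ∈ ordLT (mulOp (N := N)) 2 := by
  refine mem_ordLT_succ.2 fun f => ?_
  rw [dx_mul_mulOp, add_sub_cancel_right]
  exact mulOp_mem_ordLT _

theorem smul_mem_ordLT (w : WeylGroup N) {n : ℕ} {D : DiffOp N}
    (h : D ∈ ordLT (mulOp (N := N)) n) : w • D ∈ ordLT (mulOp (N := N)) n := by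
  induction n generalizing D with
  | zero => rw [mem_ordLT_zero.1 h, smul_zero]; exact zero_mem _
  | succ n ih =>
    refine mem_ordLT_succ.2 fun f => ?_
    -- Conjugation by K_w permutes the multiplication operators, so it carries commutators with
    -- functions to such commutators.
    have hf : mulOp f = w • mulOp (opK w⁻¹ f) := by
      rw [smul_mulOp, ← Module.End.mul_apply, opK_mul_cancel, Module.End.one_apply]
    rw [hf, ← smul_mul', ← smul_mul', ← smul_sub]
    exact ih (mem_ordLT_succ.1 h _)

/-- The elements of `𝔇 ⊗ 𝔎` whose coefficients are differential operators of order less than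
`n`. -/
def ordK (N n : ℕ) : AddSubgroup (DK N) :=
  AddSubgroup.closure {A | ∃ w, ∃ D ∈ ordLT (mulOp (N := N)) n, A = SkewMonoidAlgebra.single w D}

theorem single_mem_ordK {n : ℕ} (w : WeylGroup N) {D : DiffOp N}
    (h : D ∈ ordLT (mulOp (N := N)) n) : SkewMonoidAlgebra.single w D ∈ ordK N n :=
  AddSubgroup.subset_closure ⟨w, D, h, rfl⟩

theorem ordK_mono : Monotone (ordK N) := fun n m h => by
  refine (AddSubgroup.closure_le _).2 ?_
  rintro _ ⟨w, D, hD, rfl⟩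
  exact single_mem_ordK w (ordLT_mono h hD)

theorem mul_mem_ordK {n m k : ℕ} (h : ∀ D ∈ ordLT (mulOp (N := N)) n,
    ∀ E ∈ ordLT (mulOp (N := N)) m, D * E ∈ ordLT (mulOp (N := N)) k) {A B : DK N}
    (hA : A ∈ ordK N n) (hB : B ∈ ordK N m) : A * B ∈ ordK N k := by
  induction hA using AddSubgroup.closure_induction with
  | zero => rw [zero_mul]; exact zero_mem _
  | add A A' _ _ hA hA' => rw [add_mul]; exact add_mem hA hA'
  | neg A _ hA => rw [neg_mul]; exact neg_mem hA
  | mem A hA =>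
    obtain ⟨v, D, hD, rfl⟩ := hA
    induction hB using AddSubgroup.closure_induction with
    | zero => rw [mul_zero]; exact zero_mem _
    | add A A' _ _ hA hA' => rw [mul_add]; exact add_mem hA hA'
    | neg A _ hA => rw [mul_neg]; exact neg_mem hA
    | mem B hB =>
      obtain ⟨w, E, hE, rfl⟩ := hB
      rw [SkewMonoidAlgebra.single_mul_single]
      exact single_mem_ordK _ (h _ hD _ (smul_mem_ordLT v hE))

theorem dunklJ_sub_mem_ordK (a b b' : ℝ) (i : Fin N) :
    dunklJ a b b' i - ofD (dx i) ∈ ordK N 1 := by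
  have h : dunklJ a b b' i - ofD (dx i) =
      -(∑ j ∈ Finset.univ.erase i, exch a i j + pot b b' i) := by
    rw [dunklJ_eq]; abel
  rw [h]
  refine neg_mem (add_mem (sum_mem fun j _ => sum_mem fun e _ => ?_) ?_)
  · exact single_mem_ordK _ (mulOp_mem_ordLT _)
  · exact single_mem_ordK _ (mulOp_mem_ordLT _)

theorem dunklJ_mem_ordK (a b b' : ℝ) (i : Fin N) : dunklJ a b b' i ∈ ordK N 2 := by
  have := add_mem (ordK_mono one_le_two (dunklJ_sub_mem_ordK a b b' i))
    (single_mem_ordK 1 (dx_mem_ordLT i))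
  rwa [ofD, sub_add_cancel] at this

theorem dx_pow_mem_ordLT (i : Fin N) (n : ℕ) :
    (dx i ^ n : DiffOp N) ∈ ordLT (mulOp (N := N)) (n + 1) := by
  induction n with
  | zero => rw [pow_zero, ← mulOp_one]; exact mulOp_mem_ordLT 1
  | succ n ih => rw [pow_succ]; exact mul_mem_ordLT_succ n 1 ih (dx_mem_ordLT i)

theorem dunklJ_pow_sub_mem_ordK (a b b' : ℝ) (i : Fin N) (n : ℕ) :
    dunklJ a b b' i ^ n - ofD (dx i ^ n) ∈ ordK N n := by
  induction n with
  | zero => rw [pow_zero, pow_zero, show (ofD (1 : DiffOp N)) = 1 from rfl, sub_self]; exact zero_mem _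
  | succ n ih =>
    have h : dunklJ a b b' i ^ (n + 1) - ofD (dx i ^ (n + 1)) =
        (dunklJ a b b' i ^ n - ofD (dx i ^ n)) * dunklJ a b b' i +
          ofD (dx i ^ n) * (dunklJ a b b' i - ofD (dx i)) := by
      rw [pow_succ, pow_succ, ofD_mul]
      noncomm_ring
    rw [h]
    exact add_mem
      (mul_mem_ordK (fun D hD E hE => mul_mem_ordLT_left hD hE) ih (dunklJ_mem_ordK a b b' i))
      (mul_mem_ordK (fun D hD E hE => mul_mem_ordLT_succ n 0 hD hE)
        (single_mem_ordK 1 (dx_pow_mem_ordLT i n)) (dunklJ_sub_mem_ordK a b b' i))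

variable (m : ℕ)

/-- Multiplication by a function, on the spin wave functions. -/
def mulSpin (N m : ℕ) (f : Smooth N) : DS N m := mulOp f ⊗ₜ[ℂ] 1

theorem tmul_mem_ordLT {n : ℕ} {D : DiffOp N} (h : D ∈ ordLT (mulOp (N := N)) n)
    (e : Module.End ℂ (Spin N m)) : D ⊗ₜ[ℂ] e ∈ ordLT (mulSpin N m) n := by
  induction n generalizing D with
  | zero => rw [mem_ordLT_zero.1 h, TensorProduct.zero_tmul]; exact zero_mem _
  | succ n ih =>
    refine mem_ordLT_succ.2 fun f => ?_
    rw [mulSpin, Algebra.TensorProduct.tmul_mul_tmul, Algebra.TensorProduct.tmul_mul_tmul,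
      mul_one, one_mul, ← TensorProduct.sub_tmul]
    exact ih (mem_ordLT_succ.1 h f)

theorem starHom_mem_ordLT {n : ℕ} {A : DK N} (hA : A ∈ ordK N n) :
    starHom N m A ∈ ordLT (mulSpin N m) n := by
  induction hA using AddSubgroup.closure_induction with
  | zero => rw [map_zero]; exact zero_mem _
  | add A A' _ _ hA hA' => rw [map_add]; exact add_mem hA hA'
  | neg A _ hA => rw [map_neg]; exact neg_mem hA
  | mem A hA =>
    obtain ⟨w, D, hD, rfl⟩ := hA
    rw [starHom_apply, starMap_single]
    exact tmul_mem_ordLT m hD _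

theorem starIntegral_sub_mem_ordLT (a b b' : ℝ) (p : ℕ) :
    starIntegral N m a b b' p - ∑ i, (dx i ^ (2 * p)) ⊗ₜ[ℂ] 1 ∈ ordLT (mulSpin N m) (2 * p) := by
  have : starIntegral N m a b b' p - ∑ i, (dx i ^ (2 * p)) ⊗ₜ[ℂ] 1 =
      ∑ i, starHom N m (dunklJ a b b' i ^ (2 * p) - ofD (dx i ^ (2 * p))) := by
    rw [starIntegral, ← starHom_apply, powerSum, map_sum, ← Finset.sum_sub_distrib]
    exact Finset.sum_congr rfl fun i _ => by rw [map_sub, starHom_ofD]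
  rw [this]
  exact sum_mem fun i _ => starHom_mem_ordLT m (dunklJ_pow_sub_mem_ordK a b b' i _)

end DifferentialOperators

/-! ### Differential operators with constant coefficients -/

section ConstantCoefficients

open MvPolynomial

variable {N : ℕ}

/-- The commutative algebra of differential operators with constant coefficients. -/
abbrev constOps (N : ℕ) : Subalgebra ℂ (DiffOp N) :=
  Algebra.adjoin ℂ (Set.range fun i : Fin N => (dx i : DiffOp N))

instance (N : ℕ) : IsMulCommutative (constOps N) :=
  Algebra.isMulCommutative_adjoin ℂ (by
    rintro _ ⟨i, rfl⟩ _ ⟨j, rfl⟩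
    exact dx_comm i j)

open scoped IsMulCommutative in
/-- The differential operator `P(∂)` with constant coefficients. -/
def dxHom (N : ℕ) : MvPolynomial (Fin N) ℂ →ₐ[ℂ] DiffOp N :=
  (constOps N).val.comp (aeval fun i => (⟨dx i, Algebra.subset_adjoin ⟨i, rfl⟩⟩ : constOps N))

theorem dxHom_X (i : Fin N) : dxHom N (X i) = dx i := by
  simp [dxHom]

/-- A coordinate function. -/
def coord (i : Fin N) : Smooth N :=
  ofRealFun (fun x => x i) (contDiff_apply ℝ ℝ i).contDiffOn

theorem partialD_coord (i j : Fin N) :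
    partialD j (coord i) = if i = j then 1 else 0 := by
  refine partialD_eq_of_hasDerivAt j (fun y => y i) (fun _ => if i = j then 1 else 0)
    (fun _ => rfl) (fun x => by split_ifs <;> simp) fun x _ => ?_
  have := ((hasDerivAt_id (0 : ℝ)).mul_const ((Pi.single j 1 : Fin N → ℝ) i)).const_add (x i)
  simpa [Pi.single_apply] using this

/-- Commutation with a coordinate differentiates the symbol. Both operations are derivations, so the
generators ∂_j decide. -/
theorem dxHom_mul_coord_sub (i : Fin N) (P : MvPolynomial (Fin N) ℂ) :
    dxHom N P * mulOp (coord i) - mulOp (coord i) * dxHom N P = dxHom N (pderiv i P) := by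
  induction P using MvPolynomial.induction_on with
  | C c =>
    rw [pderiv_C, map_zero, ← algebraMap_eq, AlgHom.commutes, ← Algebra.commutes, sub_self]
  | add P Q hP hQ =>
    rw [map_add, map_add, map_add, ← hP, ← hQ]
    noncomm_ring
  | mul_X P j hP =>
    have h : dx j * mulOp (coord i) - mulOp (coord i) * dx j =
        dxHom N ((Pi.single i 1 : Fin N → MvPolynomial (Fin N) ℂ) j) := by
      rw [dx_mul_mulOp, add_sub_cancel_right, partialD_coord]
      rcases eq_or_ne i j with rfl | h
      · simp [mulOp_one]
      · simp [mulOp_zero, h, h.symm]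
    rw [pderiv_mul, pderiv_X, map_add, map_mul, map_mul, map_mul, ← hP, ← h, dxHom_X]
    noncomm_ring

variable (m : ℕ)

/-- `P(∂)` acting on spin wave functions. -/
def symHom (N m : ℕ) : MvPolynomial (Fin N) ℂ →ₐ[ℂ] DS N m :=
  (Algebra.TensorProduct.includeLeft : DiffOp N →ₐ[ℂ] DS N m).comp (dxHom N)

theorem symHom_apply (P : MvPolynomial (Fin N) ℂ) : symHom N m P = dxHom N P ⊗ₜ[ℂ] 1 := rfl

instance (N : ℕ) : Nontrivial (DiffOp N) := by
  -- The point (1, 2, …, N) lies on no wall, so the configuration space is not empty.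
  have x : regularSet N := ⟨fun i => (i : ℝ) + 1, fun i => by positivity, fun i j hij =>
    ⟨fun h => hij (Fin.ext (by
      have : (i : ℝ) = j := by linarith
      exact_mod_cast this)), by positivity⟩⟩
  refine ⟨⟨0, 1, fun h => ?_⟩⟩
  rw [← mulOp_zero, ← mulOp_one] at h
  have := congrArg (fun f : Smooth N => f.1 x) (mulOp_injective h)
  simp at this

theorem symHom_C (c : ℂ) : symHom N m (C c) = c • (1 : DS N m) := by
  rw [symHom_apply, ← algebraMap_eq, AlgHom.commutes, Algebra.algebraMap_eq_smul_one]
  rfl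

theorem includeLeft_DS_injective : Function.Injective
    (Algebra.TensorProduct.includeLeft : DiffOp N →ₐ[ℂ] DS N m) :=
  Algebra.TensorProduct.includeLeft_injective (algebraMap ℂ _).injective

/-- A homogeneous polynomial in the derivatives does not have lower order. -/
theorem eq_zero_of_symHom_mem_ordLT (n : ℕ) {P : MvPolynomial (Fin N) ℂ} (hP : P.IsHomogeneous n)
    (h : symHom N m P ∈ ordLT (mulSpin N m) n) : P = 0 := by
  induction n generalizing P with
  | zero =>
    obtain ⟨c, rfl⟩ : ∃ c, P = C c :=
      ⟨_, totalDegree_eq_zero_iff_eq_C.1 (Nat.le_zero.1 hP.totalDegree_le)⟩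
    have h0 := (map_eq_zero_iff _ (includeLeft_DS_injective m)).1 (mem_ordLT_zero.1 h)
    change dxHom N (C c) = 0 at h0
    rw [← algebraMap_eq, AlgHom.commutes] at h0
    rw [(map_eq_zero_iff _ (algebraMap ℂ (DiffOp N)).injective).1 h0, map_zero]
  | succ n ih =>
    have hd : ∀ i, pderiv i P = 0 := fun i => by
      refine ih hP.pderiv ?_
      have := mem_ordLT_succ.1 h (coord i)
      rwa [symHom_apply, mulSpin, Algebra.TensorProduct.tmul_mul_tmul,
        Algebra.TensorProduct.tmul_mul_tmul, mul_one, ← TensorProduct.sub_tmul,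
        dxHom_mul_coord_sub] at this
    -- By Euler's identity a homogeneous polynomial of degree n + 1 with vanishing derivatives is
    -- zero.
    have := hP.sum_X_mul_pderiv
    simp only [hd, mul_zero, Finset.sum_const_zero] at this
    rw [eq_comm, ← Nat.cast_smul_eq_nsmul ℂ] at this
    exact (smul_eq_zero.1 this).resolve_left (by exact_mod_cast n.succ_ne_zero)

/-- `D` has the leading part `P(∂)`, of order `n`. -/
def HasSymbol (n : ℕ) (D : DS N m) (P : MvPolynomial (Fin N) ℂ) : Prop :=
  symHom N m P ∈ ordLT (mulSpin N m) (n + 1) ∧ D - symHom N m P ∈ ordLT (mulSpin N m) n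

variable {m}

theorem HasSymbol.mem {n : ℕ} {D : DS N m} {P : MvPolynomial (Fin N) ℂ} (h : HasSymbol m n D P) :
    D ∈ ordLT (mulSpin N m) (n + 1) := by
  have := add_mem (ordLT_le_succ n h.2) h.1
  rwa [sub_add_cancel] at this

theorem HasSymbol.mul {n k : ℕ} {D E : DS N m} {P Q : MvPolynomial (Fin N) ℂ}
    (h : HasSymbol m n D P) (h' : HasSymbol m k E Q) : HasSymbol m (n + k) (D * E) (P * Q) := by
  refine ⟨by rw [map_mul]; exact mul_mem_ordLT_succ n k h.1 h'.1, ?_⟩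
  have : D * E - symHom N m (P * Q) =
      (D - symHom N m P) * E + symHom N m P * (E - symHom N m Q) := by
    rw [map_mul, sub_mul, mul_sub]; abel
  rw [this]
  exact add_mem (mul_mem_ordLT_left h.2 h'.mem) (mul_mem_ordLT_right h.1 h'.2)

theorem hasSymbol_C (c : ℂ) : HasSymbol (N := N) m 0 (c • (1 : DS N m)) (C c) := by
  refine ⟨?_, by rw [symHom_C, sub_self]; exact zero_mem _⟩
  rw [symHom_C]
  exact mem_ordLT_one_of_commute fun f => (Commute.one_left _).smul_left c

theorem hasSymbol_one : HasSymbol (N := N) m 0 1 1 := by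
  simpa using hasSymbol_C (N := N) (m := m) 1

theorem HasSymbol.pow {n : ℕ} {D : DS N m} {P : MvPolynomial (Fin N) ℂ} (h : HasSymbol m n D P)
    (d : ℕ) : HasSymbol m (d * n) (D ^ d) (P ^ d) := by
  induction d with
  | zero => simpa using hasSymbol_one
  | succ d ih => rw [pow_succ, pow_succ, add_mul, one_mul]; exact ih.mul h

theorem hasSymbol_prod {k : ℕ} {e : Fin k → ℕ} {D : Fin k → DS N m}
    {P : Fin k → MvPolynomial (Fin N) ℂ} (h : ∀ j, HasSymbol m (e j) (D j) (P j)) :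
    HasSymbol m (∑ j, e j) (List.ofFn D).prod (∏ j, P j) := by
  induction k with
  | zero => simpa using hasSymbol_one
  | succ k ih =>
    rw [List.ofFn_succ, List.prod_cons, Fin.sum_univ_succ, Fin.prod_univ_succ]
    exact (h 0).mul (ih fun j => h j.succ)

theorem starIntegral_hasSymbol (a b b' : ℝ) (k : Fin N) :
    HasSymbol m (2 * (k.val + 1)) (starIntegral N m a b b' (k.val + 1)) (evenPsum N k) := by
  have h : symHom N m (evenPsum N k) = ∑ i, (dx i ^ (2 * (k.val + 1))) ⊗ₜ[ℂ] 1 := by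
    rw [evenPsum, map_sum]
    exact Finset.sum_congr rfl fun i _ => by rw [symHom_apply, map_pow, dxHom_X]
  refine ⟨?_, ?_⟩
  · rw [h]
    exact sum_mem fun i _ => tmul_mem_ordLT m (dx_pow_mem_ordLT i _) _
  · rw [h]
    exact starIntegral_sub_mem_ordLT m a b b' _

theorem starIntegral_algIndependent (N m : ℕ) (a b b' : ℝ) :
    AlgIndependent (fun k : Fin N => starIntegral N m a b b' (k.val + 1)) := by
  intro Q hQ
  by_contra hne
  -- The weight is the order of the monomial after substitution, since the integral of index k has
  -- order 2(k + 1).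
  set wt : (Fin N →₀ ℕ) → ℕ := fun d => ∑ k, d k * (2 * (k.val + 1)) with hwt
  obtain ⟨d₀, hd₀, hmax⟩ := Finset.exists_max_image Q.support wt (support_nonempty.2 hne)
  set T : (Fin N →₀ ℕ) → DS N m := fun d =>
    Q.coeff d • (List.ofFn fun k : Fin N => starIntegral N m a b b' (k.val + 1) ^ d k).prod with hT
  set S : (Fin N →₀ ℕ) → MvPolynomial (Fin N) ℂ := fun d =>
    C (Q.coeff d) * ∏ k, evenPsum N k ^ d k with hS
  have hsym : ∀ d, HasSymbol m (wt d) (T d) (S d) := fun d => by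
    have := (hasSymbol_C (N := N) (m := m) (Q.coeff d)).mul
      (hasSymbol_prod fun k : Fin N => (starIntegral_hasSymbol (m := m) a b b' k).pow (d k))
    rw [zero_add, smul_mul_assoc, one_mul] at this
    exact this
  have hhom : (∑ d ∈ Q.support with wt d = wt d₀, S d).IsHomogeneous (wt d₀) := by
    refine IsHomogeneous.sum _ _ _ fun d hd => ?_
    rw [← (Finset.mem_filter.1 hd).2]
    have := (isHomogeneous_C (Fin N) (Q.coeff d)).mul
      (IsHomogeneous.prod Finset.univ (fun k => evenPsum N k ^ d k)
        (fun k => (2 * (k.val + 1)) * d k) fun k _ => (evenPsum_isHomogeneous N k).pow (d k))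
    rw [zero_add] at this
    simpa only [hwt, mul_comm] using this
  have hmem : symHom N m (∑ d ∈ Q.support with wt d = wt d₀, S d) ∈
      ordLT (mulSpin N m) (wt d₀) := by
    -- At top weight, subtracting the leading part lowers the order, and the other terms have lower
    -- order already. Since the T d sum to zero, the sum of the top leading parts has order below
    -- its degree, and being homogeneous it vanishes.
    have h1 : ∑ d ∈ Q.support, (T d - if wt d = wt d₀ then symHom N m (S d) else 0) ∈
        ordLT (mulSpin N m) (wt d₀) := by
      refine sum_mem fun d hd => ?_
      split_ifs with h
      · rw [← h]; exact (hsym d).2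
      · rw [sub_zero]
        exact ordLT_mono (Nat.succ_le_of_lt (lt_of_le_of_ne (hmax d hd) h)) (hsym d).mem
    have h2 : ∑ d ∈ Q.support, T d = 0 := hQ
    rw [Finset.sum_sub_distrib, h2, zero_sub, ← Finset.sum_filter, ← map_sum] at h1
    exact neg_mem_iff.1 h1
  have h0 := eq_zero_of_symHom_mem_ordLT m _ hhom hmem
  have h1 : aeval (evenPsum N) (∑ d ∈ Q.support with wt d = wt d₀, monomial d (Q.coeff d)) =
      (0 : MvPolynomial (Fin N) ℂ) := by
    rw [← h0, map_sum]
    refine Finset.sum_congr rfl fun d _ => ?_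
    rw [aeval_monomial, hS, Finsupp.prod_fintype _ _ fun _ => pow_zero _]
    rfl
  have h2 := (map_eq_zero_iff _ (aeval_evenPsum_injective N)).1 h1
  have h3 := congrArg (coeff d₀) h2
  have h4 := Finset.sum_eq_single_of_mem (s := Q.support.filter fun d => wt d = wt d₀)
    (f := fun d => coeff d₀ (monomial d (Q.coeff d))) d₀ (Finset.mem_filter.2 ⟨hd₀, rfl⟩)
    fun d _ hd => by rw [coeff_monomial, if_neg hd]
  rw [coeff_sum, coeff_zero] at h3
  rw [h3, coeff_monomial, if_pos rfl] at h4
  exact mem_support_iff.1 hd₀ h4.symm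

end ConstantCoefficients

end Sutherland

end

theorem theorem1 (N m : ℕ) (a b b' : ℝ) :
    (∀ i j : Fin N, Commute (Sutherland.dunklJ a b b' i) (Sutherland.dunklJ a b b' j)) ∧
    Sutherland.hamiltonian N m a b b' = -Sutherland.starIntegral N m a b b' 1 ∧
    (∀ p ∈ Finset.Icc 1 N,
      Commute (Sutherland.hamiltonian N m a b b') (Sutherland.starIntegral N m a b b' p)) ∧
    (∀ p ∈ Finset.Icc 1 N, ∀ q ∈ Finset.Icc 1 N,
      Commute (Sutherland.starIntegral N m a b b' p) (Sutherland.starIntegral N m a b b' q)) ∧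
    Sutherland.AlgIndependent
      (fun k : Fin N => Sutherland.starIntegral N m a b b' (k.val + 1)) := by
  refine ⟨Sutherland.dunklJ_commute a b b', Sutherland.hamiltonian_eq_neg_starIntegral m a b b',
    fun p _ => ?_, fun p _ q _ => Sutherland.starIntegral_commute m a b b' p q,
    Sutherland.starIntegral_algIndependent N m a b b'⟩
  rw [Sutherland.hamiltonian_eq_neg_starIntegral]
  exact (Sutherland.starIntegral_commute m a b b' 1 p).neg_left
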